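/- **Setting.** Fix dimensions $d_\eta,d_\Theta,d_Y$. *Model.* Let $\mu$ be a $\sigma$-finite measure on $\mathbb R^{d_Y}$, $T:\mathbb R^{d_Y}\to\mathbb R^{d_\eta}$ and $h:\mathbb R^{d_Y}\to[0,\infty)$ measurable, $h$ not $\mu$-a.e. zero. Put $\Omega=\{\eta:\int e^{\eta^\top T(y)}h(y)\,d\mu(y)<\infty\}$, $A(\eta)=\log\int e^{\eta^\top T(y)}h(y)\,d\mu(y)$ and $p(y|\eta)=\exp(\eta^\top T(y)-A(\eta))h(y)$ for $\eta\in\Omega$. (If a response has to be generated for some $\eta\notin\Omega$, an arbitrary fixed Markov kernel is used.) Let $H$ be a probability distribution on $\mathbb R^{d_\eta\times d_\Theta}$ with finite moments of all orders and $\theta_0\in\mathbb R^{d_\Theta}$. Write $\mathbb P_0$ for the law of $Z=(X,Y)$ with $X\sim H$, $Y|X\sim p(\cdot|X\theta_0)$. Assume that there are $r>0$ and a function $B\ge 0$ with finite moments of all orders under $H$ such that for $H$-a.e. $X$ and all $\theta$ with $\|\theta-\theta_0\|\le r$, $X\theta$ is interior to $\Omega$ and all third partial derivatives of $A$ at $X\theta$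 are bounded by $B(X)$ in absolute value; and that $V_T:=\mathbb E_0[X^\top\nabla^2A(X\theta_0)X]$ is finite. *Data.* For each $n$ there are generations $G=1,2,\dots$, each with $n$ data points $Z_{G,i}=(X_{G,i},Y_{G,i})$, and external randomness $u\sim\nu$. The estimator $\hat\theta_G$ is a measurable function of $u$ and the data of generations $1,\dots,G$. Under the *reference law* $\mathbb P^{\rm ref}$ all $Z_{g,i}$ are i.i.d. from $\mathbb P_0$ and independent of $u$. Under the *workflow law*, given $u$, the first generation is i.i.d. from $\mathbb P_0$ and, given $u$ and the data of generations $1,\dots,G$, the points of generation $G+1$ are independent with $X_{G+1,i}\sim H$ and $Y_{G+1,i}|X_{G+1,i}\sim p(\cdot|X_{G+1,i}\hat\theta_G)$. *Estimators.* Let $L(z;\theta)$ be a loss which for $\mathbb P_0$-a.e. $z$ is twice differentiable at $\theta_0$, with $\mathbb E_0[\nabla_\theta L(Z;\theta_0)]=0$, $\mathbb E_0\|\nabla_\theta L(Z;\theta_0)\|^2<\infty$, and $\mathbb E_0[\nabla^2_\theta L(Z;\theta_0)]$ finite and invertible. Let the weights $\omega_{G,g,i}=\omega^{(n)}_{G,g,i}$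 ($g\le G$, $i\le n$) be measurable functions of $u$, such that in probability as $n\to\infty$, for all $g\le G,G'$: $\frac1n\sum_i\omega_{G,g,i}\to\rho_{G,g}$ with constants satisfying $\sum_{g\le G}\rho_{G,g}\ne0$; $\frac1n\sum_i\omega_{G,g,i}\omega_{G',g,i}$ converges to a constant; and $\max_i|\omega_{G,g,i}|/\sqrt n\to0$. Assume that the estimators are asymptotically approximately linear: for a fixed sign $s\in\{1,-1\}$ and every $G\ge1$, $$\sqrt{nG}(\hat\theta_G-\theta_0)=\frac{s}{\sqrt{nG}}\sum_{g=1}^G\sum_{i=1}^n\omega_{G,g,i}A_{n,G}^{-1}\nabla_\theta L(Z_{g,i};\theta_0)+o_{\mathbb P^{\rm ref}}(1),\qquad A_{n,G}=\frac1{nG}\sum_{g=1}^G\sum_{i=1}^n\omega_{G,g,i}\nabla^2_\theta L(Z_{g,i};\theta_0).$$ **Theorem.** Put $W_{n,T}(g)=\frac1{\sqrt n}\sum_{i=1}^nX_{g,i}^\top(T(Y_{g,i})-\nabla A(X_{g,i}\theta_0))$ and $W_{n,\Theta}(g)=\sqrt n(\hat\theta_g-\theta_0)$. For every $G$, as $n\to\infty$: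 (a) Under $\mathbb P^{\rm ref}$, $(W_{n,T}(g),W_{n,\Theta}(g))_{g=1}^G$ converges in distribution to a mean-zero jointly Gaussian vector $(W^{\rm ref}_T(g),W^{\rm ref}_\Theta(g))_{g=1}^G$. (b) Under the workflow law, $(W_{n,T}(g),W_{n,\Theta}(g))_{g=1}^G$ converges in distribution to the jointly Gaussian vector $(W_T(g),W_\Theta(g))_{g=1}^G$ generated sequentially as follows, with $W_\Theta(0)=0$: $W_T(g)=\xi_g+V_T\,W_\Theta(g-1)$, where $\xi_g$ has the law of $W^{\rm ref}_T(g)$ and is independent of $(W_T(g'),W_\Theta(g'))_{g'<g}$; and given $W_T(g)$ and $(W_T(g'),W_\Theta(g'))_{g'<g}$, $W_\Theta(g)$ is drawn from the conditional law of $W^{\rm ref}_\Theta(g)$ given $W^{\rm ref}_T(g)$ and $(W^{\rm ref}_T(g'),W^{\rm ref}_\Theta(g'))_{g'<g}$, evaluated at the generated values. -/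

import Mathlib

open MeasureTheory ProbabilityTheory Filter Topology
open scoped Matrix ENNReal

noncomputable section

namespace SyntheticData

/-- Real vectors with `d` coordinates. -/
abbrev Vec (d : ℕ) : Type := Fin d → ℝ

/-- Features: real `dη × dΘ` matrices, with the product σ-algebra and topology. -/
abbrev Feature (dη dΘ : ℕ) : Type := Fin dη → Fin dΘ → ℝ

/-- A data point `z = (x, y)`: feature and response. -/
abbrev DataPt (dη dΘ dY : ℕ) : Type := Feature dη dΘ × Vec dY

/-- The natural parameter `x θ`. -/
def natParam {dη dΘ : ℕ} (x : Feature dη dΘ) (θ : Vec dΘ) : Vec dη := Matrix.of x *ᵥ θ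

/-- Coordinate unit vector. -/
def unitVec {d : ℕ} (i : Fin d) : Vec d := Pi.single i 1

/-- The gradient of `f` at `x`, in coordinates. -/
def grad {d : ℕ} (f : Vec d → ℝ) (x : Vec d) : Vec d := fun i => fderiv ℝ f x (unitVec i)

/-- The Hessian matrix of `f` at `x`. -/
def hess {d : ℕ} (f : Vec d → ℝ) (x : Vec d) : Matrix (Fin d) (Fin d) ℝ :=
  Matrix.of fun i j => iteratedFDeriv ℝ 2 f x ![unitVec i, unitVec j]

/-- The third partial derivative `∂³f / ∂xᵢ∂xⱼ∂xₖ` at `x`. -/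
def thirdPartial {d : ℕ} (f : Vec d → ℝ) (x : Vec d) (i j k : Fin d) : ℝ :=
  iteratedFDeriv ℝ 3 f x ![unitVec i, unitVec j, unitVec k]

/-! ### Exponential families -/

/-- The data of an exponential family on `ℝ^dY`: dominating σ-finite measure `μ`, sufficient
statistic `T`, and base density `h ≥ 0` which is not `μ`-almost everywhere zero. -/
structure ExpFamily (dη dY : ℕ) where
  μ : Measure (Vec dY)
  sigmaFinite : SigmaFinite μ
  T : Vec dY → Vec dη
  measurable_T : Measurable T
  h : Vec dY → ℝ
  measurable_h : Measurable h
  h_nonneg : ∀ y, 0 ≤ h y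
  h_ne_zero : ¬ (h =ᵐ[μ] 0)

attribute [instance] ExpFamily.sigmaFinite

namespace ExpFamily

variable {dη dY : ℕ} (E : ExpFamily dη dY)

/-- `∫ exp(ηᵀ T(y)) h(y) dμ(y)`, as an extended nonnegative number. -/
def partition (η : Vec dη) : ℝ≥0∞ :=
  ∫⁻ y, ENNReal.ofReal (Real.exp (η ⬝ᵥ E.T y) * E.h y) ∂E.μ

/-- The natural parameter space `Ω`. -/
def Ω : Set (Vec dη) := {η | E.partition η < ∞}

/-- The log-partition function (meaningful on `Ω`). -/
def A (η : Vec dη) : ℝ := Real.log (E.partition η).toReal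

/-- The density `p(y | η) = exp(ηᵀ T(y) - A(η)) h(y)`. -/
def density (η : Vec dη) (y : Vec dY) : ℝ≥0∞ :=
  ENNReal.ofReal (Real.exp (η ⬝ᵥ E.T y - E.A η) * E.h y)

lemma measurable_partition : Measurable E.partition := by
  unfold partition
  refine Measurable.lintegral_prod_right' (f := fun p : Vec dη × Vec dY =>
    ENNReal.ofReal (Real.exp (p.1 ⬝ᵥ E.T p.2) * E.h p.2)) ?_
  have h1 := E.measurable_T
  have h2 := E.measurable_h
  simp only [dotProduct]
  fun_prop

lemma measurableSet_Ω : MeasurableSet E.Ω :=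
  measurableSet_lt E.measurable_partition measurable_const

lemma measurable_A : Measurable E.A :=
  Real.measurable_log.comp E.measurable_partition.ennreal_toReal

lemma measurable_density : Measurable (Function.uncurry E.density) := by
  have h1 := E.measurable_T
  have h2 := E.measurable_h
  have h3 := E.measurable_A
  simp only [density, Function.uncurry_def, dotProduct]
  fun_prop

lemma partition_ne_zero (η : Vec dη) : E.partition η ≠ 0 := by
  intro h0
  have h1 := E.measurable_T
  have h2 := E.measurable_h
  unfold partition at h0
  rw [lintegral_eq_zero_iff (by simp only [dotProduct]; fun_prop)] at h0
  refine E.h_ne_zero ?_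
  filter_upwards [h0] with y hy
  have hy' : Real.exp (η ⬝ᵥ E.T y) * E.h y ≤ 0 := by simpa using hy
  have := Real.exp_pos (η ⬝ᵥ E.T y)
  have h3 := E.h_nonneg y
  have : E.h y ≤ 0 := by
    by_contra hc
    push Not at hc
    nlinarith [mul_pos this hc]
  simpa using le_antisymm this h3

lemma lintegral_density {η : Vec dη} (hη : η ∈ E.Ω) : ∫⁻ y, E.density η y ∂E.μ = 1 := by
  have h1 := E.measurable_T
  have h2 := E.measurable_h
  have h0 := E.partition_ne_zero η
  have htop : E.partition η ≠ ∞ := ne_of_lt hη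
  have hpos : 0 < (E.partition η).toReal := ENNReal.toReal_pos h0 htop
  have : ∀ y, E.density η y = ENNReal.ofReal (Real.exp (-E.A η)) *
      ENNReal.ofReal (Real.exp (η ⬝ᵥ E.T y) * E.h y) := by
    intro y
    rw [density, ← ENNReal.ofReal_mul (Real.exp_pos _).le, ← mul_assoc, ← Real.exp_add]
    ring_nf
  simp_rw [this]
  rw [lintegral_const_mul' _ _ ENNReal.ofReal_ne_top]
  change ENNReal.ofReal (Real.exp (-E.A η)) * E.partition η = 1
  rw [A, Real.exp_neg, Real.exp_log hpos, ENNReal.ofReal_inv_of_pos hpos,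
    ENNReal.ofReal_toReal htop, ENNReal.inv_mul_cancel h0 htop]

open Classical in
/-- The response kernel: `η ↦ p(· | η) dμ` for `η ∈ Ω`. For `η ∉ Ω`, where the exponential family
defines no distribution, responses are drawn from an arbitrary Markov kernel `q`. -/
def response (q : Kernel (Vec dη) (Vec dY)) : Kernel (Vec dη) (Vec dY) :=
  Kernel.piecewise E.measurableSet_Ω (Kernel.withDensity (Kernel.const _ E.μ) E.density) q

open Classical in
lemma response_apply (q : Kernel (Vec dη) (Vec dY)) {η : Vec dη} (hη : η ∈ E.Ω) :
    E.response q η = E.μ.withDensity (E.density η) := by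
  rw [response, Kernel.piecewise_apply, if_pos hη, Kernel.withDensity_apply _ E.measurable_density,
    Kernel.const_apply]

open Classical in
instance (q : Kernel (Vec dη) (Vec dY)) [IsMarkovKernel q] : IsMarkovKernel (E.response q) := by
  refine ⟨fun η => ?_⟩
  by_cases hη : η ∈ E.Ω
  · rw [E.response_apply q hη]
    refine ⟨?_⟩
    rw [withDensity_apply _ MeasurableSet.univ, Measure.restrict_univ, E.lintegral_density hη]
  · rw [response, Kernel.piecewise_apply, if_neg hη]
    infer_instance

end ExpFamily

/-! ### Data laws -/

section Laws

variable {dη dΘ dY : ℕ}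

lemma measurable_natParam :
    Measurable fun p : Vec dΘ × Feature dη dΘ => natParam p.2 p.1 := by
  refine measurable_pi_lambda _ fun i => ?_
  simp only [natParam, Matrix.mulVec, dotProduct, Matrix.of_apply]
  fun_prop

/-- The law of one data point `(X, Y)` as a function of `θ`: `X ∼ H` and
`Y | X ∼ p(· | X θ)`. -/
def pointKernel (E : ExpFamily dη dY) (q : Kernel (Vec dη) (Vec dY)) [IsMarkovKernel q]
    (H : Measure (Feature dη dΘ)) : Kernel (Vec dΘ) (DataPt dη dΘ dY) :=
  Kernel.const (Vec dΘ) H ⊗ₖ (E.response q).comap (fun p => natParam p.2 p.1) measurable_natParam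

instance (E : ExpFamily dη dY) (q : Kernel (Vec dη) (Vec dY)) [IsMarkovKernel q]
    (H : Measure (Feature dη dΘ)) [IsProbabilityMeasure H] :
    IsMarkovKernel (pointKernel E q H) := by
  unfold pointKernel; infer_instance

/-- `n` independent draws from a Markov kernel. -/
def iidKernel {α β : Type*} [MeasurableSpace α] [MeasurableSpace β] (κ : Kernel α β)
    [IsMarkovKernel κ] (n : ℕ) : Kernel α (Fin n → β) where
  toFun a := Measure.pi fun _ => κ a
  measurable' := by
    refine Measurable.measure_of_isPiSystem_of_isProbabilityMeasure generateFrom_pi.symm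
      isPiSystem_pi ?_
    rintro s ⟨t, ht, rfl⟩
    simp only [Measure.pi_pi]
    exact Finset.measurable_prod _ fun i _ => κ.measurable_coe (ht i trivial)

instance {α β : Type*} [MeasurableSpace α] [MeasurableSpace β] (κ : Kernel α β)
    [IsMarkovKernel κ] (n : ℕ) : IsMarkovKernel (iidKernel κ n) :=
  ⟨fun a => by change IsProbabilityMeasure (Measure.pi fun _ => κ a); infer_instance⟩

/-- Accumulated data of `G` generations with `n` points each. The index `g : Fin G` is
generation `g + 1`. -/
abbrev History (dη dΘ dY n G : ℕ) : Type := Fin G → Fin n → DataPt dη dΘ dY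

/-- The first `k` generations of a history. -/
def truncate {n G k : ℕ} (hk : k ≤ G) (z : History dη dΘ dY n G) : History dη dΘ dY n k :=
  fun j => z (Fin.castLE hk j)

variable {U : Type*} [MeasurableSpace U]

/-- A sequence of estimators: `est n G (u, z)` is computed from the data `z` accumulated in
generations `1, …, G` and from external randomness `u` (which also carries random weights). The
value at `G = 0` is never used. -/
structure Estimators (dη dΘ dY : ℕ) (U : Type*) [MeasurableSpace U] where
  est : (n G : ℕ) → U × History dη dΘ dY n G → Vec dΘ
  measurable_est : ∀ n G, Measurable (est n G)

/-- The parameter from which generation `G + 1` is generated: `θ₀` for the real data of the first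
generation, the current estimate afterwards. -/
def Estimators.current (e : Estimators dη dΘ dY U) (θ₀ : Vec dΘ) (n : ℕ) (G : ℕ) :
    U × History dη dΘ dY n G → Vec dΘ :=
  if G = 0 then fun _ => θ₀ else e.est n G

lemma Estimators.measurable_current (e : Estimators dη dΘ dY U) (θ₀ : Vec dΘ) (n G : ℕ) :
    Measurable (e.current θ₀ n G) := by
  unfold Estimators.current
  split_ifs
  · exact measurable_const
  · exact e.measurable_est n G

lemma measurable_snoc {β : Type*} [MeasurableSpace β] (G : ℕ) :
    Measurable fun p : (Fin G → β) × β => (Fin.snoc p.1 p.2 : Fin (G + 1) → β) := by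
  refine measurable_pi_lambda _ fun j => ?_
  refine Fin.lastCases ?_ (fun j => ?_) j
  · simpa using measurable_snd
  · simp only [Fin.snoc_castSucc]
    fun_prop

/-- The reference law of external randomness and `G` generations of data: all data points are
i.i.d. real data, independent of the external randomness. -/
def refLaw (E : ExpFamily dη dY) (q : Kernel (Vec dη) (Vec dY)) [IsMarkovKernel q]
    (H : Measure (Feature dη dΘ)) (θ₀ : Vec dΘ) (ν : Measure U) (n G : ℕ) :
    Measure (U × History dη dΘ dY n G) :=
  ν.prod (Measure.pi fun _ => Measure.pi fun _ => pointKernel E q H θ₀)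

instance (E : ExpFamily dη dY) (q : Kernel (Vec dη) (Vec dY)) [IsMarkovKernel q]
    (H : Measure (Feature dη dΘ)) [IsProbabilityMeasure H] (θ₀ : Vec dΘ) (ν : Measure U)
    [IsProbabilityMeasure ν] (n G : ℕ) :
    IsProbabilityMeasure (refLaw E q H θ₀ ν n G) := by
  unfold refLaw; infer_instance

/-- The law of external randomness and `G` generations of data under the actual workflow: given
everything up to generation `G`, the `n` points of generation `G + 1` are drawn independently
with `X ∼ H` and `Y | X ∼ p(· | X θ̂_G)`, the first generation being real data. -/
def workflowLaw (E : ExpFamily dη dY) (q : Kernel (Vec dη) (Vec dY)) [IsMarkovKernel q]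
    (H : Measure (Feature dη dΘ)) [IsProbabilityMeasure H] (θ₀ : Vec dΘ) (ν : Measure U)
    (e : Estimators dη dΘ dY U) (n : ℕ) : (G : ℕ) → Measure (U × History dη dΘ dY n G)
  | 0 => ν.map fun u => (u, Fin.elim0)
  | G + 1 =>
    ((workflowLaw E q H θ₀ ν e n G) ⊗ₘ
      (iidKernel (pointKernel E q H) n).comap (e.current θ₀ n G)
        (e.measurable_current θ₀ n G)).map
      fun p => (p.1.1, Fin.snoc p.1.2 p.2)

instance (E : ExpFamily dη dY) (q : Kernel (Vec dη) (Vec dY)) [IsMarkovKernel q]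
    (H : Measure (Feature dη dΘ)) [IsProbabilityMeasure H] (θ₀ : Vec dΘ) (ν : Measure U)
    [IsProbabilityMeasure ν] (e : Estimators dη dΘ dY U) (n G : ℕ) :
    IsProbabilityMeasure (workflowLaw E q H θ₀ ν e n G) := by
  induction G with
  | zero => exact Measure.isProbabilityMeasure_map (by fun_prop)
  | succ G ih =>
    unfold workflowLaw
    refine Measure.isProbabilityMeasure_map (Measurable.aemeasurable ?_)
    refine (measurable_fst.comp measurable_fst).prodMk ?_
    exact (measurable_snoc G).comp ((measurable_snd.comp measurable_fst).prodMk measurable_snd)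

/-! ### Statistics -/

/-- The score statistic of one generation:
`n^{-1/2} ∑ᵢ Xᵢᵀ (T(Yᵢ) - ∇A(Xᵢ θ₀))`. -/
def scoreStat (E : ExpFamily dη dY) (θ₀ : Vec dΘ) {n : ℕ} (d : Fin n → DataPt dη dΘ dY) :
    Vec dΘ :=
  (√(n : ℝ))⁻¹ • ∑ i, (Matrix.of (d i).1)ᵀ *ᵥ (E.T (d i).2 - grad E.A (natParam (d i).1 θ₀))

/-- `(W_{n,T}(g), W_{n,Θ}(g))` for `g = 1, …, G` (indexed from zero), where
`W_{n,Θ}(g) = √n (θ̂_g - θ₀)`. -/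
def jointStat (E : ExpFamily dη dY) (e : Estimators dη dΘ dY U) (θ₀ : Vec dΘ) (n G : ℕ)
    (p : U × History dη dΘ dY n G) : Fin G → Vec dΘ × Vec dΘ :=
  fun g => (scoreStat E θ₀ (p.2 g),
    √(n : ℝ) • (e.est n (g + 1) (p.1, truncate (Nat.succ_le_of_lt g.isLt) p.2) - θ₀))

/-- `E₀[Xᵀ ∇²A(Xθ₀) X]`. -/
def fisherMatrix (E : ExpFamily dη dY) (H : Measure (Feature dη dΘ)) (θ₀ : Vec dΘ) :
    Matrix (Fin dΘ) (Fin dΘ) ℝ :=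
  Matrix.of fun a b =>
    ∫ x, ((Matrix.of x)ᵀ * hess E.A (natParam x θ₀) * Matrix.of x) a b ∂H

/-! ### Assumptions -/

/-- Moments of the features, local bound on the third derivatives of the log-partition function,
and finiteness of `E₀[Xᵀ ∇²A(Xθ₀) X]`. -/
structure RegularModel (E : ExpFamily dη dY) (H : Measure (Feature dη dΘ)) (θ₀ : Vec dΘ) :
    Prop where
  moments : ∀ k : ℕ, Integrable (fun x => ‖x‖ ^ k) H
  third_bound : ∃ r > 0, ∃ B : Feature dη dΘ → ℝ, (∀ x, 0 ≤ B x) ∧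
    (∀ k : ℕ, Integrable (fun x => B x ^ k) H) ∧
    ∀ᵐ x ∂H, ∀ θ ∈ Metric.closedBall θ₀ r, natParam x θ ∈ interior E.Ω ∧
      ∀ i j k, |thirdPartial E.A (natParam x θ) i j k| ≤ B x
  fisher_integrable : ∀ a b,
    Integrable (fun x => ((Matrix.of x)ᵀ * hess E.A (natParam x θ₀) * Matrix.of x) a b) H

/-- Conditions on the loss under the real data law `P₀`: almost surely twice differentiable at
`θ₀`, centred square-integrable gradient, integrable Hessian with invertible mean. -/
structure RegularLoss (L : DataPt dη dΘ dY → Vec dΘ → ℝ) (P₀ : Measure (DataPt dη dΘ dY))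
    (θ₀ : Vec dΘ) : Prop where
  twice_diff : ∀ᵐ z ∂P₀, (∀ᶠ θ in 𝓝 θ₀, DifferentiableAt ℝ (L z) θ) ∧
    DifferentiableAt ℝ (fderiv ℝ (L z)) θ₀
  grad_sq : ∀ a, MemLp (fun z => grad (L z) θ₀ a) 2 P₀
  grad_mean : ∀ a, ∫ z, grad (L z) θ₀ a ∂P₀ = 0
  hess_integrable : ∀ a b, Integrable (fun z => hess (L z) θ₀ a b) P₀
  hess_invertible : IsUnit (Matrix.of fun a b => ∫ z, hess (L z) θ₀ a b ∂P₀).det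

/-- Conditions on the weights `ω n G g i`, the weight given at generation `G` to the `i`-th point of
generation `g + 1` (`g < G`, `i < n`). They are functions of the external randomness, hence
independent of real data. -/
structure RegularWeights (ω : ℕ → ℕ → ℕ → ℕ → U → ℝ) (ν : Measure U) : Prop where
  measurable : ∀ n G g i, Measurable (ω n G g i)
  mean : ∀ G ≥ 1, ∃ ρ : ℕ → ℝ, ∑ g ∈ Finset.range G, ρ g ≠ 0 ∧ ∀ g < G,
    TendstoInMeasure ν (fun (n : ℕ) u => (n : ℝ)⁻¹ * ∑ i : Fin n, ω n G g i u) atTop (fun _ => ρ g)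
  cross : ∀ G G' g, g < G → g < G' → ∃ c : ℝ,
    TendstoInMeasure ν (fun (n : ℕ) u => (n : ℝ)⁻¹ * ∑ i : Fin n, ω n G g i u * ω n G' g i u) atTop
      (fun _ => c)
  negligible : ∀ G g, g < G →
    TendstoInMeasure ν (fun (n : ℕ) u => (√(n : ℝ))⁻¹ * ⨆ i : Fin n, |ω n G g i u|) atTop (fun _ => 0)

/-- `A_{n,G}(θ₀) = (nG)⁻¹ ∑_g ∑_i ω_{G,g,i} ∇²L(Z_{g,i}; θ₀)`. -/
def weightedHess (L : DataPt dη dΘ dY → Vec dΘ → ℝ) (ω : ℕ → ℕ → ℕ → ℕ → U → ℝ) (θ₀ : Vec dΘ)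
    (n G : ℕ) (p : U × History dη dΘ dY n G) : Matrix (Fin dΘ) (Fin dΘ) ℝ :=
  ((n : ℝ) * G)⁻¹ • ∑ g : Fin G, ∑ i : Fin n, ω n G g i p.1 • hess (L (p.2 g i)) θ₀

/-- The linear term
`(nG)^{-1/2} ∑_g ∑_i ω_{G,g,i} ψ(Z_{g,i}; θ₀)`, with `ψ(z; θ₀) = A_{n,G}(θ₀)⁻¹ ∇L(z; θ₀)`. -/
def linearTerm (L : DataPt dη dΘ dY → Vec dΘ → ℝ) (ω : ℕ → ℕ → ℕ → ℕ → U → ℝ) (θ₀ : Vec dΘ)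
    (n G : ℕ) (p : U × History dη dΘ dY n G) : Vec dΘ :=
  (√((n : ℝ) * G))⁻¹ • ∑ g : Fin G, ∑ i : Fin n,
    ω n G g i p.1 • ((weightedHess L ω θ₀ n G p)⁻¹ *ᵥ grad (L (p.2 g i)) θ₀)

/-- Asymptotic approximate linearity under i.i.d. real data: at every generation `G ≥ 1`,
`√(nG) (θ̂_G - θ₀) = s · linearTerm + o_P(1)` as `n → ∞`. The sign `s = ±1` allows for both sign
conventions for the influence function (`s = -1` is that of a minimiser of the weighted loss). -/
def IsAAL (e : Estimators dη dΘ dY U) (L : DataPt dη dΘ dY → Vec dΘ → ℝ)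
    (ω : ℕ → ℕ → ℕ → ℕ → U → ℝ) (s : ℝ) (E : ExpFamily dη dY) (q : Kernel (Vec dη) (Vec dY))
    [IsMarkovKernel q] (H : Measure (Feature dη dΘ)) (θ₀ : Vec dΘ) (ν : Measure U) : Prop :=
  ∀ G ≥ 1, ∀ ε > 0, Tendsto
    (fun n : ℕ => refLaw E q H θ₀ ν n G
      {p | ε ≤ ‖√((n : ℝ) * G) • (e.est n G p - θ₀) - s • linearTerm L ω θ₀ n G p‖})
    atTop (𝓝 0)

end Laws

/-! ### The sequential limit process -/

/-- The last `W_Θ` of a path, and `0` for the empty path. -/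
def lastTheta {d : ℕ} : {G : ℕ} → (Fin G → Vec d × Vec d) → Vec d
  | 0, _ => 0
  | G + 1, w => (w (Fin.last G)).2

lemma measurable_lastTheta {d G : ℕ} :
    Measurable (lastTheta : (Fin G → Vec d × Vec d) → Vec d) := by
  cases G with
  | zero => exact measurable_const
  | succ G => exact measurable_snd.comp (measurable_pi_apply (Fin.last G))

/-- The joint law of `(W_T(g), W_Θ(g))`, `g = 1, …, G`, given the reference laws `Γ` of
`(W_T^ref(g), W_Θ^ref(g))`, `g = 1, …, G`. Given the past, draw `ξ` with the law of
`W_T^ref(G + 1)` independently of the past, put `W_T(G + 1) = ξ + V W_Θ(G)` (with `W_Θ(0) = 0`),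
and draw `W_Θ(G + 1)` from the conditional law of `W_Θ^ref(G + 1)` given `W_T^ref(G + 1)` and
`(W_T^ref(g), W_Θ^ref(g))`, `g ≤ G`, evaluated at the generated values. -/
def sequentialLaw {d : ℕ} (V : Matrix (Fin d) (Fin d) ℝ)
    (Γ : (G : ℕ) → ProbabilityMeasure (Fin G → Vec d × Vec d)) :
    (G : ℕ) → Measure (Fin G → Vec d × Vec d)
  | 0 => Measure.dirac Fin.elim0
  | G + 1 =>
    ((((sequentialLaw V Γ G).prod
        ((Γ (G + 1) : Measure (Fin (G + 1) → Vec d × Vec d)).map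
          fun w => (w (Fin.last G)).1)).map
      fun p => (p.1, p.2 + V *ᵥ lastTheta p.1)) ⊗ₘ
        condDistrib (fun w : Fin (G + 1) → Vec d × Vec d => (w (Fin.last G)).2)
          (fun w => ((fun j : Fin G => w j.castSucc), (w (Fin.last G)).1))
          (Γ (G + 1) : Measure (Fin (G + 1) → Vec d × Vec d))).map
      fun p => Fin.snoc p.1.1 (p.1.2, p.2)

instance {d : ℕ} (V : Matrix (Fin d) (Fin d) ℝ)
    (Γ : (G : ℕ) → ProbabilityMeasure (Fin G → Vec d × Vec d)) (G : ℕ) :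
    IsProbabilityMeasure (sequentialLaw V Γ G) := by
  induction G with
  | zero => unfold sequentialLaw; infer_instance
  | succ G ih =>
    unfold sequentialLaw
    have h1 : IsProbabilityMeasure ((Γ (G + 1) : Measure (Fin (G + 1) → Vec d × Vec d)).map
        fun w => (w (Fin.last G)).1) :=
      Measure.isProbabilityMeasure_map
        (measurable_fst.comp (measurable_pi_apply (Fin.last G))).aemeasurable
    have h2 : Measurable fun p : (Fin G → Vec d × Vec d) × Vec d =>
        (p.1, p.2 + V *ᵥ lastTheta p.1) := by
      refine measurable_fst.prodMk (measurable_snd.add ?_)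
      exact (Continuous.matrix_mulVec continuous_const continuous_id).measurable.comp
        (measurable_lastTheta.comp measurable_fst)
    have h3 := Measure.isProbabilityMeasure_map (μ := (sequentialLaw V Γ G).prod
        ((Γ (G + 1) : Measure (Fin (G + 1) → Vec d × Vec d)).map
          fun w => (w (Fin.last G)).1)) h2.aemeasurable
    refine Measure.isProbabilityMeasure_map (Measurable.aemeasurable ?_)
    exact (measurable_snoc G).comp ((measurable_fst.comp measurable_fst).prodMk
      ((measurable_snd.comp measurable_fst).prodMk measurable_snd))

end SyntheticData

end

/-! The argument is a change of measure in the spirit of Le Cam's third lemma. Under the reference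
law, scores and loss gradients form weighted sums of i.i.d. vectors whose weights are independent of
the data. Conditioning on `u`, a central limit theorem by characteristic functions
(`tendstoInDistribution_arraySum`) gives a joint Gaussian limit. The averaged Hessian converges in
probability to an invertible matrix, so the estimators are asymptotically a fixed linear image of
these sums; this is part (a), `exists_gaussian_tendstoInDistribution_jointStat`.

As long as the estimates stay near θ₀, the workflow law has a density with respect to the reference
law: the product over generations and points of p(Y|Xθ̂)/p(Y|Xθ₀). With u = √n(θ̂ − θ₀) for the
previous estimate θ̂, a Taylor expansion of `A` shows that generation g contributes uᵀW_T(g) −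
uᵀVu/2 + o(1) to the log-likelihood ratio. The log ratio is thus asymptotically a continuous
function, `logLR`, of the very statistics whose reference limit is known.

In the limit, tilting by `exp logLR` produces exactly the sequential process
(`sequentialLaw_eq_withDensity`). The reference score of a generation is N(0, V) and independent of
the past, and tilting N(0, V) by exp(θᵀw − θᵀVθ/2) translates it by Vθ. The factor of a generation
does not involve the estimate computed from that generation, so the conditional law of that estimate
is unchanged. Linear regression then shows that the tilted law is again Gaussian.

Because the limiting density has total mass one, no mass can escape, and a lower bound for the
likelihood ratio suffices (`tendstoInDistribution_of_le_likelihoodRatio`). The ratio may therefore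
be set to zero when an estimate leaves a ball around θ₀ (`lintegral_likelihoodRatio_le`), and the
expansion is only needed as a lower bound on bounded paths (`whp_le_likelihoodRatio`). Neither
contiguity nor uniform integrability has to be proved separately. -/

namespace SyntheticData

/-! ### Convergence in probability along varying probability spaces. -/

section InProbability

variable {Ω : ℕ → Type*} [∀ n, MeasurableSpace (Ω n)]

/-- The events `p n` have probability tending to one. -/
def WHP (μ : ∀ n, Measure (Ω n)) (p : ∀ n, Ω n → Prop) : Prop :=
  Tendsto (fun n => μ n {ω | ¬ p n ω}) atTop (𝓝 0)

/-- Convergence in probability to a constant, for random variables on varying spaces. -/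
def TendstoInProb {E : Type*} [SeminormedAddCommGroup E] (μ : ∀ n, Measure (Ω n))
    (X : ∀ n, Ω n → E) (c : E) : Prop :=
  ∀ ε > 0, WHP μ fun n ω => ‖X n ω - c‖ < ε

variable {μ : ∀ n, Measure (Ω n)} {p q : ∀ n, Ω n → Prop}

/-- Here and below only monotonicity and subadditivity of the outer measure are used, so the events
need not be measurable. -/
lemma WHP.mono_ae (h : WHP μ p) (hpq : ∀ᶠ n in atTop, ∀ᵐ ω ∂(μ n), p n ω → q n ω) : WHP μ q := by
  refine tendsto_of_tendsto_of_tendsto_of_le_of_le' tendsto_const_nhds h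
    (Eventually.of_forall fun _ => zero_le) ?_
  filter_upwards [hpq] with n hn
  refine measure_mono_ae ?_
  filter_upwards [hn] with ω hω hq hp
  exact hq (hω hp)

lemma WHP.mono (h : WHP μ p) (hpq : ∀ n ω, p n ω → q n ω) : WHP μ q :=
  h.mono_ae (Eventually.of_forall fun n => Eventually.of_forall (hpq n))

lemma WHP.of_eventually (h : ∀ᶠ n in atTop, ∀ᵐ ω ∂(μ n), p n ω) : WHP μ p := by
  refine WHP.mono_ae (p := fun _ _ => True) (by simp [WHP]) ?_
  filter_upwards [h] with n hn
  filter_upwards [hn] with ω hω _ using hω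

lemma WHP.and (hp : WHP μ p) (hq : WHP μ q) : WHP μ fun n ω => p n ω ∧ q n ω := by
  have h := hp.add hq
  rw [add_zero] at h
  refine tendsto_of_tendsto_of_tendsto_of_le_of_le tendsto_const_nhds h
    (fun _ => zero_le) fun n => (measure_mono ?_).trans (measure_union_le _ _)
  intro ω hω
  simp only [Set.mem_ofPred_eq, Set.mem_union] at hω ⊢
  tauto

lemma WHP.all {ι : Type*} [Finite ι] {p : ι → ∀ n, Ω n → Prop} (h : ∀ i, WHP μ (p i)) :
    WHP μ fun n ω => ∀ i, p i n ω := by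
  have := Fintype.ofFinite ι
  have h' := tendsto_finsetSum (Finset.univ : Finset ι) fun i _ => h i
  rw [Finset.sum_const_zero] at h'
  refine tendsto_of_tendsto_of_tendsto_of_le_of_le tendsto_const_nhds h'
    (fun _ => zero_le) fun n => (measure_mono ?_).trans (measure_iUnion_fintype_le _ _)
  intro ω hω
  simpa using hω

variable {E F : Type*} [SeminormedAddCommGroup E] [SeminormedAddCommGroup F]
  {X : ∀ n, Ω n → E} {Y : ∀ n, Ω n → F} {c : E} {d : F}

lemma TendstoInProb.congr {X' : ∀ n, Ω n → E} (h : TendstoInProb μ X c)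
    (hX : ∀ n, ∀ᵐ ω ∂(μ n), X n ω = X' n ω) : TendstoInProb μ X' c := fun ε hε =>
  (h ε hε).mono_ae (Eventually.of_forall fun n => by
    filter_upwards [hX n] with ω hω h1; rwa [← hω])

lemma tendstoInProb_of_tendsto {x : ℕ → E} (h : Tendsto x atTop (𝓝 c)) :
    TendstoInProb μ (fun n _ => x n) c := fun ε hε =>
  WHP.of_eventually (by
    filter_upwards [Metric.tendsto_nhds.1 h ε hε] with n hn
    exact Eventually.of_forall fun _ => by rwa [← dist_eq_norm])

lemma TendstoInProb.whp_of_mem_nhds (h : TendstoInProb μ X c) {s : Set E} (hs : s ∈ 𝓝 c) :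
    WHP μ fun n ω => X n ω ∈ s := by
  obtain ⟨δ, hδ, hs⟩ := Metric.mem_nhds_iff.1 hs
  exact (h δ hδ).mono fun n ω hω => hs (by rwa [Metric.mem_ball, dist_eq_norm])

/-- Continuity at the limit point alone is required, which makes the lemma applicable to matrix
inversion. -/
lemma TendstoInProb.comp {f : E → F} (h : TendstoInProb μ X c) (hf : ContinuousAt f c) :
    TendstoInProb μ (fun n ω => f (X n ω)) (f c) := fun ε hε => by
  refine (h.whp_of_mem_nhds (hf (Metric.ball_mem_nhds (f c) hε))).mono fun n ω hω => ?_
  simpa [Metric.mem_ball, dist_eq_norm] using hω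

lemma TendstoInProb.prodMk (hX : TendstoInProb μ X c) (hY : TendstoInProb μ Y d) :
    TendstoInProb μ (fun n ω => (X n ω, Y n ω)) (c, d) := fun ε hε =>
  ((hX ε hε).and (hY ε hε)).mono fun n ω hω => by
    simpa [Prod.norm_def] using hω

lemma TendstoInProb.pi {ι : Type*} [Fintype ι] {E : ι → Type*} [∀ i, SeminormedAddCommGroup (E i)]
    {X : ∀ n, Ω n → ∀ i, E i} {c : ∀ i, E i}
    (h : ∀ i, TendstoInProb μ (fun n ω => X n ω i) (c i)) : TendstoInProb μ X c := fun ε hε =>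
  (WHP.all fun i => h i ε hε).mono fun n ω hω => by
    rw [pi_norm_lt_iff hε]
    exact hω

lemma TendstoInProb.add {Y : ∀ n, Ω n → E} {d : E} (hX : TendstoInProb μ X c)
    (hY : TendstoInProb μ Y d) : TendstoInProb μ (fun n ω => X n ω + Y n ω) (c + d) :=
  (hX.prodMk hY).comp (f := fun p : E × E => p.1 + p.2) (by fun_prop)

lemma TendstoInProb.sum {ι : Type*} [Fintype ι] {X : ι → ∀ n, Ω n → E} {c : ι → E}
    (h : ∀ i, TendstoInProb μ (X i) (c i)) :
    TendstoInProb μ (fun n ω => ∑ i, X i n ω) (∑ i, c i) :=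
  (TendstoInProb.pi h).comp (f := fun x : ι → E => ∑ i, x i) (by fun_prop)

lemma TendstoInProb.mul {X Y : ∀ n, Ω n → ℝ} {c d : ℝ} (hX : TendstoInProb μ X c)
    (hY : TendstoInProb μ Y d) : TendstoInProb μ (fun n ω => X n ω * Y n ω) (c * d) :=
  (hX.prodMk hY).comp (f := fun p : ℝ × ℝ => p.1 * p.2) (by fun_prop)

lemma TendstoInProb.const_mul {X : ∀ n, Ω n → ℝ} {c : ℝ} (a : ℝ) (hX : TendstoInProb μ X c) :
    TendstoInProb μ (fun n ω => a * X n ω) (a * c) :=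
  hX.comp (f := fun x : ℝ => a * x) (by fun_prop)

lemma tendstoInProb_of_tendstoInMeasure {U : Type*} [MeasurableSpace U] {ν : Measure U}
    {X : ℕ → U → E} (h : TendstoInMeasure ν X atTop fun _ => c) :
    TendstoInProb (fun _ => ν) X c := fun ε hε => by
  have := tendstoInMeasure_iff_norm.1 h ε hε
  simpa only [WHP, not_lt] using this

lemma integrable_indicator_const_of_null {α : Type*} [MeasurableSpace α] {P : Measure α}
    [IsFiniteMeasure P] {s : Set α} (hs : NullMeasurableSet s P) (C : ℝ) :
    Integrable (s.indicator fun _ => C) P :=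
  (integrable_const C).indicator₀ hs

lemma integral_indicator_const_of_null {α : Type*} [MeasurableSpace α] {P : Measure α}
    [IsFiniteMeasure P] {s : Set α} (hs : NullMeasurableSet s P) (C : ℝ) :
    ∫ x, s.indicator (fun _ => C) x ∂P = C * P.real s := by
  rw [integral_indicator₀ hs, setIntegral_const, smul_eq_mul, mul_comm]

/-- Integrals of bounded functions that are small with probability tending to one. -/
lemma WHP.tendsto_integral_norm {V : Type*} [NormedAddCommGroup V]
    [∀ n, IsProbabilityMeasure (μ n)] {f : ∀ n, Ω n → V} {C : ℝ}
    (hf : ∀ n, AEStronglyMeasurable (f n) (μ n)) (hC : ∀ n ω, ‖f n ω‖ ≤ C)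
    (h : ∀ ε > 0, WHP μ fun n ω => ‖f n ω‖ ≤ ε) :
    Tendsto (fun n => ∫ ω, ‖f n ω‖ ∂(μ n)) atTop (𝓝 0) := by
  have hC0 : 0 ≤ max C 0 := le_max_right _ _
  rw [Metric.tendsto_nhds]
  intro ε hε
  -- The integrand is at most ε / 2 off the exceptional event and at most C on it.
  have h1 : Tendsto (fun n => ε / 2 + max C 0 * (μ n).real {ω | ¬ ‖f n ω‖ ≤ ε / 2}) atTop
      (𝓝 (ε / 2 + max C 0 * 0)) :=
    ((ENNReal.tendsto_toReal ENNReal.zero_ne_top).comp (h (ε / 2) (by positivity))).const_mul _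
      |>.const_add _
  filter_upwards [h1.eventually_lt_const (show ε / 2 + max C 0 * 0 < ε by linarith)] with n hn
  rw [Real.dist_0_eq_abs, abs_of_nonneg (integral_nonneg fun _ => norm_nonneg _)]
  refine lt_of_le_of_lt ?_ hn
  have hm : NullMeasurableSet {ω | ¬ ‖f n ω‖ ≤ ε / 2} (μ n) := by
    have : NullMeasurableSet {ω | ‖f n ω‖ ≤ ε / 2} (μ n) :=
      nullMeasurableSet_le (hf n).norm.aemeasurable aemeasurable_const
    exact this.compl
  calc ∫ ω, ‖f n ω‖ ∂(μ n)
      ≤ ∫ ω, (ε / 2 + {ω | ¬ ‖f n ω‖ ≤ ε / 2}.indicator (fun _ => max C 0) ω) ∂(μ n) := by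
        refine integral_mono_of_nonneg (Eventually.of_forall fun _ => norm_nonneg _)
          ((integrable_const _).add (integrable_indicator_const_of_null hm _))
          (Eventually.of_forall fun ω => ?_)
        dsimp only
        by_cases hω : ‖f n ω‖ ≤ ε / 2
        · rw [Set.indicator_of_notMem (by simpa using hω)]
          linarith
        · have := hC n ω
          rw [Set.indicator_of_mem (by exact hω)]
          linarith [le_max_left C 0]
    _ = ε / 2 + max C 0 * (μ n).real {ω | ¬ ‖f n ω‖ ≤ ε / 2} := by
        rw [integral_add (integrable_const _) (integrable_indicator_const_of_null hm _),
          integral_indicator_const_of_null hm]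
        simp

/-- Bounded convergence when the probability space changes with `n`; it turns limits of conditional
characteristic functions into limits of unconditional ones. -/
lemma TendstoInProb.tendsto_integral {V : Type*} [NormedAddCommGroup V] [NormedSpace ℝ V]
    [CompleteSpace V] [∀ n, IsProbabilityMeasure (μ n)] {f : ∀ n, Ω n → V} {C : ℝ} {c : V}
    (hf : ∀ n, AEStronglyMeasurable (f n) (μ n)) (hC : ∀ n ω, ‖f n ω‖ ≤ C)
    (h : TendstoInProb μ f c) : Tendsto (fun n => ∫ ω, f n ω ∂(μ n)) atTop (𝓝 c) := by
  have h1 := WHP.tendsto_integral_norm (μ := μ) (f := fun n ω => f n ω - c) (C := C + ‖c‖)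
    (fun n => (hf n).sub aestronglyMeasurable_const)
    (fun n ω => (norm_sub_le _ _).trans (by gcongr; exact hC n ω))
    (fun ε hε => (h ε hε).mono fun n ω hω => hω.le)
  rw [tendsto_iff_norm_sub_tendsto_zero]
  refine squeeze_zero (fun _ => norm_nonneg _) (fun n => ?_) h1
  have hi : Integrable (f n) (μ n) := Integrable.of_bound (hf n) C (Eventually.of_forall (hC n))
  calc ‖∫ ω, f n ω ∂(μ n) - c‖ = ‖∫ ω, (f n ω - c) ∂(μ n)‖ := by
        rw [integral_sub hi (integrable_const _)]; simp
    _ ≤ _ := norm_integral_le_integral_norm _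

end InProbability

/-! ### Continuous truncation to balls. -/

section Cutoff

variable {E : Type*} [NormedAddCommGroup E]

/-- A continuous cutoff, equal to one on the ball of radius `K` and vanishing outside the ball of
radius `K + 1`. -/
noncomputable def cutoff (E : Type*) [NormedAddCommGroup E] (K : ℝ) :
    BoundedContinuousFunction E ℝ :=
  BoundedContinuousFunction.ofNormedAddCommGroup (fun x => max 0 (min 1 (K + 1 - ‖x‖)))
    (by fun_prop) 1 fun x => by
      rw [Real.norm_eq_abs, abs_of_nonneg (le_max_left _ _)]
      exact max_le zero_le_one (min_le_left _ _)

lemma cutoff_apply (K : ℝ) (x : E) : cutoff E K x = max 0 (min 1 (K + 1 - ‖x‖)) := rfl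

lemma cutoff_nonneg (K : ℝ) (x : E) : 0 ≤ cutoff E K x := le_max_left _ _

lemma cutoff_le_one (K : ℝ) (x : E) : cutoff E K x ≤ 1 := max_le zero_le_one (min_le_left _ _)

lemma cutoff_eq_zero {K : ℝ} {x : E} (h : K + 1 ≤ ‖x‖) : cutoff E K x = 0 := by
  rw [cutoff_apply]
  exact max_eq_left ((min_le_right _ _).trans (by linarith))

lemma cutoff_eq_one {K : ℝ} {x : E} (h : ‖x‖ ≤ K) : cutoff E K x = 1 := by
  rw [cutoff_apply, min_eq_left (by linarith), max_eq_right zero_le_one]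

lemma tendsto_cutoff (x : E) : Tendsto (fun K : ℕ => cutoff E K x) atTop (𝓝 1) := by
  obtain ⟨N, hN⟩ := exists_nat_ge ‖x‖
  refine tendsto_const_nhds.congr' ?_
  filter_upwards [eventually_ge_atTop N] with n hn
  exact (cutoff_eq_one (hN.trans (by exact_mod_cast hn))).symm

end Cutoff

/-! ### Convergence in distribution: Slutsky, tightness, constant limits. -/

section Distribution

variable {Ω : ℕ → Type*} [∀ n, MeasurableSpace (Ω n)] {μ : ∀ n, Measure (Ω n)}
  [∀ n, IsProbabilityMeasure (μ n)] {Ω' : Type*} [MeasurableSpace Ω'] {μ' : Measure Ω'}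
  [IsProbabilityMeasure μ'] {E : Type*} [NormedAddCommGroup E] [MeasurableSpace E] [BorelSpace E]
  {X Y : ∀ n, Ω n → E} {Z : Ω' → E}

lemma tendstoInDistribution_iff_integral (hX : ∀ n, AEMeasurable (X n) (μ n))
    (hZ : AEMeasurable Z μ') : TendstoInDistribution X atTop Z μ μ' ↔
    ∀ f : BoundedContinuousFunction E ℝ,
      Tendsto (fun n => ∫ ω, f (X n ω) ∂(μ n)) atTop (𝓝 (∫ ω, f (Z ω) ∂μ')) := by
  have key : ∀ f : BoundedContinuousFunction E ℝ,
      (Tendsto (fun n => ∫ x, f x ∂((μ n).map (X n))) atTop (𝓝 (∫ x, f x ∂(μ'.map Z))) ↔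
      Tendsto (fun n => ∫ ω, f (X n ω) ∂(μ n)) atTop (𝓝 (∫ ω, f (Z ω) ∂μ'))) := fun f => by
    rw [integral_map hZ f.continuous.aestronglyMeasurable]
    simp_rw [integral_map (hX _) f.continuous.aestronglyMeasurable]
  constructor
  · intro h f
    exact (key f).1 (ProbabilityMeasure.tendsto_iff_forall_integral_tendsto.1 h.tendsto f)
  · intro h
    exact ⟨hX, hZ, ProbabilityMeasure.tendsto_iff_forall_integral_tendsto.2
      fun f => (key f).2 (h f)⟩

/-- Slutsky's theorem for random variables on varying spaces. -/
lemma _root_.MeasureTheory.TendstoInDistribution.of_sub_tendstoInProb [SecondCountableTopology E]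
    (h : TendstoInDistribution X atTop Z μ μ') (hY : ∀ n, AEMeasurable (Y n) (μ n))
    (hYX : TendstoInProb μ (fun n ω => Y n ω - X n ω) 0) :
    TendstoInDistribution Y atTop Z μ μ' := by
  have hX := h.forall_aemeasurable
  refine ⟨hY, h.aemeasurable_limit, ?_⟩
  have h0 := h.tendsto
  refine tendsto_iff_forall_lipschitz_integral_tendsto.2 fun F hFb hFl => ?_
  have hF := tendsto_iff_forall_lipschitz_integral_tendsto.1 h0 F hFb hFl
  obtain ⟨M, hM⟩ := hFb
  obtain ⟨L, hL⟩ := hFl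
  have hFc : Continuous F := hL.continuous
  simp only [ProbabilityMeasure.coe_mk] at hF ⊢
  have e1 : ∀ n, ∫ x, F x ∂((μ n).map (X n)) = ∫ ω, F (X n ω) ∂(μ n) := fun n =>
    integral_map (hX n) hFc.aestronglyMeasurable
  have e2 : ∀ n, ∫ x, F x ∂((μ n).map (Y n)) = ∫ ω, F (Y n ω) ∂(μ n) := fun n =>
    integral_map (hY n) hFc.aestronglyMeasurable
  have hi : ∀ (n) (W : Ω n → E), AEMeasurable W (μ n) → Integrable (fun ω => F (W ω)) (μ n) := by
    intro n W hW
    refine Integrable.of_bound (hFc.measurable.comp_aemeasurable hW).aestronglyMeasurable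
      (‖F 0‖ + M) (Eventually.of_forall fun ω => ?_)
    have := hM (W ω) 0
    rw [Real.dist_eq] at this
    rw [Real.norm_eq_abs, Real.norm_eq_abs]
    linarith [abs_sub_abs_le_abs_sub (F (W ω)) (F 0)]
  have hd : Tendsto (fun n => ∫ ω, (F (Y n ω) - F (X n ω)) ∂(μ n)) atTop (𝓝 0) := by
    refine TendstoInProb.tendsto_integral (C := M)
      (fun n => ((hi n _ (hY n)).sub (hi n _ (hX n))).aestronglyMeasurable)
      (fun n ω => by rw [← dist_eq_norm]; exact hM _ _) fun ε hε => ?_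
    -- `L + 1` keeps the quotient meaningful when the Lipschitz constant is zero.
    refine (hYX (ε / (L + 1)) (by positivity)).mono fun n ω hω => ?_
    rw [sub_zero, ← dist_eq_norm]
    rw [sub_zero, ← dist_eq_norm, lt_div_iff₀ (by positivity)] at hω
    have := hL.dist_le_mul (Y n ω) (X n ω)
    nlinarith [dist_nonneg (x := Y n ω) (y := X n ω)]
  have := hF.add hd
  rw [add_zero] at this
  refine this.congr fun n => ?_
  rw [e1, e2, integral_sub (hi n _ (hY n)) (hi n _ (hX n))]
  ring

/-- A sequence that converges in distribution is bounded in probability. -/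
lemma _root_.MeasureTheory.TendstoInDistribution.bounded (h : TendstoInDistribution X atTop Z μ μ') {η : ℝ}
    (hη : 0 < η) : ∃ K : ℝ, ∀ᶠ n in atTop, (μ n).real {ω | ¬ ‖X n ω‖ ≤ K} ≤ η := by
  have hX := h.forall_aemeasurable
  have hZ := h.aemeasurable_limit
  have hlim := (tendstoInDistribution_iff_integral hX hZ).1 h
  -- The radius is found on the limit law, where the cutoffs integrate to nearly one, and is
  -- transferred to `X n` because a cutoff is bounded and continuous.
  have h1 : Tendsto (fun K : ℕ => ∫ ω, cutoff E K (Z ω) ∂μ') atTop (𝓝 (∫ _, (1 : ℝ) ∂μ')) := by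
    refine tendsto_integral_of_dominated_convergence (fun _ => 1)
      (fun K => ((cutoff E K).continuous.measurable.comp_aemeasurable hZ).aestronglyMeasurable)
      (integrable_const _) (fun K => Eventually.of_forall fun ω => ?_)
      (Eventually.of_forall fun ω => tendsto_cutoff _)
    rw [Real.norm_eq_abs, abs_of_nonneg (cutoff_nonneg _ _)]
    exact cutoff_le_one _ _
  rw [integral_const, probReal_univ, one_smul] at h1
  obtain ⟨K, hK⟩ := (h1.eventually_const_lt (show 1 - η < 1 by linarith)).exists
  -- The cutoff of radius `K` lies below the indicator of the ball of radius `K + 1`.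
  refine ⟨K + 1, ?_⟩
  filter_upwards [(hlim (cutoff E K)).eventually_const_lt hK] with n hn
  have hm : NullMeasurableSet {ω | ‖X n ω‖ ≤ K + 1} (μ n) :=
    nullMeasurableSet_le (hX n).norm aemeasurable_const
  have h2 : ∫ ω, cutoff E K (X n ω) ∂(μ n) ≤ (μ n).real {ω | ‖X n ω‖ ≤ K + 1} := by
    rw [← one_mul ((μ n).real _), ← integral_indicator_const_of_null hm]
    refine integral_mono_of_nonneg (Eventually.of_forall fun _ => cutoff_nonneg _ _)
      (integrable_indicator_const_of_null hm _) (Eventually.of_forall fun ω => ?_)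
    by_cases hω : ‖X n ω‖ ≤ K + 1
    · rw [Set.indicator_of_mem (by exact hω)]
      exact cutoff_le_one _ _
    · rw [Set.indicator_of_notMem (by exact hω)]
      exact (cutoff_eq_zero (not_le.1 hω).le).le
  have h3 : (μ n).real {ω | ‖X n ω‖ ≤ K + 1}ᶜ = 1 - (μ n).real {ω | ‖X n ω‖ ≤ K + 1} := by
    rw [measureReal_def, prob_compl_eq_one_sub₀ hm, ENNReal.toReal_sub_of_le prob_le_one
      ENNReal.one_ne_top, ENNReal.toReal_one, measureReal_def]
  change (μ n).real {ω | ‖X n ω‖ ≤ K + 1}ᶜ ≤ η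
  linarith

/-- Tightness allows an event to be checked on each fixed ball. This is how a matrix tending to zero
in probability is multiplied by a vector that is only bounded in probability. -/
lemma _root_.MeasureTheory.TendstoInDistribution.whp_of_bounded {p : ∀ n, Ω n → Prop}
    (h : TendstoInDistribution X atTop Z μ μ')
    (hp : ∀ K : ℝ, WHP μ fun n ω => ‖X n ω‖ ≤ K → p n ω) : WHP μ p := by
  refine (ENNReal.tendsto_toReal_iff (fun n => measure_ne_top _ _) ENNReal.zero_ne_top).1 ?_
  rw [ENNReal.toReal_zero, Metric.tendsto_nhds]
  intro ε hε
  obtain ⟨K, hK⟩ := h.bounded (half_pos hε)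
  have h1 := (ENNReal.tendsto_toReal ENNReal.zero_ne_top).comp (hp K)
  filter_upwards [hK, h1.eventually_lt_const (half_pos hε)] with n h2 h3
  rw [Real.dist_0_eq_abs, abs_of_nonneg ENNReal.toReal_nonneg]
  change (μ n).real _ < ε
  change (μ n).real _ < ε / 2 at h3
  calc (μ n).real {ω | ¬ p n ω} ≤ (μ n).real ({ω | ¬ ‖X n ω‖ ≤ K} ∪
          {ω | ¬ (‖X n ω‖ ≤ K → p n ω)}) := by
        refine measureReal_mono fun ω hω => ?_
        simp only [Set.mem_ofPred_eq, Set.mem_union] at hω ⊢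
        tauto
    _ ≤ _ := measureReal_union_le _ _
    _ < ε := by linarith

/-- The test function min(1, ‖x − c‖/ε) dominates the indicator of the exceptional event and
vanishes at `c`. This extracts a law of large numbers from characteristic functions. -/
lemma _root_.MeasureTheory.TendstoInDistribution.tendstoInProb_const {c : E}
    (h : TendstoInDistribution X atTop (fun _ => c) μ μ') : TendstoInProb μ X c := by
  intro ε hε
  have hX := h.forall_aemeasurable
  let f : BoundedContinuousFunction E ℝ :=
    BoundedContinuousFunction.ofNormedAddCommGroup (fun x => min 1 (ε⁻¹ * ‖x - c‖))
      (by fun_prop) 1 fun x => by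
        rw [Real.norm_eq_abs, abs_of_nonneg (le_min zero_le_one (by positivity))]
        exact min_le_left _ _
  have h1 := (tendstoInDistribution_iff_integral hX h.aemeasurable_limit).1 h f
  have hf : ∀ x, f x = min 1 (ε⁻¹ * ‖x - c‖) := fun _ => rfl
  simp only [hf, sub_self, norm_zero, mul_zero, zero_le_one, min_eq_right, integral_zero] at h1
  refine (ENNReal.tendsto_toReal_iff (fun n => measure_ne_top _ _) ENNReal.zero_ne_top).1 ?_
  refine squeeze_zero (fun _ => ENNReal.toReal_nonneg) (fun n => ?_) h1
  have hm : NullMeasurableSet {ω | ¬ ‖X n ω - c‖ < ε} (μ n) :=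
    (nullMeasurableSet_lt ((hX n).sub_const c).norm aemeasurable_const).compl
  change (μ n).real _ ≤ _
  rw [← one_mul ((μ n).real _), ← integral_indicator_const_of_null hm]
  refine integral_mono_of_nonneg (Eventually.of_forall fun ω => Set.indicator_nonneg (by simp) _)
    (Integrable.of_bound (f.continuous.measurable.comp_aemeasurable (hX n)).aestronglyMeasurable 1
      (Eventually.of_forall fun ω => ?_)) (Eventually.of_forall fun ω => ?_)
  · rw [Real.norm_eq_abs, abs_of_nonneg (le_min zero_le_one (by positivity))]
    exact min_le_left _ _
  · by_cases hω : ‖X n ω - c‖ < ε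
    · have : 0 ≤ min 1 (ε⁻¹ * ‖X n ω - c‖) := le_min zero_le_one (by positivity)
      rw [Set.indicator_of_notMem (by simpa using hω)]
      exact this
    · have : 1 ≤ ε⁻¹ * ‖X n ω - c‖ := by
        rw [inv_mul_eq_div, le_div_iff₀ hε]; linarith
      rw [Set.indicator_of_mem (by exact hω)]
      exact le_min le_rfl this

end Distribution

/-- Closed conditions valid for every `n` pass to the limit; symmetry and positivity of limit
covariances are obtained in this way. -/
lemma TendstoInProb.mem_of_isClosed {Ω : ℕ → Type*} [∀ n, MeasurableSpace (Ω n)]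
    {μ : ∀ n, Measure (Ω n)} [∀ n, IsProbabilityMeasure (μ n)] {E : Type*}
    [SeminormedAddCommGroup E] {X : ∀ n, Ω n → E} {c : E} (h : TendstoInProb μ X c) {s : Set E}
    (hs : IsClosed s) (hX : ∀ n ω, X n ω ∈ s) : c ∈ s := by
  by_contra hc
  have h1 := h.whp_of_mem_nhds (hs.isOpen_compl.mem_nhds hc)
  have h2 : ∀ n, μ n {ω | ¬ X n ω ∈ sᶜ} = 1 := fun n => by
    have : {ω | ¬ X n ω ∈ sᶜ} = Set.univ := by ext; simp [hX]
    rw [this, measure_univ]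
  simp only [WHP, h2] at h1
  exact one_ne_zero (tendsto_nhds_unique tendsto_const_nhds h1)

/-- Lindeberg's telescoping: the factors are exchanged one at a time, the remaining ones staying in
the unit disc. -/
lemma norm_prod_sub_prod_le {ι : Type*} (s : Finset ι) {a b : ι → ℂ} (ha : ∀ i, ‖a i‖ ≤ 1)
    (hb : ∀ i, ‖b i‖ ≤ 1) : ‖∏ i ∈ s, a i - ∏ i ∈ s, b i‖ ≤ ∑ i ∈ s, ‖a i - b i‖ := by
  classical
  induction s using Finset.induction_on with
  | empty => simp
  | insert i s hi ih =>
    rw [Finset.prod_insert hi, Finset.prod_insert hi, Finset.sum_insert hi]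
    have h1 : a i * ∏ j ∈ s, a j - b i * ∏ j ∈ s, b j =
        (a i - b i) * ∏ j ∈ s, a j + b i * (∏ j ∈ s, a j - ∏ j ∈ s, b j) := by ring
    have h2 : ‖∏ j ∈ s, a j‖ ≤ 1 := by
      rw [norm_prod]
      exact Finset.prod_le_one (fun _ _ => norm_nonneg _) fun j _ => ha j
    rw [h1]
    refine (norm_add_le _ _).trans (add_le_add ?_ ?_)
    · rw [norm_mul]
      exact mul_le_of_le_one_right (norm_nonneg _) h2
    · rw [norm_mul]
      exact (mul_le_of_le_one_left (norm_nonneg _) (hb i)).trans ih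

lemma measurable_cexp_I_mul {α : Type*} [MeasurableSpace α] {f : α → ℝ} (hf : Measurable f) :
    Measurable fun x => Complex.exp (Complex.I * f x) := by fun_prop

lemma norm_cexp_I_mul_le (x : ℝ) : ‖Complex.exp (Complex.I * x)‖ ≤ 1 := by
  rw [mul_comm, Complex.norm_exp_ofReal_mul_I]

/-! ### Characteristic functions of randomly weighted sums of i.i.d. vectors. -/

section Arrays

variable {U 𝒵 J : Type*} [MeasurableSpace U] [MeasurableSpace 𝒵] [Fintype J]

/-- The law of an independent pair of external randomness and a `G × n` array of i.i.d. points. -/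
noncomputable abbrev arrayLaw (ν : Measure U) (P : Measure 𝒵) (G n : ℕ) :
    Measure (U × (Fin G → Fin n → 𝒵)) :=
  ν.prod (Measure.pi fun _ => Measure.pi fun _ => P)

/-- The characteristic function of `ξ` under `P`, in coordinates. -/
noncomputable def coordCharFun (P : Measure 𝒵) (ξ : 𝒵 → J → ℝ) (a : J → ℝ) : ℂ :=
  ∫ z, Complex.exp (Complex.I * (∑ j, a j * ξ z j : ℝ)) ∂P

variable {ν : Measure U} [IsProbabilityMeasure ν] {P : Measure 𝒵} [IsProbabilityMeasure P] {G : ℕ}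

lemma norm_coordCharFun_le (ξ : 𝒵 → J → ℝ) (a : J → ℝ) : ‖coordCharFun P ξ a‖ ≤ 1 := by
  refine (norm_integral_le_of_norm_le_const (C := 1) (Eventually.of_forall fun z => ?_)).trans ?_
  · exact norm_cexp_I_mul_le _
  · simp

lemma measurable_coordCharFun {ξ : 𝒵 → J → ℝ} (hξ : Measurable ξ) :
    Measurable (coordCharFun P ξ) := by
  have : StronglyMeasurable fun p : (J → ℝ) × 𝒵 =>
      Complex.exp (Complex.I * (∑ j, p.1 j * ξ p.2 j : ℝ)) := by
    refine (measurable_cexp_I_mul ?_).stronglyMeasurable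
    fun_prop
  exact (this.integral_prod_right (ν := P)).measurable

lemma measurable_arraySum {n : ℕ} {ξ : 𝒵 → J → ℝ} (hξ : Measurable ξ)
    {w : Fin G → Fin n → J → U → ℝ} (hw : ∀ g i j, Measurable (w g i j)) :
    Measurable fun p : U × (Fin G → Fin n → 𝒵) =>
      ∑ g, ∑ i, ∑ j, w g i j p.1 * ξ (p.2 g i) j := by
  fun_prop

/-- For fixed `u` the weights are constants and the summands independent, so Fubini leaves a product
of one-point characteristic functions. -/
lemma integral_exp_arraySum {n : ℕ} {ξ : 𝒵 → J → ℝ} (hξ : Measurable ξ)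
    {w : Fin G → Fin n → J → U → ℝ} (hw : ∀ g i j, Measurable (w g i j)) :
    ∫ p, Complex.exp (Complex.I * (∑ g, ∑ i, ∑ j, w g i j p.1 * ξ (p.2 g i) j : ℝ))
      ∂(arrayLaw ν P G n) = ∫ u, ∏ g, ∏ i, coordCharFun P ξ (fun j => w g i j u) ∂ν := by
  rw [integral_prod]
  · refine integral_congr_ae (Eventually.of_forall fun u => ?_)
    have h1 : ∀ z : Fin G → Fin n → 𝒵,
        Complex.exp (Complex.I * (∑ g, ∑ i, ∑ j, w g i j u * ξ (z g i) j : ℝ)) =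
        ∏ g, (fun zg : Fin n → 𝒵 => ∏ i, (fun x : 𝒵 =>
          Complex.exp (Complex.I * (∑ j, w g i j u * ξ x j : ℝ))) (zg i)) (z g) := fun z => by
      simp only [← Complex.exp_sum, ← Finset.mul_sum]
      push_cast
      rfl
    simp only [h1]
    rw [integral_fintype_prod_eq_prod (fun g (zg : Fin n → 𝒵) => ∏ i, (fun x : 𝒵 =>
          Complex.exp (Complex.I * (∑ j, w g i j u * ξ x j : ℝ))) (zg i))]
    refine Finset.prod_congr rfl fun g _ => ?_
    rw [integral_fintype_prod_eq_prod (fun i (x : 𝒵) =>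
          Complex.exp (Complex.I * (∑ j, w g i j u * ξ x j : ℝ)))]
    rfl
  · refine Integrable.of_bound
      (measurable_cexp_I_mul (measurable_arraySum hξ hw)).aestronglyMeasurable 1
      (Eventually.of_forall fun p => norm_cexp_I_mul_le _)

/-- Weighted sums of i.i.d. vectors: if the characteristic function `φ` of one vector is
approximated by `ψ` near the origin, the characteristic function of the sum behaves like the product
of `ψ` at the weights. -/
lemma tendsto_integral_exp_arraySum {ξ : 𝒵 → J → ℝ} (hξ : Measurable ξ)
    {w : ∀ n, Fin G → Fin n → J → U → ℝ} (hw : ∀ n g i j, Measurable (w n g i j))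
    {ψ : (J → ℝ) → ℂ} {N : (J → ℝ) → ℝ} (hψ : ∀ a, ‖ψ a‖ ≤ 1)
    (happrox : ∀ ε > 0, ∃ δ > 0, ∀ a, ‖a‖ < δ → ‖coordCharFun P ξ a - ψ a‖ ≤ ε * N a)
    (hmax : ∀ δ > 0, WHP (fun _ => ν) fun n u => ∀ g i j, |w n g i j u| < δ)
    (hN : ∃ C, WHP (fun _ => ν) fun n u => ∑ g, ∑ i, N (fun j => w n g i j u) ≤ C) {c : ℂ}
    (hlim : TendstoInProb (fun _ => ν) (fun n u => ∏ g, ∏ i, ψ (fun j => w n g i j u)) c) :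
    Tendsto (fun n => ∫ p, Complex.exp (Complex.I *
      (∑ g, ∑ i, ∑ j, w n g i j p.1 * ξ (p.2 g i) j : ℝ)) ∂(arrayLaw ν P G n)) atTop (𝓝 c) := by
  have hφ := measurable_coordCharFun (P := P) hξ
  simp_rw [integral_exp_arraySum hξ (hw _)]
  have h0 : TendstoInProb (fun _ => ν) (fun n u =>
      ∏ g, ∏ i, coordCharFun P ξ (fun j => w n g i j u) -
      ∏ g, ∏ i, ψ (fun j => w n g i j u)) 0 := by
    intro ε hε
    obtain ⟨C, hC⟩ := hN
    -- The errors of all factors add up to this constant times the total of `N`, which is at most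
    -- `C` with high probability; hence the sum stays below ε.
    obtain ⟨δ, hδ, happ⟩ := happrox (ε / (|C| + 1)) (by positivity)
    refine ((hmax δ hδ).and hC).mono fun n u ⟨h1, h2⟩ => ?_
    rw [sub_zero]
    have h3 : ∀ g i, ‖fun j => w n g i j u‖ < δ := fun g i =>
      (pi_norm_lt_iff hδ).2 fun j => h1 g i j
    have h4 := norm_prod_sub_prod_le (Finset.univ : Finset (Fin G × Fin n))
      (a := fun x => coordCharFun P ξ (fun j => w n x.1 x.2 j u))
      (b := fun x => ψ (fun j => w n x.1 x.2 j u))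
      (fun _ => norm_coordCharFun_le _ _) (fun _ => hψ _)
    simp only [Fintype.prod_prod_type, Fintype.sum_prod_type] at h4
    refine h4.trans_lt ?_
    calc ∑ g, ∑ i, ‖coordCharFun P ξ (fun j => w n g i j u) - ψ (fun j => w n g i j u)‖
        ≤ ∑ g, ∑ i, ε / (|C| + 1) * N (fun j => w n g i j u) := by
          gcongr with g _ i _
          exact happ _ (h3 g i)
      _ = ε / (|C| + 1) * ∑ g, ∑ i, N (fun j => w n g i j u) := by
          simp only [Finset.mul_sum]
      _ ≤ ε / (|C| + 1) * |C| := by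
          gcongr
          exact h2.trans (le_abs_self C)
      _ < ε := by
          rw [div_mul_eq_mul_div, div_lt_iff₀ (by positivity)]
          linarith
  have h1 := h0.add hlim
  simp only [sub_add_cancel, zero_add] at h1
  refine h1.tendsto_integral (C := 1) (fun n => ?_) (fun n u => ?_)
  · refine Measurable.aestronglyMeasurable ?_
    refine Finset.measurable_prod _ fun g _ => Finset.measurable_prod _ fun i _ => ?_
    exact hφ.comp (measurable_pi_lambda _ fun j => hw n g i j)
  · rw [norm_prod]
    refine Finset.prod_le_one (fun _ _ => norm_nonneg _) fun g _ => ?_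
    rw [norm_prod]
    exact Finset.prod_le_one (fun _ _ => norm_nonneg _) fun i _ => norm_coordCharFun_le _ _

end Arrays

/-! ### Second-order expansion of characteristic functions under second moments. -/

section Taylor

variable {𝒵 J : Type*} [MeasurableSpace 𝒵] [Fintype J] {P : Measure 𝒵}

/-- The bound is cubic for small `y` and quadratic for large `y`. The minimum permits dominated
convergence with second moments only. -/
lemma norm_exp_taylor_two_le (y : ℝ) :
    ‖Complex.exp (Complex.I * y) - (1 + Complex.I * y - (y : ℂ) ^ 2 / 2)‖ ≤
      4 * y ^ 2 * min |y| 1 := by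
  have hn : ‖Complex.I * (y : ℂ)‖ = |y| := by simp
  rcases le_total |y| 1 with h | h
  · have := Complex.exp_bound (x := Complex.I * y) (by rwa [hn]) (n := 3) (by norm_num)
    rw [hn] at this
    have e : ∑ m ∈ Finset.range 3, (Complex.I * (y : ℂ)) ^ m / (m.factorial : ℂ) =
        1 + Complex.I * y - (y : ℂ) ^ 2 / 2 := by
      simp [Finset.sum_range_succ, mul_pow]
      ring
    rw [e] at this
    refine this.trans ?_
    rw [min_eq_left h, ← sq_abs y]
    have h3 := pow_nonneg (abs_nonneg y) 3
    have h4 : (((Nat.succ 3 : ℕ) : ℝ) * (((Nat.factorial 3 : ℕ) : ℝ) * ((3 : ℕ) : ℝ))⁻¹) ≤ 4 := by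
      norm_num [Nat.factorial]
    calc _ ≤ |y| ^ 3 * 4 := mul_le_mul_of_nonneg_left h4 h3
      _ = _ := by ring
  · rw [min_eq_right h]
    calc ‖Complex.exp (Complex.I * y) - (1 + Complex.I * y - (y : ℂ) ^ 2 / 2)‖
        ≤ ‖Complex.exp (Complex.I * y)‖ + (‖(1 : ℂ)‖ + ‖Complex.I * (y : ℂ)‖ +
          ‖(y : ℂ) ^ 2 / 2‖) :=
          (norm_sub_le _ _).trans (by
            gcongr
            exact (norm_sub_le _ _).trans (by gcongr; exact norm_add_le _ _))
      _ ≤ 1 + (1 + |y| + |y| ^ 2 / 2) := by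
          gcongr
          · exact norm_cexp_I_mul_le _
          · simp
          · rw [hn]
          · simp
      _ ≤ _ := by rw [← sq_abs y]; nlinarith

/-- Dominated convergence with dominating function R²; it plays the role of the Lindeberg condition.
-/
lemma tendsto_integral_sq_mul_min {R : 𝒵 → ℝ} (hR : MemLp R 2 P) (hR0 : ∀ z, 0 ≤ R z) :
    Tendsto (fun s : ℝ => ∫ z, R z ^ 2 * min (s * R z) 1 ∂P) (𝓝[≥] 0) (𝓝 0) := by
  have h0 : ∫ z, R z ^ 2 * min (0 * R z) 1 ∂P = 0 := by simp
  have hRm := hR.1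
  suffices Tendsto (fun s : ℝ => ∫ z, R z ^ 2 * min (s * R z) 1 ∂P) (𝓝[≥] 0)
      (𝓝 (∫ z, R z ^ 2 * min (0 * R z) 1 ∂P)) by rwa [h0] at this
  refine tendsto_integral_filter_of_dominated_convergence (fun z => R z ^ 2)
    (Eventually.of_forall fun s => ?_) ?_ hR.integrable_sq (Eventually.of_forall fun z => ?_)
  · exact (hRm.pow 2).mul ((hRm.const_mul s).inf aestronglyMeasurable_const)
  · filter_upwards [self_mem_nhdsWithin] with s hs
    refine Eventually.of_forall fun z => ?_
    have h1 : 0 ≤ min (s * R z) 1 := le_min (mul_nonneg hs (hR0 z)) zero_le_one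
    rw [norm_mul, Real.norm_eq_abs, Real.norm_eq_abs, abs_of_nonneg (sq_nonneg _),
      abs_of_nonneg h1]
    exact mul_le_of_le_one_right (sq_nonneg _) (min_le_right _ _)
  · have : Continuous fun s : ℝ => R z ^ 2 * min (s * R z) 1 := by fun_prop
    exact (this.tendsto 0).mono_left nhdsWithin_le_nhds

/-- The second moment form `∑ a_j a_k E[ξ_j ξ_k]`. -/
noncomputable def momentForm (P : Measure 𝒵) (ξ : 𝒵 → J → ℝ) (a : J → ℝ) : ℝ :=
  ∑ j, ∑ k, a j * a k * ∫ z, ξ z j * ξ z k ∂P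

lemma momentForm_eq {ξ : 𝒵 → J → ℝ} (hξ : ∀ j, MemLp (fun z => ξ z j) 2 P) (a : J → ℝ) :
    momentForm P ξ a = ∫ z, (∑ j, a j * ξ z j) ^ 2 ∂P := by
  have hi : ∀ j k, Integrable (fun z => ξ z j * ξ z k) P := fun j k => (hξ j).integrable_mul (hξ k)
  have : ∀ z, (∑ j, a j * ξ z j) ^ 2 = ∑ j, ∑ k, a j * a k * (ξ z j * ξ z k) := fun z => by
    rw [sq, Finset.sum_mul_sum]
    refine Finset.sum_congr rfl fun j _ => Finset.sum_congr rfl fun k _ => by ring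
  simp_rw [this]
  rw [integral_finsetSum _ fun j _ => integrable_finsetSum _ fun k _ => (hi j k).const_mul _]
  refine Finset.sum_congr rfl fun j _ => ?_
  rw [integral_finsetSum _ fun k _ => (hi j k).const_mul _]
  refine Finset.sum_congr rfl fun k _ => ?_
  rw [integral_const_mul]

lemma momentForm_nonneg {ξ : 𝒵 → J → ℝ} (hξ : ∀ j, MemLp (fun z => ξ z j) 2 P) (a : J → ℝ) :
    0 ≤ momentForm P ξ a := by
  rw [momentForm_eq hξ]
  exact integral_nonneg fun z => sq_nonneg _

/-- The intermediate term is 1 − Q(a)/2. Centring and the definition of Q make it the exact mean of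
the quadratic Taylor polynomial, and it differs from exp(−Q(a)/2) by O(Q(a)²) = O(‖a‖⁴). -/
lemma coordCharFun_approx [IsProbabilityMeasure P] {ξ : 𝒵 → J → ℝ} (hξ : ∀ j, MemLp (fun z => ξ z j) 2 P)
    (hξ0 : ∀ j, ∫ z, ξ z j ∂P = 0) : ∀ ε > 0, ∃ δ > 0, ∀ a : J → ℝ, ‖a‖ < δ →
      ‖coordCharFun P ξ a - Complex.exp (-(momentForm P ξ a : ℂ) / 2)‖ ≤ ε * ∑ j, a j ^ 2 := by
  intro ε hε
  set R : 𝒵 → ℝ := fun z => ∑ j, |ξ z j| with hRdef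
  have hR0 : ∀ z, 0 ≤ R z := fun z => Finset.sum_nonneg fun _ _ => abs_nonneg _
  have hR : MemLp R 2 P := memLp_finsetSum _ fun j _ => (hξ j).abs
  have hRi : Integrable (fun z => R z ^ 2) P := hR.integrable_sq
  set M : ℝ := ∫ z, R z ^ 2 ∂P with hM
  have hM0 : 0 ≤ M := integral_nonneg fun _ => sq_nonneg _
  have hnorm : Tendsto (fun a : J → ℝ => ‖a‖) (𝓝 0) (𝓝[≥] 0) :=
    tendsto_nhdsWithin_iff.2 ⟨by simpa using (continuous_norm (E := J → ℝ)).tendsto 0,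
      Eventually.of_forall fun a => norm_nonneg a⟩
  -- ε / 8 compensates the factor 4 of `norm_exp_taylor_two_le`, leaving half of the error budget.
  have h1 := hnorm.eventually ((tendsto_integral_sq_mul_min hR hR0).eventually_lt_const
    (show (0 : ℝ) < ε / 8 by positivity))
  -- Since Q(a) ≤ M‖a‖², this condition makes the exponential bound on [−1, 1] applicable, and the
  -- next one makes its quadratic error at most (ε / 2)‖a‖².
  have h2 : ∀ᶠ a : J → ℝ in 𝓝 0, M * ‖a‖ ^ 2 < 1 := by
    have : Continuous fun a : J → ℝ => M * ‖a‖ ^ 2 := by fun_prop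
    exact (this.tendsto 0).eventually_lt_const (by simp)
  have h3 : ∀ᶠ a : J → ℝ in 𝓝 0, M ^ 2 * ‖a‖ ^ 2 < ε / 2 := by
    have : Continuous fun a : J → ℝ => M ^ 2 * ‖a‖ ^ 2 := by fun_prop
    exact (this.tendsto 0).eventually_lt_const (by simpa using hε)
  obtain ⟨δ, hδ, h⟩ := Metric.eventually_nhds_iff.1 (h1.and (h2.and h3))
  refine ⟨δ, hδ, fun a ha => ?_⟩
  obtain ⟨h1, h2, h3⟩ := h (by rwa [dist_zero_right])
  set y : 𝒵 → ℝ := fun z => ∑ j, a j * ξ z j with hy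
  have hyR : ∀ z, |y z| ≤ ‖a‖ * R z := fun z => by
    refine (Finset.abs_sum_le_sum_abs _ _).trans ?_
    rw [hRdef, Finset.mul_sum]
    gcongr with j
    rw [abs_mul]
    gcongr
    exact norm_le_pi_norm a j
  have hyL : MemLp y 2 P := memLp_finsetSum _ fun j _ => (hξ j).const_mul _
  have hyi : Integrable y P := hyL.integrable one_le_two
  have hy2 : Integrable (fun z => y z ^ 2) P := hyL.integrable_sq
  have hy0 : ∫ z, y z ∂P = 0 := by
    rw [hy, integral_finsetSum _ fun j _ => ((hξ j).integrable one_le_two).const_mul _]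
    simp [integral_const_mul, hξ0]
  have hQ : momentForm P ξ a = ∫ z, y z ^ 2 ∂P := momentForm_eq hξ a
  have hy2R : ∀ z, y z ^ 2 ≤ ‖a‖ ^ 2 * R z ^ 2 := fun z => by
    rw [← mul_pow, ← sq_abs (y z)]
    exact pow_le_pow_left₀ (abs_nonneg _) (hyR z) 2
  have hQ0 := momentForm_nonneg hξ a
  have hQM : momentForm P ξ a ≤ ‖a‖ ^ 2 * M := by
    rw [hQ, hM, ← integral_const_mul]
    exact integral_mono hy2 (hRi.const_mul _) hy2R
  have ei : Integrable (fun z => Complex.exp (Complex.I * (y z : ℂ))) P :=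
    Integrable.of_bound (by
      have := hyL.1.aemeasurable
      exact AEMeasurable.aestronglyMeasurable (by fun_prop)) 1
      (Eventually.of_forall fun z => norm_cexp_I_mul_le _)
  have ti : Integrable (fun z => 1 + Complex.I * (y z : ℂ) - (y z : ℂ) ^ 2 / 2) P := by
    refine ((integrable_const _).add (hyi.ofReal.const_mul _)).sub ?_
    have := hy2.ofReal (𝕜 := ℂ)
    simp only [Complex.coe_algebraMap, RCLike.ofReal_pow] at this
    exact this.div_const 2
  have tint : ∫ z, (1 + Complex.I * (y z : ℂ) - (y z : ℂ) ^ 2 / 2) ∂P =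
      1 - (momentForm P ξ a : ℂ) / 2 := by
    have hy2' : Integrable (fun z => (y z : ℂ) ^ 2) P := by
      simpa using hy2.ofReal (𝕜 := ℂ)
    have hyi' : Integrable (fun z => Complex.I * (y z : ℂ)) P := hyi.ofReal.const_mul _
    have h1' : Integrable (fun z => 1 + Complex.I * (y z : ℂ)) P := (integrable_const _).add hyi'
    rw [integral_sub h1' (hy2'.div_const 2), integral_add (integrable_const _) hyi',
      integral_const_mul, integral_div, hQ]
    have e1 : ∫ z, (y z : ℂ) ∂P = 0 := by
      rw [integral_complex_ofReal, hy0, Complex.ofReal_zero]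
    have e2 : ∫ z, (y z : ℂ) ^ 2 ∂P = ((∫ z, y z ^ 2 ∂P : ℝ) : ℂ) := by
      rw [← integral_complex_ofReal]
      simp
    rw [e2]
    simp [e1]
  have b1 : ‖coordCharFun P ξ a - (1 - (momentForm P ξ a : ℂ) / 2)‖ ≤ ε / 2 * ‖a‖ ^ 2 := by
    rw [← tint, coordCharFun, ← integral_sub ei ti]
    have hdom : Integrable (fun z => 4 * ‖a‖ ^ 2 * (R z ^ 2 * min (‖a‖ * R z) 1)) P := by
      refine Integrable.const_mul (hRi.mono' ((hR.1.pow 2).mul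
        ((hR.1.const_mul _).inf aestronglyMeasurable_const)) (Eventually.of_forall fun z => ?_)) _
      have : 0 ≤ min (‖a‖ * R z) 1 := le_min (mul_nonneg (norm_nonneg _) (hR0 z)) zero_le_one
      change ‖R z ^ 2 * min (‖a‖ * R z) 1‖ ≤ R z ^ 2
      rw [norm_mul, Real.norm_eq_abs, Real.norm_eq_abs, abs_of_nonneg (sq_nonneg _),
        abs_of_nonneg this]
      exact mul_le_of_le_one_right (sq_nonneg _) (min_le_right _ _)
    refine (norm_integral_le_of_norm_le hdom (Eventually.of_forall fun z => ?_)).trans ?_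
    · refine (norm_exp_taylor_two_le (y z)).trans ?_
      have e3 : min |y z| 1 ≤ min (‖a‖ * R z) 1 := min_le_min_right _ (hyR z)
      have e4 : 0 ≤ min |y z| 1 := le_min (abs_nonneg _) zero_le_one
      calc 4 * y z ^ 2 * min |y z| 1 ≤ 4 * (‖a‖ ^ 2 * R z ^ 2) * min (‖a‖ * R z) 1 := by
            gcongr
            exact hy2R z
        _ = _ := by ring
    · rw [integral_const_mul]
      nlinarith [sq_nonneg ‖a‖]
  have b2 : ‖(1 - (momentForm P ξ a : ℂ) / 2) - Complex.exp (-(momentForm P ξ a : ℂ) / 2)‖ ≤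
      ε / 2 * ‖a‖ ^ 2 := by
    have hx : |-(momentForm P ξ a) / 2| ≤ 1 := by
      rw [abs_le]; constructor <;> nlinarith
    have := Real.abs_exp_sub_one_sub_id_le hx
    rw [norm_sub_rev]
    have e5 : Complex.exp (-(momentForm P ξ a : ℂ) / 2) - (1 - (momentForm P ξ a : ℂ) / 2) =
        ((Real.exp (-(momentForm P ξ a) / 2) - 1 - -(momentForm P ξ a) / 2 : ℝ) : ℂ) := by
      push_cast; ring
    rw [e5, Complex.norm_real, Real.norm_eq_abs]
    refine this.trans ?_
    have e6 : (-(momentForm P ξ a) / 2) ^ 2 ≤ (‖a‖ ^ 2 * M) ^ 2 := by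
      nlinarith
    nlinarith [sq_nonneg ‖a‖]
  have hna : ‖a‖ ^ 2 ≤ ∑ j, a j ^ 2 := by
    have hs : 0 ≤ ∑ j, a j ^ 2 := Finset.sum_nonneg fun _ _ => sq_nonneg _
    have : ‖a‖ ≤ √(∑ j, a j ^ 2) := by
      refine (pi_norm_le_iff_of_nonneg (Real.sqrt_nonneg _)).2 fun j => ?_
      rw [Real.norm_eq_abs]
      refine Real.abs_le_sqrt ?_
      exact Finset.single_le_sum (f := fun j => a j ^ 2) (fun _ _ => sq_nonneg _)
        (Finset.mem_univ j)
    calc ‖a‖ ^ 2 ≤ √(∑ j, a j ^ 2) ^ 2 := by gcongr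
      _ = _ := Real.sq_sqrt hs
  calc _ ≤ ‖coordCharFun P ξ a - (1 - (momentForm P ξ a : ℂ) / 2)‖ +
        ‖(1 - (momentForm P ξ a : ℂ) / 2) - Complex.exp (-(momentForm P ξ a : ℂ) / 2)‖ :=
        norm_sub_le_norm_sub_add_norm_sub _ _ _
    _ ≤ ε * ‖a‖ ^ 2 := by linarith
    _ ≤ _ := by gcongr

end Taylor

/-! ### Central limit theorem and law of large numbers with random weights. -/

section Limits

variable {U 𝒵 J : Type*} [MeasurableSpace U] [MeasurableSpace 𝒵] [Fintype J]
  {ν : Measure U} {P : Measure 𝒵} {G : ℕ}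

lemma ae_arrayLaw [IsProbabilityMeasure P] {n : ℕ} {q : 𝒵 → Prop} (h : ∀ᵐ z ∂P, q z) :
    ∀ᵐ p ∂(arrayLaw ν P G n), ∀ g i, q (p.2 g i) := by
  refine Measure.quasiMeasurePreserving_snd.ae (p := fun z : Fin G → Fin n → 𝒵 =>
    ∀ g i, q (z g i)) ?_
  refine ae_all_iff.2 fun g => ?_
  have h1 : ∀ᵐ zg ∂(Measure.pi fun _ : Fin n => P), ∀ i, q (zg i) :=
    ae_all_iff.2 fun i => (Measure.quasiMeasurePreserving_eval (fun _ : Fin n => P) i).ae h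
  exact (Measure.quasiMeasurePreserving_eval
    (fun _ : Fin G => Measure.pi fun _ : Fin n => P) g).ae h1

/-- The covariance matrix with entries `c_jk E[ξ_j ξ_k]`. -/
noncomputable def limitCov (P : Measure 𝒵) (ξ : 𝒵 → J → ℝ) (c : J → J → ℝ) : Matrix J J ℝ :=
  Matrix.of fun j k => c j k * ∫ z, ξ z j * ξ z k ∂P

lemma tendstoInProb_sum_momentForm {ξ : 𝒵 → J → ℝ} {w : ∀ n, Fin G → Fin n → J → U → ℝ}
    {c : J → J → ℝ}
    (hcross : ∀ j k, TendstoInProb (fun _ => ν)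
      (fun n u => ∑ g, ∑ i, w n g i j u * w n g i k u) (c j k)) (t : J → ℝ) :
    TendstoInProb (fun _ => ν) (fun n u => ∑ g, ∑ i, momentForm P ξ (fun j => t j * w n g i j u))
      (t ⬝ᵥ limitCov P ξ c *ᵥ t) := by
  have h := TendstoInProb.sum fun j => TendstoInProb.sum fun k =>
    (hcross j k).const_mul (t j * t k * ∫ z, ξ z j * ξ z k ∂P)
  have e : ∑ j, ∑ k, t j * t k * (∫ z, ξ z j * ξ z k ∂P) * c j k =
      t ⬝ᵥ limitCov P ξ c *ᵥ t := by
    simp only [dotProduct, Matrix.mulVec, limitCov, Matrix.of_apply, Finset.mul_sum]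
    refine Finset.sum_congr rfl fun j _ => Finset.sum_congr rfl fun k _ => by ring
  rw [e] at h
  refine h.congr fun n => Eventually.of_forall fun u => ?_
  have e2 : ∀ g i, momentForm P ξ (fun j => t j * w n g i j u) =
      ∑ j, ∑ k, t j * t k * (∫ z, ξ z j * ξ z k ∂P) * (w n g i j u * w n g i k u) := fun g i => by
    refine Finset.sum_congr rfl fun j _ => Finset.sum_congr rfl fun k _ => by ring
  simp only [e2, Finset.mul_sum]
  calc _ = ∑ j, ∑ g, ∑ i, ∑ k, t j * t k * (∫ z, ξ z j * ξ z k ∂P) *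
          (w n g i j u * w n g i k u) := by
        refine Finset.sum_congr rfl fun j _ => ?_
        rw [Finset.sum_comm]
        refine Finset.sum_congr rfl fun g _ => ?_
        rw [Finset.sum_comm]
    _ = _ := by
        rw [Finset.sum_comm]
        refine Finset.sum_congr rfl fun g _ => ?_
        rw [Finset.sum_comm]

/-- The matrix `c` is only given as a limit, so even its symmetry has to be inherited from the sums
at finite `n`. -/
lemma limitCov_posSemidef [IsProbabilityMeasure ν] {ξ : 𝒵 → J → ℝ} (hξ : ∀ j, MemLp (fun z => ξ z j) 2 P)
    {w : ∀ n, Fin G → Fin n → J → U → ℝ} {c : J → J → ℝ}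
    (hcross : ∀ j k, TendstoInProb (fun _ => ν)
      (fun n u => ∑ g, ∑ i, w n g i j u * w n g i k u) (c j k)) :
    (limitCov P ξ c).PosSemidef := by
  have hsymm : ∀ j k, c j k = c k j := fun j k => by
    have h := (hcross j k).add ((hcross k j).const_mul (-1))
    have h0 : c j k + -1 * c k j ∈ ({0} : Set ℝ) :=
      h.mem_of_isClosed isClosed_singleton fun n u => by
        simp only [Set.mem_singleton_iff]
        have : ∑ g, ∑ i, w n g i j u * w n g i k u = ∑ g, ∑ i, w n g i k u * w n g i j u :=
          Finset.sum_congr rfl fun g _ => Finset.sum_congr rfl fun i _ => mul_comm _ _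
        rw [this]; ring
    simp only [Set.mem_singleton_iff] at h0
    linarith
  refine Matrix.PosSemidef.of_dotProduct_mulVec_nonneg ?_ fun t => ?_
  · ext j k
    simp only [limitCov, Matrix.conjTranspose_apply, Matrix.of_apply, star_trivial]
    rw [hsymm k j]
    simp only [mul_comm (ξ _ k)]
  · have h := tendstoInProb_sum_momentForm (P := P) (ξ := ξ) hcross t
    have := h.mem_of_isClosed (isClosed_Ici (a := (0 : ℝ))) fun n u =>
      Finset.sum_nonneg fun g _ => Finset.sum_nonneg fun i _ => momentForm_nonneg hξ _
    simpa using this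

variable [IsProbabilityMeasure ν] [IsProbabilityMeasure P]

/-- Central limit theorem for sums of i.i.d. vectors with random weights. -/
theorem tendstoInDistribution_arraySum [DecidableEq J] {ξ : 𝒵 → J → ℝ} (hξm : Measurable ξ)
    (hξ : ∀ j, MemLp (fun z => ξ z j) 2 P) (hξ0 : ∀ j, ∫ z, ξ z j ∂P = 0)
    {w : ∀ n, Fin G → Fin n → J → U → ℝ} (hw : ∀ n g i j, Measurable (w n g i j))
    (hmax : ∀ δ > 0, WHP (fun _ => ν) fun n u => ∀ g i j, |w n g i j u| < δ)
    {c : J → J → ℝ} (hcross : ∀ j k, TendstoInProb (fun _ => ν)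
      (fun n u => ∑ g, ∑ i, w n g i j u * w n g i k u) (c j k)) :
    TendstoInDistribution (fun n (p : U × (Fin G → Fin n → 𝒵)) =>
        WithLp.toLp 2 fun j => ∑ g, ∑ i, w n g i j p.1 * ξ (p.2 g i) j) atTop
      (id : EuclideanSpace ℝ J → _) (fun n => arrayLaw ν P G n)
      (multivariateGaussian 0 (limitCov P ξ c)) := by
  have hm : ∀ n, Measurable fun p : U × (Fin G → Fin n → 𝒵) =>
      (WithLp.toLp 2 fun j => ∑ g, ∑ i, w n g i j p.1 * ξ (p.2 g i) j : EuclideanSpace ℝ J) :=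
    fun n => by fun_prop
  refine ⟨fun n => (hm n).aemeasurable, aemeasurable_id,
    ProbabilityMeasure.tendsto_of_tendsto_charFun fun t => ?_⟩
  simp only [ProbabilityMeasure.coe_mk, Measure.map_id]
  rw [charFun_multivariateGaussian (limitCov_posSemidef hξ hcross), inner_zero_right]
  -- The frequency `t` is absorbed into the weights. With a Gaussian approximant, the product of the
  -- factors is the exponential of a sum of moment forms, whose limit is known.
  have h := tendsto_integral_exp_arraySum (ν := ν) (P := P) (G := G) hξm
    (w := fun n g i j u => t j * w n g i j u)
    (fun n g i j => (hw n g i j).const_mul _) (ψ := fun a => Complex.exp (-(momentForm P ξ a : ℂ) / 2))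
    (N := fun a => ∑ j, a j ^ 2) (c := Complex.exp (-((t ⬝ᵥ limitCov P ξ c *ᵥ t : ℝ) : ℂ) / 2))
    (fun a => ?_) (coordCharFun_approx hξ hξ0) ?_ ?_ ?_
  · refine (h.congr fun n => ?_).trans (by
      rw [Complex.ofReal_zero, zero_mul, zero_sub, ← neg_div])
    rw [charFun_apply, integral_map (hm n).aemeasurable
      (Measurable.aestronglyMeasurable (by fun_prop))]
    refine integral_congr_ae (Eventually.of_forall fun p => ?_)
    simp only [EuclideanSpace.inner_eq_star_dotProduct, star_trivial, dotProduct]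
    rw [mul_comm Complex.I]
    congr 3
    simp only [Finset.mul_sum]
    symm
    rw [Finset.sum_comm]
    refine Finset.sum_congr rfl fun g _ => ?_
    rw [Finset.sum_comm]
    refine Finset.sum_congr rfl fun i _ => Finset.sum_congr rfl fun j _ => by ring
  · have := momentForm_nonneg hξ a
    rw [← Complex.ofReal_neg, ← Complex.ofReal_ofNat, ← Complex.ofReal_div, Complex.norm_exp_ofReal,
      Real.exp_le_one_iff]
    linarith
  · intro δ hδ
    have hM : 0 < ‖(t : J → ℝ)‖ + 1 := by positivity
    refine (hmax (δ / (‖(t : J → ℝ)‖ + 1)) (by positivity)).mono fun n u h g i j => ?_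
    have h1 := h g i j
    rw [lt_div_iff₀ hM] at h1
    rw [abs_mul]
    have h2 : |t j| ≤ ‖(t : J → ℝ)‖ := norm_le_pi_norm (t : J → ℝ) j
    nlinarith [abs_nonneg (w n g i j u)]
  · have h1 := TendstoInProb.sum fun j => (hcross j j).const_mul (t j ^ 2)
    refine ⟨∑ j, t j ^ 2 * c j j + 1, (h1 1 one_pos).mono fun n u hu => ?_⟩
    have e : ∑ g, ∑ i, ∑ j, (t j * w n g i j u) ^ 2 =
        ∑ j, t j ^ 2 * ∑ g, ∑ i, w n g i j u * w n g i j u := by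
      simp only [Finset.mul_sum]
      rw [Finset.sum_comm (γ := J)]
      refine Finset.sum_congr rfl fun g _ => ?_
      rw [Finset.sum_comm]
      refine Finset.sum_congr rfl fun i _ => Finset.sum_congr rfl fun j _ => by ring
    rw [e]
    rw [Real.norm_eq_abs, abs_lt] at hu
    linarith [hu.2]
  · have h1 := (tendstoInProb_sum_momentForm (P := P) (ξ := ξ) hcross t).comp
      (f := fun x : ℝ => Complex.exp (-(x : ℂ) / 2)) (by fun_prop)
    refine h1.congr fun n => Eventually.of_forall fun u => ?_
    simp only [← Complex.exp_sum]
    congr 1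
    push_cast
    simp only [neg_div, Finset.sum_neg_distrib, Finset.sum_div]

/-- The characteristic function of an integrable variable with mean m has derivative i·m at 0, as
does exp(itm); hence their difference is o(t). The index type `Unit` lets the vector-valued array
lemma be reused. -/
lemma coordCharFun_approx_one {ξ : 𝒵 → ℝ} (hξm : Measurable ξ) (hξ : Integrable ξ P) :
    ∀ ε > 0, ∃ δ > 0, ∀ a : Unit → ℝ, ‖a‖ < δ →
      ‖coordCharFun P (fun z (_ : Unit) => ξ z) a -
        Complex.exp (Complex.I * (a () * ∫ z, ξ z ∂P : ℝ))‖ ≤ ε * |a ()| := by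
  intro ε hε
  set m := ∫ z, ξ z ∂P
  have : IsProbabilityMeasure (P.map ξ) := Measure.isProbabilityMeasure_map hξm.aemeasurable
  have hid : MemLp id 1 (P.map ξ) := by
    rw [memLp_map_measure_iff aestronglyMeasurable_id hξm.aemeasurable]
    exact memLp_one_iff_integrable.2 hξ
  have h1 : HasDerivAt (charFun (P.map ξ)) (Complex.I * m) 0 := by
    have hd := ((contDiff_charFun (n := 1) (by exact_mod_cast hid)).differentiable
      (by norm_num) 0).hasDerivAt
    rw [← iteratedDeriv_one, iteratedDeriv_charFun_zero (by exact_mod_cast hid)] at hd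
    rw [pow_one, integral_map hξm.aemeasurable (by fun_prop)] at hd
    simpa using hd
  have h2 : HasDerivAt (fun t : ℝ => Complex.exp (Complex.I * (t * m : ℝ))) (Complex.I * m) 0 := by
    have h3 : HasDerivAt (fun t : ℝ => Complex.I * (t * m : ℝ)) (Complex.I * m) 0 := by
      have := ((hasDerivAt_id (0 : ℝ)).mul_const m).ofReal_comp.const_mul Complex.I
      simpa using this
    have := h3.cexp
    simpa using this
  have h3 := (h1.sub h2).isLittleO
  rw [Asymptotics.isLittleO_iff] at h3
  obtain ⟨δ, hδ, h4⟩ := Metric.eventually_nhds_iff.1 (h3 hε)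
  refine ⟨δ, hδ, fun a ha => ?_⟩
  have h5 := h4 (y := a ()) (by
    rw [dist_zero_right]
    exact (norm_le_pi_norm a ()).trans_lt ha)
  have e : coordCharFun P (fun z (_ : Unit) => ξ z) a = charFun (P.map ξ) (a ()) := by
    rw [charFun_apply_real, integral_map hξm.aemeasurable (by fun_prop)]
    simp [coordCharFun, mul_comm Complex.I]
  rw [e]
  simpa using h5

/-- Weak law of large numbers for sums of i.i.d. variables with random weights. -/
theorem tendstoInProb_arraySum {ξ : 𝒵 → ℝ} (hξ : Integrable ξ P)
    {w : ∀ n, Fin G → Fin n → U → ℝ} (hw : ∀ n g i, Measurable (w n g i))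
    (hmax : ∀ δ > 0, WHP (fun _ => ν) fun n u => ∀ g i, |w n g i u| < δ)
    (hN : ∃ C, WHP (fun _ => ν) fun n u => ∑ g, ∑ i, |w n g i u| ≤ C) {ρ : ℝ}
    (hρ : TendstoInProb (fun _ => ν) (fun n u => ∑ g, ∑ i, w n g i u) ρ) :
    TendstoInProb (fun n => arrayLaw ν P G n)
      (fun n p => ∑ g, ∑ i, w n g i p.1 * ξ (p.2 g i)) (ρ * ∫ z, ξ z ∂P) := by
  -- A measurable version of `ξ` changes the sums only on a null set, since each data point has law
  -- `P`.
  wlog hξm : Measurable ξ generalizing ξ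
  · have hm := hξ.1.aemeasurable
    have h1 := this (hξ.congr hm.ae_eq_mk) hm.measurable_mk
    rw [← integral_congr_ae hm.ae_eq_mk] at h1
    refine h1.congr fun n => ?_
    filter_upwards [ae_arrayLaw (ν := ν) (G := G) (n := n) hm.ae_eq_mk] with p hp
    simp only [hp]
  have hm : ∀ n, Measurable fun p : U × (Fin G → Fin n → 𝒵) =>
      ∑ g, ∑ i, w n g i p.1 * ξ (p.2 g i) := fun n => by fun_prop
  refine TendstoInDistribution.tendstoInProb_const
    (μ' := (Measure.dirac () : Measure Unit)) ⟨fun n => (hm n).aemeasurable, aemeasurable_const,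
      ProbabilityMeasure.tendsto_of_tendsto_charFun fun t => ?_⟩
  simp only [ProbabilityMeasure.coe_mk, Measure.map_const, measure_univ, one_smul]
  rw [charFun_dirac]
  have h := tendsto_integral_exp_arraySum (ν := ν) (P := P) (G := G)
    (ξ := fun z (_ : Unit) => ξ z) (by fun_prop)
    (w := fun n g i _ u => t * w n g i u) (fun n g i _ => (hw n g i).const_mul _)
    (ψ := fun a => Complex.exp (Complex.I * (a () * ∫ z, ξ z ∂P : ℝ)))
    (N := fun a => |a ()|) (c := Complex.exp (Complex.I * (t * (ρ * ∫ z, ξ z ∂P) : ℝ)))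
    (fun a => norm_cexp_I_mul_le _) (coordCharFun_approx_one hξm hξ) ?_ ?_ ?_
  · have e : Complex.exp ((inner ℝ (ρ * ∫ z, ξ z ∂P) t : ℝ) * Complex.I) =
        Complex.exp (Complex.I * (t * (ρ * ∫ z, ξ z ∂P) : ℝ)) := by
      rw [mul_comm Complex.I]
      simp [mul_comm]
    rw [e]
    refine h.congr fun n => ?_
    rw [charFun_apply_real, integral_map (hm n).aemeasurable
      (Measurable.aestronglyMeasurable (by fun_prop))]
    refine integral_congr_ae (Eventually.of_forall fun p => ?_)
    simp only [Finset.univ_unique, Finset.sum_singleton]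
    rw [mul_comm Complex.I, ← Complex.ofReal_mul]
    congr 3
    simp only [Finset.mul_sum, mul_assoc]
  · intro δ hδ
    refine (hmax (δ / (|t| + 1)) (by positivity)).mono fun n u h g i _ => ?_
    have h1 := h g i
    rw [lt_div_iff₀ (by positivity)] at h1
    rw [abs_mul]
    nlinarith [abs_nonneg (w n g i u)]
  · obtain ⟨C, hC⟩ := hN
    refine ⟨|t| * C, hC.mono fun n u hu => ?_⟩
    simp only [abs_mul, ← Finset.mul_sum]
    gcongr
  · have h1 := hρ.comp (f := fun x : ℝ => Complex.exp (Complex.I * (t * (x * ∫ z, ξ z ∂P) : ℝ)))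
      (by fun_prop)
    refine h1.congr fun n => Eventually.of_forall fun u => ?_
    simp only [← Complex.exp_sum, ← Finset.mul_sum, ← Complex.ofReal_sum, Finset.sum_mul, mul_assoc]

end Limits

/-! ### Laplace transforms determine measures; tilting a Gaussian translates it. -/

section Laplace

/-- With exponential moments of all orders the complex moment generating function is determined on
the whole plane by its values on the real line, and it contains the characteristic function. -/
lemma measure_ext_of_integral_exp {μ μ' : Measure ℝ} [IsProbabilityMeasure μ]
    [IsProbabilityMeasure μ'] (hint : ∀ t : ℝ, Integrable (fun x => Real.exp (t * x)) μ)
    (h : ∀ t : ℝ, ∫ x, Real.exp (t * x) ∂μ = ∫ x, Real.exp (t * x) ∂μ') : μ = μ' := by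
  refine Measure.ext_of_complexMGF_id_eq (funext fun z => ?_)
  refine eqOn_complexMGF_of_mgf (funext h) ?_
  have : integrableExpSet id μ = Set.univ := Set.eq_univ_of_forall hint
  change z.re ∈ interior (integrableExpSet id μ)
  rw [this, interior_univ]
  trivial

lemma exists_strongDual_eq_dotProduct {d : ℕ} (ℓ : StrongDual ℝ (Vec d)) :
    ∃ t : Vec d, ∀ w, ℓ w = t ⬝ᵥ w :=
  ⟨fun i => ℓ (Pi.single i 1), fun w => by
    conv_lhs => rw [pi_eq_sum_univ' w]
    simp [dotProduct, mul_comm, map_sum]⟩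

/-- Cramér–Wold: each one-dimensional marginal is determined by the Laplace transform along a line
`s • t`. -/
lemma measure_ext_of_integral_exp_dotProduct {d : ℕ} {μ μ' : Measure (Vec d)}
    [IsProbabilityMeasure μ] [IsProbabilityMeasure μ']
    (hint : ∀ t : Vec d, Integrable (fun w => Real.exp (t ⬝ᵥ w)) μ)
    (h : ∀ t : Vec d, ∫ w, Real.exp (t ⬝ᵥ w) ∂μ = ∫ w, Real.exp (t ⬝ᵥ w) ∂μ') : μ = μ' := by
  refine Measure.ext_of_charFunDual (funext fun ℓ => ?_)
  obtain ⟨t, ht⟩ := exists_strongDual_eq_dotProduct ℓ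
  have hm : Measurable ℓ := ℓ.continuous.measurable
  have := Measure.isProbabilityMeasure_map (μ := μ) hm.aemeasurable
  have := Measure.isProbabilityMeasure_map (μ := μ') hm.aemeasurable
  rw [charFunDual_eq_charFun_map_one, charFunDual_eq_charFun_map_one]
  congr 1
  refine measure_ext_of_integral_exp (fun s => ?_) fun s => ?_
  · rw [integrable_map_measure (by fun_prop) hm.aemeasurable]
    simpa [Function.comp_def, ht, smul_dotProduct] using hint (s • t)
  · rw [integral_map hm.aemeasurable (by fun_prop), integral_map hm.aemeasurable (by fun_prop)]
    simpa [ht, smul_dotProduct] using h (s • t)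

lemma continuous_exp_dotProduct {d : ℕ} (t : Vec d) :
    Continuous fun w : Vec d => Real.exp (t ⬝ᵥ w) := by
  unfold dotProduct
  fun_prop

lemma continuous_dotProduct_right {d : ℕ} (t : Vec d) : Continuous fun w : Vec d => t ⬝ᵥ w := by
  unfold dotProduct
  fun_prop

variable {d : ℕ} {V : Matrix (Fin d) (Fin d) ℝ} {N : Measure (Vec d)}

/-- A non-integrable function has Bochner integral zero, whereas the right side is positive; the
formula itself forces integrability. -/
lemma integrable_exp_dotProduct
    (hN : ∀ t, ∫ w, Real.exp (t ⬝ᵥ w) ∂N = Real.exp ((t ⬝ᵥ V *ᵥ t) / 2)) (t : Vec d) :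
    Integrable (fun w => Real.exp (t ⬝ᵥ w)) N := by
  by_contra hc
  have := hN t
  rw [integral_undef hc] at this
  exact (Real.exp_pos _).ne this

/-- Exponential tilting of a centred Gaussian measure is a translation. -/
lemma withDensity_exp_eq_map_add [IsProbabilityMeasure N] (hV : Vᵀ = V)
    (hN : ∀ t, ∫ w, Real.exp (t ⬝ᵥ w) ∂N = Real.exp ((t ⬝ᵥ V *ᵥ t) / 2)) (θ : Vec d) :
    N.withDensity (fun w => ENNReal.ofReal (Real.exp (θ ⬝ᵥ w - (θ ⬝ᵥ V *ᵥ θ) / 2))) =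
      N.map fun w => w + V *ᵥ θ := by
  have hint := integrable_exp_dotProduct hN
  have hsymm : ∀ t, t ⬝ᵥ V *ᵥ θ = θ ⬝ᵥ V *ᵥ t := fun t => by
    rw [Matrix.dotProduct_mulVec, ← Matrix.mulVec_transpose, hV, dotProduct_comm]
  have hc : Continuous fun w : Vec d => Real.exp (θ ⬝ᵥ w - (θ ⬝ᵥ V *ᵥ θ) / 2) :=
    Real.continuous_exp.comp ((continuous_dotProduct_right θ).sub continuous_const)
  have hm : Measurable fun w : Vec d => w + V *ᵥ θ := by fun_prop
  have hi : ∀ t : Vec d, Integrable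
      (fun w => Real.exp (θ ⬝ᵥ w - (θ ⬝ᵥ V *ᵥ θ) / 2) * Real.exp (t ⬝ᵥ w)) N := fun t => by
    refine ((hint (θ + t)).const_mul (Real.exp (-(θ ⬝ᵥ V *ᵥ θ) / 2))).congr
      (Eventually.of_forall fun w => ?_)
    simp only [← Real.exp_add, add_dotProduct]
    ring_nf
  -- The Laplace transform of the tilted measure comes from that of `N` at `θ + t`; symmetry of `V`
  -- merges the two cross terms. At `t = 0` it gives total mass one.
  have hint1 : ∀ t : Vec d, ∫ w, Real.exp (θ ⬝ᵥ w - (θ ⬝ᵥ V *ᵥ θ) / 2) * Real.exp (t ⬝ᵥ w) ∂N =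
      Real.exp ((t ⬝ᵥ V *ᵥ t) / 2 + θ ⬝ᵥ V *ᵥ t) := fun t => by
    have : ∀ w, Real.exp (θ ⬝ᵥ w - (θ ⬝ᵥ V *ᵥ θ) / 2) * Real.exp (t ⬝ᵥ w) =
        Real.exp (-(θ ⬝ᵥ V *ᵥ θ) / 2) * Real.exp ((θ + t) ⬝ᵥ w) := fun w => by
      simp only [← Real.exp_add, add_dotProduct]
      ring_nf
    simp_rw [this]
    rw [integral_const_mul, hN, ← Real.exp_add]
    congr 1
    rw [Matrix.mulVec_add, add_dotProduct, dotProduct_add, dotProduct_add, hsymm t]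
    ring
  have hprob : IsProbabilityMeasure
      (N.withDensity (fun w => ENNReal.ofReal (Real.exp (θ ⬝ᵥ w - (θ ⬝ᵥ V *ᵥ θ) / 2)))) := by
    refine ⟨?_⟩
    have h0 := hint1 0
    have h1 := hi 0
    simp only [zero_dotProduct, Real.exp_zero, mul_one, Matrix.mulVec_zero, dotProduct_zero,
      zero_div, add_zero] at h0 h1
    rw [withDensity_apply _ MeasurableSet.univ, Measure.restrict_univ,
      ← ofReal_integral_eq_lintegral_ofReal h1
        (Eventually.of_forall fun w => (Real.exp_pos _).le), h0, ENNReal.ofReal_one]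
  have := Measure.isProbabilityMeasure_map (μ := N) hm.aemeasurable
  have hfin : ∀ᵐ w ∂N, ENNReal.ofReal (Real.exp (θ ⬝ᵥ w - (θ ⬝ᵥ V *ᵥ θ) / 2)) < ∞ :=
    Eventually.of_forall fun w => ENNReal.ofReal_lt_top
  refine measure_ext_of_integral_exp_dotProduct (fun t => ?_) fun t => ?_
  · rw [integrable_withDensity_iff_integrable_smul' hc.measurable.ennreal_ofReal hfin]
    refine (hi t).congr (Eventually.of_forall fun w => ?_)
    simp [ENNReal.toReal_ofReal (Real.exp_pos _).le]
  · rw [integral_withDensity_eq_integral_toReal_smul hc.measurable.ennreal_ofReal hfin,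
      integral_map hm.aemeasurable
        (continuous_exp_dotProduct t).aestronglyMeasurable]
    simp only [ENNReal.toReal_ofReal (Real.exp_pos _).le, smul_eq_mul]
    rw [hint1]
    simp_rw [dotProduct_add, Real.exp_add, hsymm t]
    rw [integral_mul_const, hN]

/-- The functional w ↦ tᵀw is a centred real Gaussian of variance tᵀVt, and the claim is its moment
generating function at 1. -/
lemma integral_exp_dotProduct_multivariateGaussian (hV : V.PosSemidef) (t : Vec d) :
    ∫ w, Real.exp (t ⬝ᵥ w) ∂((multivariateGaussian 0 V).map WithLp.ofLp) =
      Real.exp ((t ⬝ᵥ V *ᵥ t) / 2) := by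
  set g := multivariateGaussian (0 : EuclideanSpace ℝ (Fin d)) V with hg
  have hid : MemLp id 2 g := IsGaussian.memLp_two_id
  set ℓ : StrongDual ℝ (EuclideanSpace ℝ (Fin d)) := innerSL ℝ (WithLp.toLp 2 t) with hℓ
  have hℓw : ∀ w, ℓ w = t ⬝ᵥ w.ofLp := fun w => by
    simp [hℓ, PiLp.inner_apply, dotProduct, mul_comm]
  rw [integral_map (by fun_prop)
    (continuous_exp_dotProduct t).aestronglyMeasurable]
  have h1 := mgf_gaussianReal (IsGaussian.map_eq_gaussianReal (μ := g) ℓ) 1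
  have hmean : ∫ w, ℓ w ∂g = 0 := by
    rw [ContinuousLinearMap.integral_comp_id_comm IsGaussian.integrable_id, hg,
      integral_id_multivariateGaussian, map_zero]
  have hvar : Var[ℓ; g] = t ⬝ᵥ V *ᵥ t := by
    have := covarianceBilin_self hid (WithLp.toLp 2 t)
    rw [covarianceBilin_multivariateGaussian hV] at this
    exact this.symm
  rw [hmean, hvar, Real.coe_toNNReal _ (hvar ▸ variance_nonneg _ _)] at h1
  simp only [mgf, one_mul, zero_add, one_pow, mul_one, hℓw] at h1
  exact h1

end Laplace

/-! ### Linear regression for Gaussian vectors. -/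

section Regression

variable {E : Type*} [NormedAddCommGroup E] [NormedSpace ℝ E] [FiniteDimensional ℝ E]
  [MeasurableSpace E] [BorelSpace E]

/-- Linear regression: the components of a centred Gaussian vector can be decorrelated by a
continuous linear map. -/
lemma exists_indepFun_sub {d : ℕ} {P : Measure (E × Vec d)} [IsGaussian P]
    (hP : ∫ w, w ∂P = 0) :
    ∃ a : E →L[ℝ] Vec d, IndepFun (fun w => w.1) (fun w => w.2 - a w.1) P := by
  have : CompleteSpace E := FiniteDimensional.complete ℝ E
  have hid : MemLp id 2 P := IsGaussian.memLp_two_id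
  have hL : ∀ ℓ : StrongDual ℝ (E × Vec d), MemLp ℓ 2 P := fun ℓ => hid.continuousLinearMap_comp ℓ
  have hmean : ∀ ℓ : StrongDual ℝ (E × Vec d), ∫ w, ℓ w ∂P = 0 := fun ℓ => by
    rw [ContinuousLinearMap.integral_comp_id_comm IsGaussian.integrable_id]
    exact (congrArg ℓ hP).trans (map_zero ℓ)
  -- For centred functionals covariance is the L² inner product, so each coordinate of the second
  -- component can be projected orthogonally onto the span of the functionals of the first. No
  -- nondegeneracy is needed, and for Gaussian vectors an uncorrelated residual is independent.
  let toL2 : StrongDual ℝ (E × Vec d) →L[ℝ] Lp ℝ 2 P := StrongDual.toLp P 2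
  have htoL2 : ∀ ℓ, toL2 ℓ =ᵐ[P] ℓ := fun ℓ => by
    have : toL2 ℓ = MemLp.toLp ℓ (hL ℓ) := StrongDual.toLp_apply hid ℓ
    rw [this]
    exact MemLp.coeFn_toLp _
  have hinner : ∀ ℓ ℓ', inner ℝ (toL2 ℓ) (toL2 ℓ') = cov[ℓ, ℓ'; P] := fun ℓ ℓ' => by
    rw [covariance_eq_sub (hL ℓ) (hL ℓ'), hmean, hmean, mul_zero, sub_zero, L2.inner_def]
    refine integral_congr_ae ?_
    filter_upwards [htoL2 ℓ, htoL2 ℓ'] with w h1 h2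
    simp [h1, h2, mul_comm]
  let pre : StrongDual ℝ E →ₗ[ℝ] Lp ℝ 2 P :=
    { toFun := fun ℓ => toL2 (ℓ.comp (ContinuousLinearMap.fst ℝ E (Vec d)))
      map_add' := fun ℓ ℓ' => by rw [← map_add]; rfl
      map_smul' := fun c ℓ => by rw [RingHom.id_apply, ← map_smul]; rfl }
  have hproj : ∀ i : Fin d, ∃ a : StrongDual ℝ E, ∀ ℓ : StrongDual ℝ E,
      cov[ℓ.comp (ContinuousLinearMap.fst ℝ E (Vec d)),
        ((ContinuousLinearMap.proj i).comp (ContinuousLinearMap.snd ℝ E (Vec d)) -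
          a.comp (ContinuousLinearMap.fst ℝ E (Vec d)) : StrongDual ℝ (E × Vec d)); P] = 0 := fun i => by
    set y := toL2 ((ContinuousLinearMap.proj i).comp (ContinuousLinearMap.snd ℝ E (Vec d))) with hy
    obtain ⟨v, hv, z, hz, hvz⟩ := Submodule.exists_add_mem_mem_orthogonal (K := LinearMap.range pre) y
    obtain ⟨a, ha⟩ := hv
    refine ⟨a, fun ℓ => ?_⟩
    rw [← hinner, map_sub, ← hy]
    have : z = y - toL2 (a.comp (ContinuousLinearMap.fst ℝ E (Vec d))) := by
      rw [hvz, ← ha]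
      simp [pre]
    rw [← this]
    exact hz _ ⟨ℓ, rfl⟩
  choose a ha using hproj
  refine ⟨ContinuousLinearMap.pi a, ?_⟩
  have hG : HasGaussianLaw (fun w : E × Vec d => (w.1, w.2 - ContinuousLinearMap.pi a w.1)) P := by
    have h0 : HasGaussianLaw (id : E × Vec d → E × Vec d) P := IsGaussian.hasGaussianLaw_id
    exact h0.map_fun ((ContinuousLinearMap.fst ℝ E (Vec d)).prod
      (ContinuousLinearMap.snd ℝ E (Vec d) -
        (ContinuousLinearMap.pi a).comp (ContinuousLinearMap.fst ℝ E (Vec d))))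
  refine hG.indepFun_of_covariance_strongDual fun L₁ L₂ => ?_
  obtain ⟨t, ht⟩ := exists_strongDual_eq_dotProduct L₂
  have e2 : L₂ ∘ (fun w : E × Vec d => w.2 - ContinuousLinearMap.pi a w.1) =
      ∑ i, t i • (⇑((ContinuousLinearMap.proj i).comp (ContinuousLinearMap.snd ℝ E (Vec d)) -
          (a i).comp (ContinuousLinearMap.fst ℝ E (Vec d))) : E × Vec d → ℝ) := by
    ext w
    simp [ht, dotProduct]
  have e1 : L₁ ∘ (fun w : E × Vec d => w.1) =
    ⇑(L₁.comp (ContinuousLinearMap.fst ℝ E (Vec d))) := rfl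
  rw [e1, e2, covariance_sum_right (fun i => (hL _).const_smul (t i)) (hL _)]
  refine Finset.sum_eq_zero fun i _ => ?_
  rw [covariance_smul_right, ha, mul_zero]

end Regression

/-! ### The sequential law as an exponential tilt of the Gaussian reference limit. -/

section Sequential

variable {d : ℕ}

/-- All but the last generation of a path. -/
abbrev pastPath {G : ℕ} (w : Fin (G + 1) → Vec d × Vec d) : Fin G → Vec d × Vec d :=
  fun j => w j.castSucc

/-- The log-likelihood ratio of the new score given the past, in the Gaussian limit. -/
noncomputable def logLRStep (V : Matrix (Fin d) (Fin d) ℝ) (θ t : Vec d) : ℝ :=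
  θ ⬝ᵥ t - (θ ⬝ᵥ V *ᵥ θ) / 2

/-- The log-likelihood ratio of the workflow law with respect to the reference law, in the
Gaussian limit. -/
noncomputable def logLR (V : Matrix (Fin d) (Fin d) ℝ) :
    (G : ℕ) → (Fin G → Vec d × Vec d) → ℝ
  | 0, _ => 0
  | G + 1, w => logLR V G (pastPath w) + logLRStep V (lastTheta (pastPath w)) (w (Fin.last G)).1

lemma continuous_lastTheta {G : ℕ} :
    Continuous (lastTheta : (Fin G → Vec d × Vec d) → Vec d) := by
  cases G with
  | zero => exact continuous_const
  | succ G => exact continuous_snd.comp (continuous_apply (Fin.last G))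

lemma continuous_logLRStep (V : Matrix (Fin d) (Fin d) ℝ) :
    Continuous fun p : Vec d × Vec d => logLRStep V p.1 p.2 := by
  unfold logLRStep Matrix.mulVec dotProduct
  fun_prop

lemma continuous_pastPath {G : ℕ} :
    Continuous (pastPath : (Fin (G + 1) → Vec d × Vec d) → _) := by
  unfold pastPath
  fun_prop

lemma continuous_logLR (V : Matrix (Fin d) (Fin d) ℝ) (G : ℕ) : Continuous (logLR V G) := by
  induction G with
  | zero => exact continuous_const
  | succ G ih =>
    refine (ih.comp continuous_pastPath).add ((continuous_logLRStep V).comp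
      ((continuous_lastTheta.comp continuous_pastPath).prodMk ?_))
    fun_prop

/-- The likelihood ratio as an extended nonnegative real. -/
noncomputable abbrev expLR (V : Matrix (Fin d) (Fin d) ℝ) (G : ℕ) (w : Fin G → Vec d × Vec d) :
    ℝ≥0∞ := ENNReal.ofReal (Real.exp (logLR V G w))

lemma measurable_expLR (V : Matrix (Fin d) (Fin d) ℝ) (G : ℕ) : Measurable (expLR V G) :=
  (Real.continuous_exp.comp (continuous_logLR V G)).measurable.ennreal_ofReal

lemma measurable_expLRStep {G : ℕ} (V : Matrix (Fin d) (Fin d) ℝ) :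
    Measurable fun x : (Fin G → Vec d × Vec d) × Vec d =>
      expLR V G x.1 * ENNReal.ofReal (Real.exp (logLRStep V (lastTheta x.1) x.2)) :=
  ((measurable_expLR V G).comp measurable_fst).mul (Real.continuous_exp.comp
    ((continuous_logLRStep V).comp
      ((continuous_lastTheta.comp continuous_fst).prodMk continuous_snd))).measurable.ennreal_ofReal

lemma measurable_shift {G : ℕ} (V : Matrix (Fin d) (Fin d) ℝ) :
    Measurable fun p : (Fin G → Vec d × Vec d) × Vec d => (p.1, p.2 + V *ᵥ lastTheta p.1) :=
  measurable_fst.prodMk (measurable_snd.add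
    ((Continuous.matrix_mulVec continuous_const continuous_id).measurable.comp
      (measurable_lastTheta.comp measurable_fst)))

/-- For a fixed past the shift of the score by `V *ᵥ lastTheta` is an exponential tilt, by
`withDensity_exp_eq_map_add`; Fubini combines this with the density of the past. -/
lemma map_shift_withDensity {G : ℕ} {V : Matrix (Fin d) (Fin d) ℝ} {N : Measure (Vec d)}
    [IsProbabilityMeasure N] (hV : Vᵀ = V)
    (hN : ∀ t, ∫ w, Real.exp (t ⬝ᵥ w) ∂N = Real.exp ((t ⬝ᵥ V *ᵥ t) / 2))
    (Q : Measure (Fin G → Vec d × Vec d)) [SFinite Q] :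
    ((Q.withDensity (expLR V G)).prod N).map (fun p => (p.1, p.2 + V *ᵥ lastTheta p.1)) =
      (Q.prod N).withDensity fun x =>
        expLR V G x.1 * ENNReal.ofReal (Real.exp (logLRStep V (lastTheta x.1) x.2)) := by
  refine Measure.ext_of_lintegral _ fun f hf => ?_
  have hfT : Measurable fun p : (Fin G → Vec d × Vec d) × Vec d =>
      f (p.1, p.2 + V *ᵥ lastTheta p.1) := hf.comp (measurable_shift V)
  rw [lintegral_map hf (measurable_shift V), lintegral_prod _ hfT.aemeasurable,
    lintegral_withDensity_eq_lintegral_mul _ (measurable_expLR V G) hfT.lintegral_prod_right',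
    lintegral_withDensity_eq_lintegral_mul _ (measurable_expLRStep V) hf,
    lintegral_prod _ ((measurable_expLRStep V).mul hf).aemeasurable]
  refine lintegral_congr fun s => ?_
  have hfs : Measurable fun w => f (s, w) := hf.comp measurable_prodMk_left
  have htilt := withDensity_exp_eq_map_add hV hN (lastTheta s)
  have hm : Measurable fun w : Vec d => w + V *ᵥ lastTheta s := by fun_prop
  have hd : Measurable fun w : Vec d =>
      ENNReal.ofReal (Real.exp (lastTheta s ⬝ᵥ w - (lastTheta s ⬝ᵥ V *ᵥ lastTheta s) / 2)) :=
    (Real.continuous_exp.comp ((continuous_logLRStep V).comp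
      (continuous_const.prodMk continuous_id))).measurable.ennreal_ofReal
  have h1 : ∫⁻ w, f (s, w + V *ᵥ lastTheta s) ∂N =
      ∫⁻ w, f (s, w) ∂(N.map fun w => w + V *ᵥ lastTheta s) := (lintegral_map hfs hm).symm
  rw [← htilt, lintegral_withDensity_eq_lintegral_mul _ hd hfs] at h1
  simp only [Pi.mul_apply] at h1 ⊢
  rw [h1]
  simp_rw [mul_assoc]
  exact (lintegral_const_mul' _ _ ENNReal.ofReal_ne_top).symm

/-- A density that only sees the first coordinate leaves the conditional law of the second
unchanged. This is why the estimate is drawn from its reference conditional law. -/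
lemma withDensity_compProd_left {α β : Type*} [MeasurableSpace α] [MeasurableSpace β]
    {μ : Measure α} [SFinite μ] {κ : Kernel α β} [IsSFiniteKernel κ] {f : α → ℝ≥0∞}
    (hf : Measurable f) [SFinite (μ.withDensity f)] :
    μ.withDensity f ⊗ₘ κ = (μ ⊗ₘ κ).withDensity fun p => f p.1 := by
  refine Measure.ext_of_lintegral _ fun g hg => ?_
  have hf' : Measurable fun p : α × β => f p.1 := hf.comp measurable_fst
  rw [Measure.lintegral_compProd hg,
    lintegral_withDensity_eq_lintegral_mul _ hf (Measurable.lintegral_kernel_prod_right' hg),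
    lintegral_withDensity_eq_lintegral_mul _ hf' hg, Measure.lintegral_compProd (hf'.mul hg)]
  refine lintegral_congr fun a => ?_
  simp only [Pi.mul_apply]
  exact (lintegral_const_mul _ (hg.comp measurable_prodMk_left)).symm

lemma withDensity_map_eq {α β : Type*} [MeasurableSpace α] [MeasurableSpace β]
    {μ : Measure α} {T : α → β} (hT : Measurable T) {f : β → ℝ≥0∞} (hf : Measurable f) :
    (μ.map T).withDensity f = (μ.withDensity fun a => f (T a)).map T := by
  refine Measure.ext_of_lintegral _ fun g hg => ?_
  have hfT : Measurable fun a => f (T a) := hf.comp hT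
  have hgT : Measurable fun a => g (T a) := hg.comp hT
  rw [lintegral_withDensity_eq_lintegral_mul _ hf hg, lintegral_map (hf.mul hg) hT,
    lintegral_map hg hT, lintegral_withDensity_eq_lintegral_mul _ hfT hgT]
  rfl

lemma isGaussian_map_linearMap {E F : Type*} [NormedAddCommGroup E] [NormedSpace ℝ E]
    [FiniteDimensional ℝ E] [MeasurableSpace E] [BorelSpace E] [NormedAddCommGroup F]
    [NormedSpace ℝ F] [MeasurableSpace F] [BorelSpace F] {P : Measure E} [IsGaussian P]
    (ℓ : E →ₗ[ℝ] F) : IsGaussian (P.map ℓ) :=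
  isGaussian_map (LinearMap.toContinuousLinearMap ℓ)

/-- `lastTheta` as a linear map. -/
def lastThetaₗ (d G : ℕ) : (Fin G → Vec d × Vec d) →ₗ[ℝ] Vec d where
  toFun := lastTheta
  map_add' v w := by cases G <;> simp [lastTheta]
  map_smul' c w := by cases G <;> simp [lastTheta]

/-- Coordinates of a path: the past, the last score, the last estimate. -/
lemma snoc_pastPath {G : ℕ} (w : Fin (G + 1) → Vec d × Vec d) :
    (Fin.snoc (pastPath w) ((w (Fin.last G)).1, (w (Fin.last G)).2) : Fin (G + 1) → Vec d × Vec d)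
      = w := Fin.snoc_init_self w

variable {V : Matrix (Fin d) (Fin d) ℝ} {N : Measure (Vec d)}
  {Γ : (G : ℕ) → ProbabilityMeasure (Fin G → Vec d × Vec d)}

/-- `Fin.snoc` as a linear map on paths. -/
def snocₗ (d G : ℕ) : ((Fin G → Vec d × Vec d) × Vec d) × Vec d →ₗ[ℝ]
    (Fin (G + 1) → Vec d × Vec d) where
  toFun p := Fin.snoc p.1.1 (p.1.2, p.2)
  map_add' p q := by
    ext j : 1
    refine Fin.lastCases ?_ (fun j => ?_) j <;> simp
  map_smul' c p := by
    ext j : 1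
    refine Fin.lastCases ?_ (fun j => ?_) j <;> simp

/-- The sequential law has the Gaussian likelihood ratio as its density with respect to the
reference law, and is Gaussian. -/
theorem sequentialLaw_eq_withDensity (hV : Vᵀ = V) [IsGaussian N]
    (hN : ∀ t, ∫ w, Real.exp (t ⬝ᵥ w) ∂N = Real.exp ((t ⬝ᵥ V *ᵥ t) / 2))
    (hΓ : ∀ G, IsGaussian (Γ G : Measure (Fin G → Vec d × Vec d)))
    (hΓ0 : ∀ G, ∫ w, w ∂(Γ G : Measure (Fin G → Vec d × Vec d)) = 0)
    (hpast : ∀ G, (Γ (G + 1) : Measure (Fin (G + 1) → Vec d × Vec d)).map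
      (fun w => (pastPath w, (w (Fin.last G)).1)) = (Γ G : Measure _).prod N) (G : ℕ) :
    sequentialLaw V Γ G = (Γ G : Measure _).withDensity (expLR V G) ∧
      IsGaussian (sequentialLaw V Γ G) := by
  induction G with
  | zero =>
    have h0 : (Γ 0 : Measure (Fin 0 → Vec d × Vec d)) = Measure.dirac Fin.elim0 := by
      refine Measure.ext_of_lintegral _ fun f hf => ?_
      have : ∀ w, f w = f Fin.elim0 := fun w => congrArg f (Subsingleton.elim _ _)
      simp [this]
    refine ⟨?_, by unfold sequentialLaw; infer_instance⟩
    have h1 : expLR V 0 = 1 := by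
      ext w
      simp [expLR, logLR]
    rw [h1, withDensity_one, h0]
    rfl
  | succ G ih =>
    obtain ⟨ih1, ih2⟩ := ih
    set P := (Γ (G + 1) : Measure (Fin (G + 1) → Vec d × Vec d)) with hP
    set Q := (Γ G : Measure (Fin G → Vec d × Vec d)) with hQ
    have hX : Measurable fun w : Fin (G + 1) → Vec d × Vec d => (pastPath w, (w (Fin.last G)).1) := by
      unfold pastPath; fun_prop
    have hY : Measurable fun w : Fin (G + 1) → Vec d × Vec d => (w (Fin.last G)).2 := by fun_prop
    have hXY := hX.prodMk hY
    have hS : Measurable fun p : ((Fin G → Vec d × Vec d) × Vec d) × Vec d =>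
        (Fin.snoc p.1.1 (p.1.2, p.2) : Fin (G + 1) → Vec d × Vec d) :=
      (measurable_snoc G).comp ((measurable_fst.comp measurable_fst).prodMk
        ((measurable_snd.comp measurable_fst).prodMk measurable_snd))
    have hN' : P.map (fun w => (w (Fin.last G)).1) = N := by
      have : P.map (fun w => (w (Fin.last G)).1) =
          (P.map (fun w => (pastPath w, (w (Fin.last G)).1))).map Prod.snd := by
        rw [Measure.map_map measurable_snd hX]
        rfl
      rw [this, hpast, Measure.map_snd_prod, measure_univ, one_smul]
    set D : (Fin G → Vec d × Vec d) × Vec d → ℝ≥0∞ := fun x =>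
        expLR V G x.1 * ENNReal.ofReal (Real.exp (logLRStep V (lastTheta x.1) x.2)) with hD
    have hDm : Measurable D := measurable_expLRStep V
    have hDf : Measurable fun p : ((Fin G → Vec d × Vec d) × Vec d) × Vec d => D p.1 :=
      hDm.comp measurable_fst
    have hτ : ((sequentialLaw V Γ G).prod N).map (fun p => (p.1, p.2 + V *ᵥ lastTheta p.1)) =
        (Q.prod N).withDensity D := by
      rw [ih1]
      exact map_shift_withDensity hV hN Q
    set τ := ((sequentialLaw V Γ G).prod N).map (fun p => (p.1, p.2 + V *ᵥ lastTheta p.1)) with hτdef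
    have hτprob : IsProbabilityMeasure τ :=
      Measure.isProbabilityMeasure_map (measurable_shift V).aemeasurable
    have hτG : IsGaussian τ := by
      let ℓ : (Fin G → Vec d × Vec d) × Vec d →ₗ[ℝ] (Fin G → Vec d × Vec d) × Vec d :=
        (LinearMap.fst ℝ _ _).prod (LinearMap.snd ℝ _ _ +
          V.mulVecLin ∘ₗ lastThetaₗ d G ∘ₗ LinearMap.fst ℝ _ _)
      exact isGaussian_map_linearMap (P := (sequentialLaw V Γ G).prod N) ℓ
    -- The reference law is disintegrated over the past and the last score. The density `D` does not
    -- involve the last estimate and can be pulled out of the composition.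
    have hseq : sequentialLaw V Γ (G + 1) = ((P.map fun w =>
        ((pastPath w, (w (Fin.last G)).1), (w (Fin.last G)).2)).withDensity fun p => D p.1).map
          fun p => Fin.snoc p.1.1 (p.1.2, p.2) := by
      rw [sequentialLaw]
      congr 1
      rw [hN', ← hτdef, ← compProd_map_condDistrib hY.aemeasurable, hpast]
      have : SFinite ((Q.prod N).withDensity D) := hτ ▸ inferInstance
      rw [hτ, withDensity_compProd_left hDm]
    refine ⟨?_, ?_⟩
    · rw [hseq, withDensity_map_eq hXY hDf, Measure.map_map hS hXY]
      have h1 : ((fun p : ((Fin G → Vec d × Vec d) × Vec d) × Vec d =>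
          (Fin.snoc p.1.1 (p.1.2, p.2) : Fin (G + 1) → Vec d × Vec d)) ∘ fun w =>
          ((pastPath w, (w (Fin.last G)).1), (w (Fin.last G)).2)) = id := by
        funext w
        exact snoc_pastPath w
      rw [h1, Measure.map_id]
      congr 1
      funext w
      simp only [hD, expLR, logLR, Real.exp_add]
      rw [ENNReal.ofReal_mul (Real.exp_pos _).le]
    · let ℓ : (Fin (G + 1) → Vec d × Vec d) →ₗ[ℝ] ((Fin G → Vec d × Vec d) × Vec d) × Vec d :=
        { toFun := fun w => ((pastPath w, (w (Fin.last G)).1), (w (Fin.last G)).2)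
          map_add' := fun _ _ => rfl
          map_smul' := fun _ _ => rfl }
      have hM : IsGaussian (P.map ℓ) := isGaussian_map_linearMap ℓ
      have hM0 : ∫ x, x ∂(P.map ℓ) = 0 := by
        have h1 : ∫ x, x ∂(P.map ℓ) = ∫ w, ℓ w ∂P :=
          integral_map hXY.aemeasurable aestronglyMeasurable_id
        rw [h1]
        have h2 := ContinuousLinearMap.integral_comp_id_comm (μ := P) IsGaussian.integrable_id
          (LinearMap.toContinuousLinearMap ℓ)
        refine h2.trans ((congrArg _ (hΓ0 (G + 1))).trans (map_zero _))
      -- Regressing the last estimate on the past and the last score writes the reference law as a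
      -- linear image of the product `(Q.prod N).prod R`, with `R` the residual law. Tilting acts on
      -- the first factor only and replaces it by the Gaussian `τ`, so the tilted law is a linear
      -- image of a Gaussian product.
      obtain ⟨a, ha⟩ := exists_indepFun_sub hM0
      set R := (P.map ℓ).map fun w => w.2 - a w.1 with hR
      have hRm : Measurable fun w : ((Fin G → Vec d × Vec d) × Vec d) × Vec d => w.2 - a w.1 :=
        measurable_snd.sub (a.continuous.measurable.comp measurable_fst)
      have hRG : IsGaussian R := isGaussian_map_linearMap (P := P.map ℓ)
        (LinearMap.snd ℝ _ _ - a.toLinearMap ∘ₗ LinearMap.fst ℝ _ _)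
      have hfst : (P.map ℓ).map (fun w => w.1) = Q.prod N := by
        rw [← hpast]
        exact Measure.map_map measurable_fst hXY
      have hprod := (indepFun_iff_map_prod_eq_prod_map_map measurable_fst.aemeasurable
        hRm.aemeasurable).1 ha
      rw [hfst, ← hR] at hprod
      set Φ : ((Fin G → Vec d × Vec d) × Vec d) × Vec d →ₗ[ℝ]
          ((Fin G → Vec d × Vec d) × Vec d) × Vec d := (LinearMap.fst ℝ _ _).prod
            (a.toLinearMap ∘ₗ LinearMap.fst ℝ _ _ + LinearMap.snd ℝ _ _) with hΦ
      have hΦm : Measurable Φ := (LinearMap.toContinuousLinearMap Φ).continuous.measurable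
      have hback : P.map ℓ = ((Q.prod N).prod R).map Φ := by
        rw [← hprod, Measure.map_map hΦm (measurable_fst.prodMk hRm)]
        have : (Φ ∘ fun w : ((Fin G → Vec d × Vec d) × Vec d) × Vec d => (w.1, w.2 - a w.1)) = id := by
          funext w
          simp [hΦ]
        rw [this, Measure.map_id]
      have hfinal : (P.map ℓ).withDensity (fun p => D p.1) = (τ.prod R).map Φ := by
        rw [hback, withDensity_map_eq hΦm hDf, hτ, prod_withDensity_left hDm]
        rfl
      have hG1 : IsGaussian ((P.map ℓ).withDensity (fun p => D p.1)) := by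
        rw [hfinal]
        exact isGaussian_map_linearMap Φ
      rw [hseq]
      exact isGaussian_map_linearMap (P := (P.map ℓ).withDensity (fun p => D p.1)) (snocₗ d G)

end Sequential

/-! ### Smoothness of Laplace transforms inside their domain. -/

section LaplaceTransform

variable {d : ℕ} {lam : Measure (Vec d)}

/-- Measurable functions of polynomial growth. -/
def PolyGrowth (φ : Vec d → ℝ) : Prop :=
  Measurable φ ∧ ∃ C, ∃ k : ℕ, ∀ t, |φ t| ≤ C * (1 + ∑ i, |t i|) ^ k

lemma PolyGrowth.mul_coord {φ : Vec d → ℝ} (h : PolyGrowth φ) (i : Fin d) :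
    PolyGrowth fun t => φ t * t i := by
  obtain ⟨hm, C, k, hC⟩ := h
  refine ⟨hm.mul (measurable_pi_apply i), C, k + 1, fun t => ?_⟩
  have h1 : |t i| ≤ 1 + ∑ i, |t i| := by
    have : |t i| ≤ ∑ i, |t i| :=
      Finset.single_le_sum (f := fun i => |t i|) (fun _ _ => abs_nonneg _) (Finset.mem_univ i)
    linarith
  rw [abs_mul, pow_succ, ← mul_assoc]
  exact mul_le_mul (hC t) h1 (abs_nonneg _) ((abs_nonneg _).trans (hC t))

lemma polyGrowth_one : PolyGrowth fun _ : Vec d => 1 :=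
  ⟨measurable_const, 1, 0, fun t => by simp⟩

/-- The set where the Laplace transform of `lam` is finite. -/
def laplaceDomain (lam : Measure (Vec d)) : Set (Vec d) :=
  {η | Integrable (fun t => Real.exp (η ⬝ᵥ t)) lam}

/-- The Laplace transform of `φ lam`. -/
noncomputable def laplace (lam : Measure (Vec d)) (φ : Vec d → ℝ) (η : Vec d) : ℝ :=
  ∫ t, φ t * Real.exp (η ⬝ᵥ t) ∂lam

/-- A vector of signs. -/
def signVec (σ : Fin d → Bool) : Vec d := fun i => if σ i then 1 else -1

lemma norm_signVec_le (σ : Fin d → Bool) : ‖signVec σ‖ ≤ 1 := by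
  refine (pi_norm_le_iff_of_nonneg zero_le_one).2 fun i => ?_
  unfold signVec
  split_ifs <;> simp

/-- The signs of the coordinates of `t` select the sign vector for which one summand equals the left
side. Summing over all signs gives a dominating function independent of the orthant. -/
lemma exp_dotProduct_add_le (η t : Vec d) (c : ℝ) :
    Real.exp (η ⬝ᵥ t + c * ∑ i, |t i|) ≤
      ∑ σ : Fin d → Bool, Real.exp ((η + c • signVec σ) ⬝ᵥ t) := by
  have h1 : η ⬝ᵥ t + c * ∑ i, |t i| = (η + c • signVec fun i => decide (0 ≤ t i)) ⬝ᵥ t := by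
    rw [add_dotProduct, smul_dotProduct, smul_eq_mul]
    congr 2
    refine Finset.sum_congr rfl fun i _ => ?_
    simp only [signVec, decide_eq_true_eq]
    split_ifs with h
    · rw [abs_of_nonneg h, one_mul]
    · rw [abs_of_neg (not_le.1 h), neg_one_mul]
  rw [h1]
  exact Finset.single_le_sum (f := fun σ => Real.exp ((η + c • signVec σ) ⬝ᵥ t))
    (fun _ _ => (Real.exp_pos _).le) (Finset.mem_univ _)

/-- With S = ∑|tᵢ|, moving η by less than ε costs a factor exp(εS), and polynomial growth is
absorbed by another exp(εS). The resulting shifts by 2ε times a sign vector stay within δ = 4ε of η.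
The radius does not depend on `φ`, so all partial derivatives can be dominated on one ball. -/
lemma exists_laplace_bound {η : Vec d} (hη : η ∈ interior (laplaceDomain lam)) :
    ∃ ε > 0, ∀ φ, PolyGrowth φ → ∃ b : Vec d → ℝ, Integrable b lam ∧
      ∀ η' ∈ Metric.ball η ε, ∀ t, |φ t * Real.exp (η' ⬝ᵥ t)| ≤ b t := by
  obtain ⟨δ, hδ, hball⟩ := Metric.mem_nhds_iff.1 (mem_interior_iff_mem_nhds.1 hη)
  set ε := δ / 4 with hεdef
  have hε : 0 < ε := by positivity
  refine ⟨ε, hε, fun φ hφ => ?_⟩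
  obtain ⟨hm, C, k, hC⟩ := hφ
  have hC0 : 0 ≤ C := by
    have := (abs_nonneg _).trans (hC 0)
    simpa using this
  refine ⟨fun t => (C * (k.factorial * (ε ^ k)⁻¹ * Real.exp ε)) *
    ∑ σ : Fin d → Bool, Real.exp ((η + (2 * ε) • signVec σ) ⬝ᵥ t), ?_, fun η' hη' t => ?_⟩
  · refine (integrable_finsetSum _ fun σ _ => ?_).const_mul _
    refine hball ?_
    rw [Metric.mem_ball, dist_eq_norm, add_sub_cancel_left, norm_smul, Real.norm_of_nonneg (by positivity)]
    have := norm_signVec_le σ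
    nlinarith
  · set S := ∑ i, |t i| with hS
    have hS0 : 0 ≤ S := Finset.sum_nonneg fun _ _ => abs_nonneg _
    have h1 : η' ⬝ᵥ t ≤ η ⬝ᵥ t + ε * S := by
      have : η' ⬝ᵥ t - η ⬝ᵥ t ≤ ε * S := by
        rw [← sub_dotProduct, dotProduct, hS, Finset.mul_sum]
        refine Finset.sum_le_sum fun i _ => (le_abs_self _).trans ?_
        rw [abs_mul]
        gcongr
        rw [Metric.mem_ball, dist_eq_norm] at hη'
        exact (norm_le_pi_norm (η' - η) i).trans hη'.le
      linarith
    have h2 : (1 + S) ^ k ≤ k.factorial * (ε ^ k)⁻¹ * Real.exp ε * Real.exp (ε * S) := by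
      have h := Real.pow_div_factorial_le_exp (ε * (1 + S)) (by positivity) k
      rw [div_le_iff₀ (by positivity), mul_pow] at h
      have h3 : ε * (1 + S) = ε + ε * S := by ring
      rw [h3, Real.exp_add] at h
      have hk : 0 < ε ^ k := by positivity
      calc (1 + S) ^ k = (ε ^ k)⁻¹ * (ε ^ k * (1 + S) ^ k) := by field_simp
        _ ≤ (ε ^ k)⁻¹ * (Real.exp ε * Real.exp (ε * S) * k.factorial) := by gcongr
        _ = _ := by ring
    rw [abs_mul, abs_of_pos (Real.exp_pos _)]
    calc |φ t| * Real.exp (η' ⬝ᵥ t) ≤ (C * (k.factorial * (ε ^ k)⁻¹ * Real.exp ε *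
          Real.exp (ε * S))) * Real.exp (η ⬝ᵥ t + ε * S) := by
          gcongr
          exact (hC t).trans (by gcongr)
      _ = (C * (k.factorial * (ε ^ k)⁻¹ * Real.exp ε)) * Real.exp (η ⬝ᵥ t + (2 * ε) * S) := by
          rw [show η ⬝ᵥ t + (2 * ε) * S = ε * S + (η ⬝ᵥ t + ε * S) by ring, Real.exp_add (ε * S)]
          ring
      _ ≤ _ := by
          exact mul_le_mul_of_nonneg_left (exp_dotProduct_add_le η t (2 * ε)) (by positivity)

lemma PolyGrowth.aestronglyMeasurable {φ : Vec d → ℝ} (hφ : PolyGrowth φ) (η : Vec d) :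
    AEStronglyMeasurable (fun t => φ t * Real.exp (η ⬝ᵥ t)) lam :=
  (hφ.1.mul (continuous_exp_dotProduct η).measurable).aestronglyMeasurable

lemma PolyGrowth.integrable {φ : Vec d → ℝ} (hφ : PolyGrowth φ) {η : Vec d}
    (hη : η ∈ interior (laplaceDomain lam)) :
    Integrable (fun t => φ t * Real.exp (η ⬝ᵥ t)) lam := by
  obtain ⟨ε, hε, h⟩ := exists_laplace_bound hη
  obtain ⟨b, hb, hbound⟩ := h φ hφ
  exact hb.mono' (hφ.aestronglyMeasurable η)
    (Eventually.of_forall fun t => hbound η (Metric.mem_ball_self hε) t)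

lemma hasFDerivAt_dotProduct_left (η t : Vec d) :
    HasFDerivAt (fun η : Vec d => η ⬝ᵥ t)
      (∑ i, t i • (ContinuousLinearMap.proj i : Vec d →L[ℝ] ℝ)) η := by
  have h1 : (fun η : Vec d => η ⬝ᵥ t) =
      ⇑(∑ i, t i • (ContinuousLinearMap.proj i : Vec d →L[ℝ] ℝ)) := by
    ext η
    simp [dotProduct, mul_comm]
  rw [h1]
  exact ContinuousLinearMap.hasFDerivAt _

lemma hasFDerivAt_laplace {φ : Vec d → ℝ} (hφ : PolyGrowth φ) {η : Vec d}
    (hη : η ∈ interior (laplaceDomain lam)) :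
    HasFDerivAt (laplace lam φ)
      (∑ i, laplace lam (fun t => φ t * t i) η • (ContinuousLinearMap.proj i : Vec d →L[ℝ] ℝ)) η := by
  obtain ⟨ε, hε, h⟩ := exists_laplace_bound hη
  choose b hb hbound using fun i => h _ (hφ.mul_coord i)
  have hF' : ∑ i, laplace lam (fun t => φ t * t i) η • (ContinuousLinearMap.proj i : Vec d →L[ℝ] ℝ) =
      ∫ t, ∑ i, (φ t * t i * Real.exp (η ⬝ᵥ t)) • (ContinuousLinearMap.proj i : Vec d →L[ℝ] ℝ)
        ∂lam := by
    rw [integral_finsetSum _ fun i _ => ((hφ.mul_coord i).integrable hη).smul_const _]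
    refine Finset.sum_congr rfl fun i _ => ?_
    rw [integral_smul_const, laplace]
  rw [hF']
  refine hasFDerivAt_integral_of_dominated_of_fderiv_le (s := Metric.ball η ε)
    (F := fun η t => φ t * Real.exp (η ⬝ᵥ t))
    (F' := fun η t => ∑ i, (φ t * t i * Real.exp (η ⬝ᵥ t)) •
      (ContinuousLinearMap.proj i : Vec d →L[ℝ] ℝ))
    (bound := fun t => ∑ i, b i t) (Metric.ball_mem_nhds η hε)
    (Eventually.of_forall fun η => hφ.aestronglyMeasurable η) (hφ.integrable hη) ?_ ?_
    (integrable_finsetSum _ fun i _ => hb i) ?_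
  · refine Finset.aestronglyMeasurable_fun_sum _ fun i _ => ?_
    exact ((hφ.mul_coord i).aestronglyMeasurable η).smul_const _
  · refine Eventually.of_forall fun t η' hη' => (norm_sum_le _ _).trans ?_
    refine Finset.sum_le_sum fun i _ => ?_
    rw [norm_smul]
    have h1 : ‖(ContinuousLinearMap.proj i : Vec d →L[ℝ] ℝ)‖ ≤ 1 :=
      ContinuousLinearMap.opNorm_le_bound _ zero_le_one fun x => by
        simpa using norm_le_pi_norm x i
    calc _ ≤ ‖φ t * t i * Real.exp (η' ⬝ᵥ t)‖ * 1 := by gcongr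
      _ ≤ b i t := by rw [mul_one]; exact hbound i η' hη' t
  · refine Eventually.of_forall fun t η' _ => ?_
    have h1 := ((hasFDerivAt_dotProduct_left η' t).exp).const_mul (φ t)
    refine h1.congr_fderiv ?_
    rw [Finset.smul_sum, Finset.smul_sum]
    refine Finset.sum_congr rfl fun i _ => ?_
    rw [smul_smul, smul_smul]
    congr 1
    ring

/-- The induction runs over all `φ` of polynomial growth at once, because the derivative has
coefficients of the same type with `φ` multiplied by a coordinate. -/
lemma contDiffOn_laplace (n : ℕ) {φ : Vec d → ℝ} (hφ : PolyGrowth φ) :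
    ContDiffOn ℝ n (laplace lam φ) (interior (laplaceDomain lam)) := by
  induction n generalizing φ with
  | zero =>
    rw [Nat.cast_zero, contDiffOn_zero]
    exact fun η hη => (hasFDerivAt_laplace hφ hη).continuousAt.continuousWithinAt
  | succ n ih =>
    rw [Nat.cast_succ, contDiffOn_succ_iff_hasFDerivWithinAt_of_uniqueDiffOn
      isOpen_interior.uniqueDiffOn]
    refine ⟨by simp, _, ?_, fun η hη => (hasFDerivAt_laplace hφ hη).hasFDerivWithinAt⟩
    refine ContDiffOn.sum fun i _ => ?_
    exact (ih (hφ.mul_coord i)).smul contDiffOn_const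

end LaplaceTransform

/-! ### Second-order Taylor expansion with third-order remainder. -/

section Taylor

/-- Second-order Taylor expansion on `[0, 1]`, for a function given with its derivatives. -/
lemma abs_taylor_two_le {f : ℕ → ℝ → ℝ} {M : ℝ} (hM : 0 ≤ M)
    (hf : ∀ k < 3, ∀ t ∈ Set.Icc (0 : ℝ) 1, HasDerivAt (f k) (f (k + 1) t) t)
    (hb : ∀ t ∈ Set.Icc (0 : ℝ) 1, |f 3 t| ≤ M) :
    |f 0 1 - f 0 0 - f 1 0 - f 2 0 / 2| ≤ M := by
  -- On [0, 1] each use of the mean value inequality keeps the bound `M`. Three uses give the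
  -- constant `M` instead of the sharp M/6, which is enough.
  have mv : ∀ g g' : ℝ → ℝ, (∀ t ∈ Set.Icc (0 : ℝ) 1, HasDerivAt g (g' t) t) →
      (∀ t ∈ Set.Icc (0 : ℝ) 1, |g' t| ≤ M) → ∀ t ∈ Set.Icc (0 : ℝ) 1, |g t - g 0| ≤ M := by
    intro g g' hg hg' t ht
    have h1 := (convex_Icc (0 : ℝ) 1).norm_image_sub_le_of_norm_hasDerivWithin_le
      (fun s hs => (hg s hs).hasDerivWithinAt) hg' (Set.left_mem_Icc.2 zero_le_one) ht
    rw [Real.norm_eq_abs, Real.norm_eq_abs, sub_zero, abs_of_nonneg ht.1] at h1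
    nlinarith [ht.2]
  have h2 := mv (f 2) (f 3) (hf 2 (by norm_num)) hb
  have h1 := mv (fun t => f 1 t - t * f 2 0) (fun t => f 2 t - 1 * f 2 0)
    (fun t ht => (hf 1 (by norm_num) t ht).sub ((hasDerivAt_id t).mul_const _))
    (fun t ht => by simpa using h2 t ht)
  have h0 := mv (fun t => f 0 t - t * f 1 0 - t ^ 2 / 2 * f 2 0)
    (fun t => f 1 t - 1 * f 1 0 - t * f 2 0)
    (fun t ht => by
      refine ((hf 0 (by norm_num) t ht).sub ((hasDerivAt_id t).mul_const _)).sub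
        (HasDerivAt.mul_const ?_ _)
      have := (hasDerivAt_pow 2 t).div_const 2
      refine this.congr_deriv ?_
      simp)
    (fun t ht => by
      have := h1 t ht
      simp only [zero_mul, sub_zero] at this
      rw [show f 1 t - 1 * f 1 0 - t * f 2 0 = f 1 t - t * f 2 0 - f 1 0 by ring]
      exact this) 1 (Set.right_mem_Icc.2 zero_le_one)
  refine le_trans (le_of_eq ?_) h0
  congr 1
  ring

variable {d : ℕ}

lemma sum_smul_unitVec (v : Vec d) : ∑ i, v i • unitVec i = v := by
  ext j
  simp [unitVec, Finset.sum_apply, Pi.single_apply]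

lemma iteratedFDeriv_two_eq (f : Vec d → ℝ) (x v : Vec d) :
    iteratedFDeriv ℝ 2 f x (fun _ => v) = v ⬝ᵥ hess f x *ᵥ v := by
  have h : ∀ i j, hess f x i j = fderiv ℝ (fderiv ℝ f) x (unitVec i) (unitVec j) := fun i j => by
    simp [hess, iteratedFDeriv_two_apply]
  rw [iteratedFDeriv_two_apply]
  conv_lhs => rw [← sum_smul_unitVec v]
  simp only [map_sum, map_smul, _root_.sum_apply, _root_.smul_apply,
    dotProduct, Matrix.mulVec, h, Finset.mul_sum, smul_eq_mul]
  rw [Finset.sum_comm]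
  refine Finset.sum_congr rfl fun i _ => Finset.sum_congr rfl fun j _ => by ring

/-- Multilinear expansion in the coordinate basis has d³ terms, each a third partial derivative
times three coordinates of `v`. -/
lemma abs_iteratedFDeriv_three_le {f : Vec d → ℝ} {x : Vec d} {B : ℝ}
    (hB : ∀ i j k, |thirdPartial f x i j k| ≤ B) (v : Vec d) :
    |iteratedFDeriv ℝ 3 f x fun _ => v| ≤ d ^ 3 * ‖v‖ ^ 3 * B := by
  have h1 : iteratedFDeriv ℝ 3 f x (fun _ => v) = ∑ r : Fin 3 → Fin d,
      (∏ l, v (r l)) * thirdPartial f x (r 0) (r 1) (r 2) := by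
    conv_lhs => rw [← sum_smul_unitVec v]
    rw [ContinuousMultilinearMap.map_sum (iteratedFDeriv ℝ 3 f x)
      (g := fun _ i => v i • unitVec i)]
    refine Finset.sum_congr rfl fun r _ => ?_
    rw [ContinuousMultilinearMap.map_smul_univ, smul_eq_mul, thirdPartial]
    congr 2
    funext l
    fin_cases l <;> rfl
  rw [h1]
  refine (Finset.abs_sum_le_sum_abs _ _).trans ?_
  calc ∑ r : Fin 3 → Fin d, |(∏ l, v (r l)) * thirdPartial f x (r 0) (r 1) (r 2)|
      ≤ ∑ _r : Fin 3 → Fin d, ‖v‖ ^ 3 * B := by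
        refine Finset.sum_le_sum fun r _ => ?_
        rw [abs_mul, Finset.abs_prod]
        refine mul_le_mul ?_ (hB _ _ _) (abs_nonneg _) (by positivity)
        refine (Finset.prod_le_prod (fun _ _ => abs_nonneg _)
          fun l _ => norm_le_pi_norm v (r l)).trans ?_
        simp
    _ = _ := by
        simp [mul_assoc]

lemma abs_taylor_second_order_le {f : Vec d → ℝ} {x v : Vec d} {B : ℝ} (hB : 0 ≤ B)
    (hf : ∀ t ∈ Set.Icc (0 : ℝ) 1, ContDiffAt ℝ 3 f (x + t • v))
    (h3 : ∀ t ∈ Set.Icc (0 : ℝ) 1, ∀ i j k, |thirdPartial f (x + t • v) i j k| ≤ B) :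
    |f (x + v) - f x - grad f x ⬝ᵥ v - (v ⬝ᵥ hess f x *ᵥ v) / 2| ≤ d ^ 3 * ‖v‖ ^ 3 * B := by
  have key := abs_taylor_two_le (f := fun k t => iteratedFDeriv ℝ k f (x + t • v) fun _ => v)
    (M := d ^ 3 * ‖v‖ ^ 3 * B) (by positivity) ?_
    (fun t ht => abs_iteratedFDeriv_three_le (h3 t ht) v)
  · have e1 : grad f x ⬝ᵥ v = fderiv ℝ f x v := by
      conv_rhs => rw [← sum_smul_unitVec v]
      simp [grad, dotProduct, mul_comm]
    simp only [zero_smul, add_zero, one_smul, iteratedFDeriv_zero_apply, iteratedFDeriv_one_apply,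
      iteratedFDeriv_two_eq] at key
    rwa [e1]
  · intro k hk t ht
    have hline : HasDerivAt (fun t : ℝ => x + t • v) v t := by
      simpa using ((hasDerivAt_id t).smul_const v).const_add x
    have hd : DifferentiableAt ℝ (iteratedFDeriv ℝ k f) (x + t • v) :=
      (hf t ht).differentiableAt_iteratedFDeriv (by exact_mod_cast hk)
    have h1 := hd.hasFDerivAt.comp_hasDerivAt t hline
    have h2 := (ContinuousMultilinearMap.apply ℝ (fun _ : Fin k => Vec d) ℝ fun _ => v).hasFDerivAt.comp_hasDerivAt t h1
    exact h2

end Taylor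

/-! ### Exponential families: moments of the sufficient statistic as derivatives of `A`. -/

namespace ExpFamily

variable {dη dY : ℕ} (E : ExpFamily dη dY)

/-- The law of the sufficient statistic under the base density. -/
noncomputable def baseMeasure : Measure (Vec dη) :=
  (E.μ.withDensity fun y => ENNReal.ofReal (E.h y)).map E.T

lemma lintegral_baseMeasure {g : Vec dη → ℝ≥0∞} (hg : Measurable g) :
    ∫⁻ t, g t ∂E.baseMeasure = ∫⁻ y, ENNReal.ofReal (E.h y) * g (E.T y) ∂E.μ := by
  rw [baseMeasure, lintegral_map hg E.measurable_T]
  exact lintegral_withDensity_eq_lintegral_mul _ E.measurable_h.ennreal_ofReal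
    (hg.comp E.measurable_T)

lemma partition_eq (η : Vec dη) :
    E.partition η = ∫⁻ t, ENNReal.ofReal (Real.exp (η ⬝ᵥ t)) ∂E.baseMeasure := by
  rw [lintegral_baseMeasure _ (continuous_exp_dotProduct η).measurable.ennreal_ofReal]
  refine lintegral_congr fun y => ?_
  rw [mul_comm, ENNReal.ofReal_mul (E.h_nonneg y)]

lemma Ω_eq : E.Ω = laplaceDomain E.baseMeasure := by
  ext η
  change E.partition η < ∞ ↔ Integrable (fun t => Real.exp (η ⬝ᵥ t)) E.baseMeasure
  rw [partition_eq, Integrable, hasFiniteIntegral_iff_ofReal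
    (Eventually.of_forall fun t => (Real.exp_pos _).le)]
  simp [(continuous_exp_dotProduct η).aestronglyMeasurable]

/-- The normalising constant. -/
noncomputable abbrev Z (η : Vec dη) : ℝ := laplace E.baseMeasure (fun _ => 1) η

lemma toReal_partition (η : Vec dη) : (E.partition η).toReal = E.Z η := by
  rw [partition_eq, Z, laplace]
  simp only [one_mul]
  rw [integral_eq_lintegral_of_nonneg_ae (Eventually.of_forall fun t => (Real.exp_pos _).le)
    (continuous_exp_dotProduct η).aestronglyMeasurable]

lemma A_eq : E.A = fun η => Real.log (E.Z η) := by
  funext η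
  rw [A, toReal_partition]

lemma Z_pos {η : Vec dη} (hη : η ∈ E.Ω) : 0 < E.Z η := by
  rw [← toReal_partition]
  exact ENNReal.toReal_pos (E.partition_ne_zero η) (ne_of_lt hη)

lemma exp_neg_A {η : Vec dη} (hη : η ∈ E.Ω) : Real.exp (-E.A η) = (E.Z η)⁻¹ := by
  rw [A_eq, Real.exp_neg, Real.exp_log (E.Z_pos hη)]

lemma contDiffAt_A (n : ℕ) {η : Vec dη} (hη : η ∈ interior E.Ω) : ContDiffAt ℝ n E.A η := by
  rw [A_eq]
  refine ContDiffAt.log ?_ (E.Z_pos (interior_subset hη)).ne'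
  rw [Ω_eq] at hη
  exact (contDiffOn_laplace n polyGrowth_one).contDiffAt (isOpen_interior.mem_nhds hη)

/-- The mean of the `i`-th coordinate of the sufficient statistic. -/
noncomputable def meanT (i : Fin dη) (η : Vec dη) : ℝ :=
  laplace E.baseMeasure (fun t => t i) η / E.Z η

lemma polyGrowth_coord (i : Fin dη) : PolyGrowth fun t : Vec dη => t i := by
  simpa using polyGrowth_one.mul_coord i

lemma hasFDerivAt_A {η : Vec dη} (hη : η ∈ interior E.Ω) :
    HasFDerivAt E.A (∑ i, E.meanT i η • (ContinuousLinearMap.proj i : Vec dη →L[ℝ] ℝ)) η := by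
  have hZ := E.Z_pos (interior_subset hη)
  rw [A_eq]
  rw [Ω_eq] at hη
  refine ((hasFDerivAt_laplace polyGrowth_one hη).log hZ.ne').congr_fderiv ?_
  rw [Finset.smul_sum]
  refine Finset.sum_congr rfl fun i _ => ?_
  rw [smul_smul, meanT]
  simp only [one_mul]
  congr 1
  field_simp

lemma grad_A {η : Vec dη} (hη : η ∈ interior E.Ω) (i : Fin dη) : grad E.A η i = E.meanT i η := by
  rw [grad, (E.hasFDerivAt_A hη).fderiv]
  simp [unitVec, Pi.single_apply]

lemma hess_A {η : Vec dη} (hη : η ∈ interior E.Ω) (i j : Fin dη) :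
    hess E.A η i j = laplace E.baseMeasure (fun t => t i * t j) η / E.Z η -
      E.meanT i η * E.meanT j η := by
  have hZ := E.Z_pos (interior_subset hη)
  have h1 : fderiv ℝ E.A =ᶠ[𝓝 η] fun η =>
      ∑ i, E.meanT i η • (ContinuousLinearMap.proj i : Vec dη →L[ℝ] ℝ) := by
    filter_upwards [isOpen_interior.mem_nhds hη] with η' hη' using (E.hasFDerivAt_A hη').fderiv
  rw [hess, Matrix.of_apply, iteratedFDeriv_two_apply, h1.fderiv_eq]
  rw [Ω_eq] at hη
  have h2 : ∀ k, HasFDerivAt (E.meanT k) _ η := fun k => by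
    have h := (hasFDerivAt_laplace (polyGrowth_coord k) hη).mul
      ((hasDerivAt_inv hZ.ne').comp_hasFDerivAt η (hasFDerivAt_laplace polyGrowth_one hη))
    exact h
  have h3 := HasFDerivAt.fun_sum (u := Finset.univ) fun k _ => (h2 k).smul_const
    (ContinuousLinearMap.proj k : Vec dη →L[ℝ] ℝ)
  rw [h3.fderiv]
  have hL : laplace E.baseMeasure (fun t => t i * t j) = laplace E.baseMeasure (fun t => t j * t i) := by
    simp_rw [mul_comm]
  simp [unitVec, Pi.single_apply, meanT, hL]
  field_simp
  ring

/-- The law of T(Y) is an exponential tilt of the base measure, so its moments become ratios of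
Laplace transforms and can be compared with the derivatives of `A`. -/
lemma map_response (q : Kernel (Vec dη) (Vec dY)) {η : Vec dη} (hη : η ∈ E.Ω) :
    (E.response q η).map E.T =
      E.baseMeasure.withDensity fun t => ENNReal.ofReal (Real.exp (η ⬝ᵥ t - E.A η)) := by
  have hd : Measurable fun t : Vec dη => ENNReal.ofReal (Real.exp (η ⬝ᵥ t - E.A η)) :=
    (Real.continuous_exp.comp
      ((continuous_dotProduct_right η).sub continuous_const)).measurable.ennreal_ofReal
  refine Measure.ext_of_lintegral _ fun g hg => ?_
  have hgT : Measurable fun y => g (E.T y) := hg.comp E.measurable_T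
  rw [lintegral_map hg E.measurable_T, response_apply _ _ hη,
    lintegral_withDensity_eq_lintegral_mul _ (E.measurable_density.of_uncurry_left) hgT,
    lintegral_withDensity_eq_lintegral_mul _ hd hg, lintegral_baseMeasure _ (hd.mul hg)]
  refine lintegral_congr fun y => ?_
  rw [Pi.mul_apply, Pi.mul_apply, density, mul_comm (Real.exp _), ENNReal.ofReal_mul (E.h_nonneg y),
    mul_assoc]

lemma integrable_response (q : Kernel (Vec dη) (Vec dY)) {η : Vec dη} (hη : η ∈ E.Ω)
    {g : Vec dη → ℝ} (hgi : Integrable (fun t => g t * Real.exp (η ⬝ᵥ t)) E.baseMeasure) :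
    Integrable g ((E.response q η).map E.T) := by
  have hd : Measurable fun t : Vec dη => ENNReal.ofReal (Real.exp (η ⬝ᵥ t - E.A η)) :=
    (Real.continuous_exp.comp
      ((continuous_dotProduct_right η).sub continuous_const)).measurable.ennreal_ofReal
  rw [map_response _ _ hη, integrable_withDensity_iff_integrable_smul' hd
    (Eventually.of_forall fun _ => ENNReal.ofReal_lt_top)]
  refine (hgi.mul_const (Real.exp (-E.A η))).congr (Eventually.of_forall fun t => ?_)
  simp only [ENNReal.toReal_ofReal (Real.exp_pos _).le, smul_eq_mul]
  rw [sub_eq_add_neg, Real.exp_add]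
  ring

lemma integral_response (q : Kernel (Vec dη) (Vec dY)) {η : Vec dη} (hη : η ∈ E.Ω)
    (g : Vec dη → ℝ) :
    ∫ t, g t ∂((E.response q η).map E.T) = laplace E.baseMeasure g η / E.Z η := by
  have hd : Measurable fun t : Vec dη => ENNReal.ofReal (Real.exp (η ⬝ᵥ t - E.A η)) :=
    (Real.continuous_exp.comp
      ((continuous_dotProduct_right η).sub continuous_const)).measurable.ennreal_ofReal
  rw [map_response _ _ hη, integral_withDensity_eq_integral_toReal_smul hd
    (Eventually.of_forall fun _ => ENNReal.ofReal_lt_top), div_eq_mul_inv, ← E.exp_neg_A hη,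
    laplace, ← integral_mul_const]
  refine integral_congr_ae (Eventually.of_forall fun t => ?_)
  simp only [ENNReal.toReal_ofReal (Real.exp_pos _).le, smul_eq_mul]
  rw [sub_eq_add_neg, Real.exp_add]
  ring

variable {E}

lemma integrable_coord (q : Kernel (Vec dη) (Vec dY)) {η : Vec dη} (hη : η ∈ interior E.Ω)
    (i : Fin dη) : Integrable (fun t : Vec dη => t i) ((E.response q η).map E.T) :=
  E.integrable_response q (interior_subset hη) ((polyGrowth_coord i).integrable (E.Ω_eq ▸ hη))

lemma integral_coord (q : Kernel (Vec dη) (Vec dY)) {η : Vec dη} (hη : η ∈ interior E.Ω)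
    (i : Fin dη) : ∫ t, t i ∂((E.response q η).map E.T) = grad E.A η i := by
  rw [E.integral_response q (interior_subset hη), grad_A _ hη, meanT]

lemma integrable_coord_mul (q : Kernel (Vec dη) (Vec dY)) {η : Vec dη} (hη : η ∈ interior E.Ω)
    (i j : Fin dη) : Integrable (fun t : Vec dη => t i * t j) ((E.response q η).map E.T) :=
  E.integrable_response q (interior_subset hη)
    (((polyGrowth_coord i).mul_coord j).integrable (E.Ω_eq ▸ hη))

lemma integrable_centred_mul (q : Kernel (Vec dη) (Vec dY)) [IsMarkovKernel q] {η : Vec dη}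
    (hη : η ∈ interior E.Ω) (i j : Fin dη) :
    Integrable (fun t : Vec dη => (t i - grad E.A η i) * (t j - grad E.A η j))
      ((E.response q η).map E.T) := by
  have := Measure.isProbabilityMeasure_map (μ := E.response q η) E.measurable_T.aemeasurable
  have h := (((integrable_coord_mul q hη i j).sub
    ((integrable_coord q hη i).mul_const (grad E.A η j))).sub
    ((integrable_coord q hη j).const_mul (grad E.A η i))).add
    (integrable_const (grad E.A η i * grad E.A η j))
  refine h.congr (Eventually.of_forall fun t => ?_)
  simp only [Pi.add_apply, Pi.sub_apply]
  ring

lemma integral_centred_mul (q : Kernel (Vec dη) (Vec dY)) [IsMarkovKernel q] {η : Vec dη}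
    (hη : η ∈ interior E.Ω) (i j : Fin dη) :
    ∫ t, (t i - grad E.A η i) * (t j - grad E.A η j) ∂((E.response q η).map E.T) =
      hess E.A η i j := by
  have := Measure.isProbabilityMeasure_map (μ := E.response q η) E.measurable_T.aemeasurable
  have h1 := integrable_coord_mul q hη i j
  have h2 := (integrable_coord q hη i).mul_const (grad E.A η j)
  have h3 := (integrable_coord q hη j).const_mul (grad E.A η i)
  have h12 : Integrable (fun t : Vec dη => t i * t j - t i * grad E.A η j)
    ((E.response q η).map E.T) := h1.sub h2
  have h123 : Integrable (fun t : Vec dη => t i * t j - t i * grad E.A η j - grad E.A η i * t j)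
    ((E.response q η).map E.T) := h12.sub h3
  have e : ∀ t : Vec dη, (t i - grad E.A η i) * (t j - grad E.A η j) =
      t i * t j - t i * grad E.A η j - grad E.A η i * t j + grad E.A η i * grad E.A η j :=
    fun t => by ring
  simp_rw [e]
  rw [integral_add h123 (integrable_const _), integral_sub h12 h3,
    integral_sub h1 h2, integral_mul_const, integral_const_mul, integral_coord q hη,
    integral_coord q hη, E.integral_response q (interior_subset hη), hess_A _ hη, grad_A _ hη,
    grad_A _ hη]
  simp

end ExpFamily

lemma RegularModel.ae_interior {dη dΘ dY : ℕ} {E : ExpFamily dη dY}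
    {H : Measure (Feature dη dΘ)} {θ₀ : Vec dΘ} (hm : RegularModel E H θ₀) :
    ∀ᵐ x ∂H, natParam x θ₀ ∈ interior E.Ω := by
  obtain ⟨r, hr, B, -, -, h⟩ := hm.third_bound
  filter_upwards [h] with x hx using (hx θ₀ (Metric.mem_closedBall_self hr.le)).1

/-! ### The score at θ₀: centred, square integrable, with the Fisher matrix as covariance. -/

section Score

variable {dη dΘ dY : ℕ} {E : ExpFamily dη dY} {q : Kernel (Vec dη) (Vec dY)} [IsMarkovKernel q]
  {H : Measure (Feature dη dΘ)} [IsProbabilityMeasure H] {θ₀ : Vec dΘ}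

/-- The score of one data point at `θ₀`. -/
noncomputable def score (E : ExpFamily dη dY) (θ₀ : Vec dΘ) (z : DataPt dη dΘ dY) : Vec dΘ :=
  (Matrix.of z.1)ᵀ *ᵥ (E.T z.2 - grad E.A (natParam z.1 θ₀))

lemma score_apply (z : DataPt dη dΘ dY) (a : Fin dΘ) :
    score E θ₀ z a = ∑ i, z.1 i a * (E.T z.2 i - grad E.A (natParam z.1 θ₀) i) := rfl

lemma measurable_natParam_left (θ : Vec dΘ) :
    Measurable fun x : Feature dη dΘ => natParam x θ :=
  measurable_natParam.comp (measurable_const.prodMk measurable_id)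

lemma measurable_score : Measurable (score E θ₀ : DataPt dη dΘ dY → Vec dΘ) := by
  refine measurable_pi_lambda _ fun a => ?_
  simp only [score_apply]
  refine Finset.measurable_fun_sum _ fun i _ => Measurable.mul (by fun_prop) (Measurable.sub ?_ ?_)
  · exact (measurable_pi_apply i).comp (E.measurable_T.comp measurable_snd)
  · exact (measurable_fderiv_apply_const ℝ E.A (unitVec i)).comp
      ((measurable_natParam_left θ₀).comp measurable_fst)

/-- The response given the feature, at a fixed parameter. -/
noncomputable def responseAt (E : ExpFamily dη dY) (q : Kernel (Vec dη) (Vec dY)) (θ : Vec dΘ) :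
    Kernel (Feature dη dΘ) (Vec dY) :=
  (E.response q).comap (fun x => natParam x θ) (measurable_natParam_left θ)

instance (θ : Vec dΘ) : IsMarkovKernel (responseAt E q θ) := by
  unfold responseAt; infer_instance

lemma pointKernel_eq (θ : Vec dΘ) : pointKernel E q H θ = H ⊗ₘ responseAt E q θ := by
  rw [pointKernel, Kernel.compProd_apply_eq_compProd_sectR]
  rfl

lemma integrable_score_mul_response {x : Feature dη dΘ} (hx : natParam x θ₀ ∈ interior E.Ω)
    (a b : Fin dΘ) :
    Integrable (fun y => score E θ₀ (x, y) a * score E θ₀ (x, y) b) (responseAt E q θ₀ x) := by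
  have h : Integrable (fun t : Vec dη => ∑ i, ∑ j, x i a * x j b *
      ((t i - grad E.A (natParam x θ₀) i) * (t j - grad E.A (natParam x θ₀) j)))
      ((E.response q (natParam x θ₀)).map E.T) :=
    integrable_finsetSum _ fun i _ => integrable_finsetSum _ fun j _ =>
      (ExpFamily.integrable_centred_mul q hx i j).const_mul _
  refine (h.comp_measurable E.measurable_T).congr (Eventually.of_forall fun y => ?_)
  simp only [Function.comp_apply, score_apply, Finset.sum_mul_sum]
  refine Finset.sum_congr rfl fun i _ => Finset.sum_congr rfl fun j _ => by ring

lemma integral_score_mul_response {x : Feature dη dΘ} (hx : natParam x θ₀ ∈ interior E.Ω)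
    (a b : Fin dΘ) :
    ∫ y, score E θ₀ (x, y) a * score E θ₀ (x, y) b ∂(responseAt E q θ₀ x) =
      ((Matrix.of x)ᵀ * hess E.A (natParam x θ₀) * Matrix.of x) a b := by
  have hi := fun i j => (ExpFamily.integrable_centred_mul q hx i j).const_mul (x i a * x j b)
  have h : ∫ t : Vec dη, ∑ i, ∑ j, x i a * x j b *
      ((t i - grad E.A (natParam x θ₀) i) * (t j - grad E.A (natParam x θ₀) j))
      ∂((E.response q (natParam x θ₀)).map E.T) =
      ∑ i, ∑ j, x i a * x j b * hess E.A (natParam x θ₀) i j := by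
    rw [integral_finsetSum _ fun i _ => integrable_finsetSum _ fun j _ => hi i j]
    refine Finset.sum_congr rfl fun i _ => ?_
    rw [integral_finsetSum _ fun j _ => hi i j]
    refine Finset.sum_congr rfl fun j _ => ?_
    rw [integral_const_mul, ExpFamily.integral_centred_mul q hx]
  rw [integral_map E.measurable_T.aemeasurable (by fun_prop)] at h
  have e : ∀ y, score E θ₀ (x, y) a * score E θ₀ (x, y) b = ∑ i, ∑ j, x i a * x j b *
      ((E.T y i - grad E.A (natParam x θ₀) i) * (E.T y j - grad E.A (natParam x θ₀) j)) :=
    fun y => by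
      simp only [score_apply, Finset.sum_mul_sum]
      refine Finset.sum_congr rfl fun i _ => Finset.sum_congr rfl fun j _ => by ring
  simp_rw [e]
  refine Eq.trans h ?_
  simp only [Matrix.mul_apply, Matrix.transpose_apply, Matrix.of_apply, Finset.sum_mul]
  rw [Finset.sum_comm]
  refine Finset.sum_congr rfl fun i _ => Finset.sum_congr rfl fun j _ => by ring

lemma integral_score_response {x : Feature dη dΘ} (hx : natParam x θ₀ ∈ interior E.Ω)
    (a : Fin dΘ) : ∫ y, score E θ₀ (x, y) a ∂(responseAt E q θ₀ x) = 0 := by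
  have := Measure.isProbabilityMeasure_map (μ := E.response q (natParam x θ₀))
    E.measurable_T.aemeasurable
  have hi : ∀ i, Integrable (fun t : Vec dη => x i a * (t i - grad E.A (natParam x θ₀) i))
      ((E.response q (natParam x θ₀)).map E.T) := fun i =>
    ((ExpFamily.integrable_coord q hx i).sub (integrable_const _)).const_mul _
  have h : ∫ t : Vec dη, ∑ i, x i a * (t i - grad E.A (natParam x θ₀) i)
      ∂((E.response q (natParam x θ₀)).map E.T) = 0 := by
    rw [integral_finsetSum _ fun i _ => hi i]
    refine Finset.sum_eq_zero fun i _ => ?_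
    rw [integral_const_mul, integral_sub (ExpFamily.integrable_coord q hx i) (integrable_const _),
      ExpFamily.integral_coord q hx]
    simp
  have hmeas : Measurable fun t : Vec dη =>
      ∑ i, x i a * (t i - grad E.A (natParam x θ₀) i) := by fun_prop
  rw [integral_map E.measurable_T.aemeasurable hmeas.aestronglyMeasurable] at h
  exact h

/-- Given X, the second moment of a score coordinate is a diagonal entry of Xᵀ∇²A(Xθ₀)X, which is
integrable by assumption; Tonelli for the composition product does the rest. -/
lemma memLp_score (hm : RegularModel E H θ₀) (a : Fin dΘ) :
    MemLp (fun z => score E θ₀ z a) 2 (pointKernel E q H θ₀) := by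
  have hmeas : Measurable fun z : DataPt dη dΘ dY => score E θ₀ z a :=
    (measurable_pi_apply a).comp measurable_score
  rw [memLp_two_iff_integrable_sq hmeas.aestronglyMeasurable, pointKernel_eq,
    Measure.integrable_compProd_iff (hmeas.pow_const 2).aestronglyMeasurable]
  simp only [sq]
  refine ⟨?_, (hm.fisher_integrable a a).congr ?_⟩
  · filter_upwards [hm.ae_interior] with x hx using integrable_score_mul_response hx a a
  · filter_upwards [hm.ae_interior] with x hx
    rw [← integral_score_mul_response (q := q) hx a a]
    refine integral_congr_ae (Eventually.of_forall fun y => ?_)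
    simp only [Real.norm_of_nonneg (mul_self_nonneg (score E θ₀ (x, y) a))]

lemma integral_score (hm : RegularModel E H θ₀) (a : Fin dΘ) :
    ∫ z, score E θ₀ z a ∂(pointKernel E q H θ₀) = 0 := by
  have hi := (memLp_score (q := q) hm a).integrable one_le_two
  rw [pointKernel_eq] at hi ⊢
  rw [Measure.integral_compProd hi]
  refine (integral_congr_ae ?_).trans (integral_zero _ _)
  filter_upwards [hm.ae_interior] with x hx using integral_score_response hx a

lemma integral_score_mul (hm : RegularModel E H θ₀) (a b : Fin dΘ) :
    ∫ z, score E θ₀ z a * score E θ₀ z b ∂(pointKernel E q H θ₀) = fisherMatrix E H θ₀ a b := by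
  have hi := (memLp_score (q := q) hm a).integrable_mul (memLp_score (q := q) hm b)
  rw [pointKernel_eq] at hi ⊢
  refine (Measure.integral_compProd hi).trans (integral_congr_ae ?_)
  filter_upwards [hm.ae_interior] with x hx using integral_score_mul_response hx a b

end Score

/-! ### Product measures: densities and adjoining one coordinate. -/

section PiMeasure

variable {β : Type*} [MeasurableSpace β]

lemma lintegral_pi_succ (P : Measure β) [SigmaFinite P] {n : ℕ} {g : (Fin (n + 1) → β) → ℝ≥0∞}
    (hg : Measurable g) : ∫⁻ z, g z ∂(Measure.pi fun _ : Fin (n + 1) => P) =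
      ∫⁻ w, ∫⁻ b, g (Fin.snoc w b) ∂P ∂(Measure.pi fun _ : Fin n => P) := by
  have h := (measurePreserving_piFinSuccAbove (fun _ : Fin (n + 1) => P) (Fin.last n)).symm
  have hgs : Measurable fun p : (Fin n → β) × β => g (Fin.snoc p.1 p.2) :=
    hg.comp (measurable_snoc n)
  have hge : Measurable fun a => g ((MeasurableEquiv.piFinSuccAbove (fun _ => β) (Fin.last n)).symm a) :=
    hg.comp h.measurable
  rw [← h.lintegral_comp hg, ← Measure.prod_swap, lintegral_map hge measurable_swap, ← lintegral_prod _ hgs.aemeasurable]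
  refine lintegral_congr fun p => ?_
  congr 1
  exact Fin.insertNth_last' p.2 p.1

lemma lintegral_pi_prod (P : Measure β) [SigmaFinite P] {n : ℕ} {f : Fin n → β → ℝ≥0∞}
    (hf : ∀ i, Measurable (f i)) :
    ∫⁻ z, ∏ i, f i (z i) ∂(Measure.pi fun _ : Fin n => P) = ∏ i, ∫⁻ b, f i b ∂P := by
  induction n with
  | zero => simp
  | succ n ih =>
    rw [lintegral_pi_succ P (by fun_prop)]
    simp only [Fin.prod_univ_castSucc, Fin.snoc_castSucc, Fin.snoc_last]
    rw [← ih fun i => hf _, ← lintegral_mul_const _ (by fun_prop)]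
    refine lintegral_congr fun w => ?_
    exact lintegral_const_mul _ (hf _)

/-- It suffices to compare the two measures on boxes, where indicator and density both factorise. -/
lemma pi_withDensity (P : Measure β) [IsProbabilityMeasure P] {f : β → ℝ≥0∞} (hf : Measurable f)
    [IsProbabilityMeasure (P.withDensity f)] (n : ℕ) :
    Measure.pi (fun _ : Fin n => P.withDensity f) =
      (Measure.pi fun _ : Fin n => P).withDensity fun z => ∏ i, f (z i) := by
  refine Measure.pi_eq fun s hs => ?_
  have hS : MeasurableSet (Set.univ.pi s) := MeasurableSet.univ_pi hs
  rw [withDensity_apply _ hS, ← lintegral_indicator hS]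
  have h1 : ∀ z : Fin n → β, (Set.univ.pi s).indicator (fun z => ∏ i, f (z i)) z =
      ∏ i, (s i).indicator f (z i) := fun z => by
    by_cases hz : z ∈ Set.univ.pi s
    · rw [Set.indicator_of_mem hz]
      exact Finset.prod_congr rfl fun i _ => (Set.indicator_of_mem (hz i trivial) f).symm
    · rw [Set.indicator_of_notMem hz]
      simp only [Set.mem_pi, Set.mem_univ, true_imp_iff, not_forall] at hz
      obtain ⟨i, hi⟩ := hz
      exact (Finset.prod_eq_zero (Finset.mem_univ i) (Set.indicator_of_notMem hi f)).symm
  simp_rw [h1]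
  rw [lintegral_pi_prod P fun i => hf.indicator (hs i)]
  refine Finset.prod_congr rfl fun i _ => ?_
  rw [lintegral_indicator (hs i), withDensity_apply _ (hs i)]

variable {U : Type*} [MeasurableSpace U]

lemma measurable_snoc_prod {G : ℕ} : Measurable fun p : (U × (Fin G → β)) × β =>
    ((p.1.1, Fin.snoc p.1.2 p.2) : U × (Fin (G + 1) → β)) :=
  (measurable_fst.comp measurable_fst).prodMk
    ((measurable_snoc G).comp ((measurable_snd.comp measurable_fst).prodMk measurable_snd))

/-- Adjoining a generation has the same form as in the recursion of `workflowLaw`, so the two laws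
can be compared one generation at a time. -/
lemma arrayLaw_succ (ν : Measure U) [IsProbabilityMeasure ν] (P : Measure β)
    [IsProbabilityMeasure P] (G n : ℕ) :
    arrayLaw ν P (G + 1) n = ((arrayLaw ν P G n).prod (Measure.pi fun _ : Fin n => P)).map
      fun p => (p.1.1, Fin.snoc p.1.2 p.2) := by
  refine Measure.ext_of_lintegral _ fun f hf => ?_
  have hfs : Measurable fun p : (U × (Fin G → Fin n → β)) × (Fin n → β) =>
      f (p.1.1, Fin.snoc p.1.2 p.2) := hf.comp measurable_snoc_prod
  rw [lintegral_map hf measurable_snoc_prod, lintegral_prod _ hfs.aemeasurable,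
    lintegral_prod _ hf.aemeasurable, lintegral_prod _ hfs.lintegral_prod_right'.aemeasurable]
  refine lintegral_congr fun u => ?_
  exact lintegral_pi_succ _ (hf.comp measurable_prodMk_left)

end PiMeasure

/-- The data of all but the last generation. -/
abbrev pastData {dη dΘ dY : ℕ} {U : Type*} {n G : ℕ} (p : U × History dη dΘ dY n (G + 1)) : U × History dη dΘ dY n G :=
  (p.1, fun j => p.2 j.castSucc)

lemma pastData_snoc {dη dΘ dY : ℕ} {U : Type*} {n G : ℕ} (p : U × History dη dΘ dY n G) (z : Fin n → DataPt dη dΘ dY) :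
    pastData ((p.1, Fin.snoc p.2 z) : U × History dη dΘ dY n (G + 1)) = p := by
  simp [pastData]

/-! ### Likelihood ratio of the workflow law with respect to the reference law. -/

section LikelihoodRatio

variable {dη dΘ dY : ℕ} {E : ExpFamily dη dY} {q : Kernel (Vec dη) (Vec dY)} [IsMarkovKernel q]
  {H : Measure (Feature dη dΘ)} [IsProbabilityMeasure H] {θ₀ : Vec dΘ}

/-- The log-likelihood ratio of one data point between the parameters `θ` and `θ₀`. -/
noncomputable def pointLogRatio (E : ExpFamily dη dY) (θ₀ θ : Vec dΘ) (z : DataPt dη dΘ dY) : ℝ :=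
  (natParam z.1 θ ⬝ᵥ E.T z.2 - E.A (natParam z.1 θ)) -
    (natParam z.1 θ₀ ⬝ᵥ E.T z.2 - E.A (natParam z.1 θ₀))

/-- The likelihood ratio of one data point between the parameters `θ` and `θ₀`. -/
noncomputable def pointRatio (E : ExpFamily dη dY) (θ₀ θ : Vec dΘ) (z : DataPt dη dΘ dY) : ℝ≥0∞ :=
  ENNReal.ofReal (Real.exp (pointLogRatio E θ₀ θ z))

lemma measurable_logDensity {α : Type*} [MeasurableSpace α] {f : α → Vec dΘ}
    {g : α → DataPt dη dΘ dY} (hf : Measurable f) (hg : Measurable g) :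
    Measurable fun a => natParam (g a).1 (f a) ⬝ᵥ E.T (g a).2 - E.A (natParam (g a).1 (f a)) := by
  have hn : Measurable fun a => natParam (g a).1 (f a) :=
    measurable_natParam.comp (hf.prodMk (measurable_fst.comp hg))
  have hT : Measurable fun a => E.T (g a).2 := E.measurable_T.comp (measurable_snd.comp hg)
  refine Measurable.sub ?_ (E.measurable_A.comp hn)
  unfold dotProduct
  fun_prop

lemma measurable_pointRatio {α : Type*} [MeasurableSpace α] {f : α → Vec dΘ}
    {g : α → DataPt dη dΘ dY} (hf : Measurable f) (hg : Measurable g) :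
    Measurable fun a => pointRatio E θ₀ (f a) (g a) :=
  (Real.measurable_exp.comp ((measurable_logDensity hf hg).sub
    (measurable_logDensity measurable_const hg))).ennreal_ofReal

/-- Both natural parameters lie in Ω almost surely, where responses have densities with the common
factor `h`. The ratio multiplies the density at θ₀, so no division by `h` occurs. -/
lemma pointKernel_eq_withDensity {θ : Vec dΘ} (hθ : ∀ᵐ x ∂H, natParam x θ ∈ E.Ω)
    (hθ₀ : ∀ᵐ x ∂H, natParam x θ₀ ∈ E.Ω) :
    pointKernel E q H θ = (pointKernel E q H θ₀).withDensity (pointRatio E θ₀ θ) := by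
  have hr : Measurable (pointRatio E θ₀ θ : DataPt dη dΘ dY → ℝ≥0∞) :=
    measurable_pointRatio measurable_const measurable_id
  refine Measure.ext_of_lintegral _ fun f hf => ?_
  rw [lintegral_withDensity_eq_lintegral_mul _ hr hf, pointKernel_eq, pointKernel_eq,
    Measure.lintegral_compProd hf, Measure.lintegral_compProd (hr.mul hf)]
  refine lintegral_congr_ae ?_
  filter_upwards [hθ, hθ₀] with x hx hx₀
  have hfx : Measurable fun y => f (x, y) := hf.comp measurable_prodMk_left
  have hrx : Measurable fun y => (pointRatio E θ₀ θ * f) (x, y) :=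
    (hr.mul hf).comp measurable_prodMk_left
  change ∫⁻ y, f (x, y) ∂(E.response q (natParam x θ)) =
    ∫⁻ y, (pointRatio E θ₀ θ * f) (x, y) ∂(E.response q (natParam x θ₀))
  rw [E.response_apply q hx, E.response_apply q hx₀,
    lintegral_withDensity_eq_lintegral_mul _ E.measurable_density.of_uncurry_left hfx,
    lintegral_withDensity_eq_lintegral_mul _ E.measurable_density.of_uncurry_left hrx]
  refine lintegral_congr fun y => ?_
  simp only [Pi.mul_apply]
  rw [← mul_assoc]
  congr 1
  simp only [ExpFamily.density, pointRatio, pointLogRatio]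
  rw [← ENNReal.ofReal_mul (mul_nonneg (Real.exp_pos _).le (E.h_nonneg y)), mul_right_comm,
    ← Real.exp_add]
  congr 3
  ring

variable {U : Type*} [MeasurableSpace U] {ν : Measure U} [IsProbabilityMeasure ν]
  {e : Estimators dη dΘ dY U}

lemma measurable_pastData {n G : ℕ} :
    Measurable (pastData : U × History dη dΘ dY n (G + 1) → U × History dη dΘ dY n G) := by
  unfold pastData
  fun_prop

open Classical in
/-- The likelihood ratio of one generation drawn from `θ`, truncated to the ball of radius `r`. -/
noncomputable def generationRatio (E : ExpFamily dη dY) (θ₀ : Vec dΘ) (r : ℝ) {n : ℕ} (θ : Vec dΘ)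
    (z : Fin n → DataPt dη dΘ dY) : ℝ≥0∞ :=
  if θ ∈ Metric.closedBall θ₀ r then ∏ i, pointRatio E θ₀ θ (z i) else 0

lemma measurable_generationRatio (r : ℝ) {n : ℕ} {α : Type*} [MeasurableSpace α]
    {f : α → Vec dΘ} {g : α → Fin n → DataPt dη dΘ dY} (hf : Measurable f) (hg : Measurable g) :
    Measurable fun a => generationRatio E θ₀ r (f a) (g a) := by
  unfold generationRatio
  refine Measurable.ite (hf Metric.isClosed_closedBall.measurableSet) ?_ measurable_const
  exact Finset.measurable_fun_prod _ fun i _ =>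
    measurable_pointRatio hf ((measurable_pi_apply i).comp hg)

/-- The likelihood ratio of the workflow law with respect to the reference law, restricted to the
event that all estimators are within distance `r` of the truth. -/
noncomputable def likelihoodRatio (E : ExpFamily dη dY) (θ₀ : Vec dΘ) (e : Estimators dη dΘ dY U)
    (r : ℝ) (n : ℕ) : (G : ℕ) → U × History dη dΘ dY n G → ℝ≥0∞
  | 0, _ => 1
  | G + 1, p => likelihoodRatio E θ₀ e r n G (pastData p) *
      generationRatio E θ₀ r (e.current θ₀ n G (pastData p)) (p.2 (Fin.last G))

lemma measurable_likelihoodRatio (r : ℝ) (n G : ℕ) :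
    Measurable (likelihoodRatio E θ₀ e r n G) := by
  induction G with
  | zero => exact measurable_const
  | succ G ih =>
    exact (ih.comp measurable_pastData).mul (measurable_generationRatio r
      ((e.measurable_current θ₀ n G).comp measurable_pastData)
      ((measurable_pi_apply (Fin.last G)).comp measurable_snd))

/-- Inside the ball equality holds; outside it the truncated ratio vanishes. Truncation also avoids
parameters for which the response kernel is arbitrary. -/
lemma lintegral_generationRatio_le {r : ℝ}
    (hr : ∀ θ ∈ Metric.closedBall θ₀ r, ∀ᵐ x ∂H, natParam x θ ∈ E.Ω) (hr0 : 0 ≤ r) {n : ℕ}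
    (θ : Vec dΘ) {f : (Fin n → DataPt dη dΘ dY) → ℝ≥0∞} (hf : Measurable f) :
    ∫⁻ z, generationRatio E θ₀ r θ z * f z ∂(Measure.pi fun _ => pointKernel E q H θ₀) ≤
      ∫⁻ z, f z ∂(Measure.pi fun _ => pointKernel E q H θ) := by
  by_cases hθ : θ ∈ Metric.closedBall θ₀ r
  · simp only [generationRatio, if_pos hθ]
    have hk := pointKernel_eq_withDensity (q := q) (hr θ hθ) (hr θ₀ (Metric.mem_closedBall_self hr0))
    have hm : Measurable (pointRatio E θ₀ θ : DataPt dη dΘ dY → ℝ≥0∞) :=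
      measurable_pointRatio measurable_const measurable_id
    have : IsProbabilityMeasure ((pointKernel E q H θ₀).withDensity (pointRatio E θ₀ θ)) :=
      hk ▸ inferInstance
    rw [hk, pi_withDensity _ hm, lintegral_withDensity_eq_lintegral_mul _ (by fun_prop) hf]
    rfl
  · simp only [generationRatio, if_neg hθ, zero_mul, lintegral_zero, zero_le]

/-- The workflow law dominates the reference law with density the truncated likelihood ratio. -/
theorem lintegral_likelihoodRatio_le {r : ℝ}
    (hr : ∀ θ ∈ Metric.closedBall θ₀ r, ∀ᵐ x ∂H, natParam x θ ∈ E.Ω) (hr0 : 0 ≤ r) (n G : ℕ)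
    {f : U × History dη dΘ dY n G → ℝ≥0∞} (hf : Measurable f) :
    ∫⁻ p, likelihoodRatio E θ₀ e r n G p * f p ∂(refLaw E q H θ₀ ν n G) ≤
      ∫⁻ p, f p ∂(workflowLaw E q H θ₀ ν e n G) := by
  induction G with
  | zero =>
    have hm : Measurable fun u : U => (u, (Fin.elim0 : History dη dΘ dY n 0)) := by fun_prop
    rw [workflowLaw, lintegral_map hf hm]
    simp only [likelihoodRatio, one_mul]
    rw [refLaw, lintegral_prod _ hf.aemeasurable]
    refine (lintegral_congr fun u => ?_).le
    have : ∀ z : History dη dΘ dY n 0, f (u, z) = f (u, Fin.elim0) := fun z => by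
      congr 2
      exact Subsingleton.elim _ _
    simp [this]
  | succ G ih =>
    have hfs : Measurable fun p : (U × History dη dΘ dY n G) × (Fin n → DataPt dη dΘ dY) =>
        f (p.1.1, Fin.snoc p.1.2 p.2) := hf.comp measurable_snoc_prod
    have hLf : Measurable fun p => likelihoodRatio E θ₀ e r n (G + 1) p * f p :=
      (measurable_likelihoodRatio r n (G + 1)).mul hf
    have hLfs : Measurable fun p : (U × History dη dΘ dY n G) × (Fin n → DataPt dη dΘ dY) =>
        likelihoodRatio E θ₀ e r n (G + 1) (p.1.1, Fin.snoc p.1.2 p.2) *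
          f (p.1.1, Fin.snoc p.1.2 p.2) := hLf.comp measurable_snoc_prod
    have hgr : ∀ p : U × History dη dΘ dY n G, Measurable fun z : Fin n → DataPt dη dΘ dY =>
        generationRatio E θ₀ r (e.current θ₀ n G p) z := fun p =>
      measurable_generationRatio r measurable_const measurable_id
    rw [workflowLaw, lintegral_map hf measurable_snoc_prod, Measure.lintegral_compProd hfs]
    -- Integrating out the last generation under the workflow kernel leaves a function of the past,
    -- to which the induction hypothesis is applied.
    have hker := Measurable.lintegral_kernel_prod_right' (κ := (iidKernel (pointKernel E q H) n).comap
      (e.current θ₀ n G) (e.measurable_current θ₀ n G)) hfs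
    refine le_trans ?_ (ih hker)
    have hsucc : refLaw E q H θ₀ ν n (G + 1) = ((refLaw E q H θ₀ ν n G).prod
        (Measure.pi fun _ => pointKernel E q H θ₀)).map fun p => (p.1.1, Fin.snoc p.1.2 p.2) :=
      arrayLaw_succ ν (pointKernel E q H θ₀) G n
    rw [hsucc, lintegral_map hLf measurable_snoc_prod, lintegral_prod _ hLfs.aemeasurable]
    refine lintegral_mono fun p => ?_
    have hstep := lintegral_generationRatio_le (q := q) hr hr0 (e.current θ₀ n G p)
      (hfs.comp (measurable_prodMk_left (x := p)))
    refine le_trans (le_of_eq ?_) (mul_le_mul_right hstep (likelihoodRatio E θ₀ e r n G p))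
    refine Eq.trans (lintegral_congr fun z => ?_)
      (lintegral_const_mul _ ((hgr p).mul (hfs.comp measurable_prodMk_left)))
    simp only [likelihoodRatio, pastData_snoc, Fin.snoc_last, Function.comp_apply, mul_assoc]

end LikelihoodRatio

/-! ### Local quadratic expansion of the log-likelihood ratio. -/

section LocalExpansion

variable {dη dΘ dY : ℕ} {E : ExpFamily dη dY} {θ₀ : Vec dΘ}

lemma natParam_add_smul (x : Feature dη dΘ) (θ h : Vec dΘ) (t : ℝ) :
    natParam x (θ + t • h) = natParam x θ + t • natParam x h := by
  rw [natParam, Matrix.mulVec_add, Matrix.mulVec_smul]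
  rfl

lemma norm_natParam_le (x : Feature dη dΘ) (h : Vec dΘ) :
    ‖natParam x h‖ ≤ dΘ * ‖x‖ * ‖h‖ := by
  refine (pi_norm_le_iff_of_nonneg (by positivity)).2 fun i => ?_
  calc ‖natParam x h i‖ ≤ ∑ j, ‖x i j * h j‖ := norm_sum_le Finset.univ fun j => x i j * h j
    _ ≤ ∑ _j : Fin dΘ, ‖x‖ * ‖h‖ := by
        refine Finset.sum_le_sum fun j _ => ?_
        rw [norm_mul]
        gcongr
        · exact (norm_le_pi_norm (x i) j).trans (norm_le_pi_norm x i)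
        · exact norm_le_pi_norm h j
    _ = _ := by simp [mul_assoc]

/-- The contribution of a feature to the Fisher information. -/
noncomputable def fisherPoint (E : ExpFamily dη dY) (θ₀ : Vec dΘ) (x : Feature dη dΘ) :
    Matrix (Fin dΘ) (Fin dΘ) ℝ :=
  (Matrix.of x)ᵀ * hess E.A (natParam x θ₀) * Matrix.of x

lemma natParam_dotProduct (x : Feature dη dΘ) (h : Vec dΘ) (w : Vec dη) :
    natParam x h ⬝ᵥ w = h ⬝ᵥ (Matrix.of x)ᵀ *ᵥ w := by
  rw [natParam, Matrix.dotProduct_mulVec, Matrix.vecMul_transpose]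

lemma natParam_hess_natParam (x : Feature dη dΘ) (h : Vec dΘ) :
    natParam x h ⬝ᵥ hess E.A (natParam x θ₀) *ᵥ natParam x h =
      h ⬝ᵥ fisherPoint E θ₀ x *ᵥ h := by
  rw [natParam_dotProduct, fisherPoint, ← Matrix.mulVec_mulVec, ← Matrix.mulVec_mulVec]
  rfl

/-- Features at which the log-partition function is well behaved near the truth. -/
def IsRegularFeature (E : ExpFamily dη dY) (θ₀ : Vec dΘ) (r : ℝ) (B : Feature dη dΘ → ℝ)
    (x : Feature dη dΘ) : Prop :=
  ∀ θ ∈ Metric.closedBall θ₀ r, natParam x θ ∈ interior E.Ω ∧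
    ∀ i j k, |thirdPartial E.A (natParam x θ) i j k| ≤ B x

/-- The statistic T(Y) enters the log ratio linearly and is matched exactly by the score. What
remains is the Taylor remainder of `A` in direction Xh, which depends on X alone. -/
lemma abs_pointLogRatio_sub_le {r : ℝ} {B : Feature dη dΘ → ℝ} (hB : ∀ x, 0 ≤ B x) {h : Vec dΘ}
    (hh : ‖h‖ ≤ r) {z : DataPt dη dΘ dY} (hz : IsRegularFeature E θ₀ r B z.1) :
    |pointLogRatio E θ₀ (θ₀ + h) z - (h ⬝ᵥ score E θ₀ z - (h ⬝ᵥ fisherPoint E θ₀ z.1 *ᵥ h) / 2)| ≤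
      (dη : ℝ) ^ 3 * dΘ ^ 3 * ‖h‖ ^ 3 * (‖z.1‖ ^ 3 * B z.1) := by
  have hmem : ∀ t ∈ Set.Icc (0 : ℝ) 1, θ₀ + t • h ∈ Metric.closedBall θ₀ r := fun t ht => by
    rw [Metric.mem_closedBall, dist_eq_norm, add_sub_cancel_left, norm_smul,
      Real.norm_of_nonneg ht.1]
    exact (mul_le_of_le_one_left (norm_nonneg h) ht.2).trans hh
  have key := abs_taylor_second_order_le (f := E.A) (x := natParam z.1 θ₀) (v := natParam z.1 h)
    (hB z.1) (fun t ht => by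
      rw [← natParam_add_smul]
      exact E.contDiffAt_A 3 (hz _ (hmem t ht)).1)
    (fun t ht => by
      rw [← natParam_add_smul]
      exact (hz _ (hmem t ht)).2)
  have e1 : natParam z.1 (θ₀ + h) = natParam z.1 θ₀ + natParam z.1 h := by
    simpa using natParam_add_smul z.1 θ₀ h 1
  have e2 : h ⬝ᵥ score E θ₀ z = natParam z.1 h ⬝ᵥ E.T z.2 -
      grad E.A (natParam z.1 θ₀) ⬝ᵥ natParam z.1 h := by
    rw [score, ← natParam_dotProduct, dotProduct_sub, dotProduct_comm (natParam z.1 h) (grad _ _)]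
  rw [natParam_hess_natParam] at key
  rw [e2, pointLogRatio, e1, add_dotProduct, abs_sub_comm]
  refine le_trans (le_of_eq ?_) (key.trans ?_)
  · congr 1
    ring
  · calc (dη : ℝ) ^ 3 * ‖natParam z.1 h‖ ^ 3 * B z.1
        ≤ (dη : ℝ) ^ 3 * (dΘ * ‖z.1‖ * ‖h‖) ^ 3 * B z.1 := by
          gcongr
          · exact hB _
          · exact norm_natParam_le _ _
      _ = _ := by ring

lemma abs_dotProduct_mulVec_le {d : ℕ} (u : Vec d) (M : Matrix (Fin d) (Fin d) ℝ) :
    |u ⬝ᵥ M *ᵥ u| ≤ ‖u‖ ^ 2 * ∑ a, ∑ b, |M a b| := by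
  have : u ⬝ᵥ M *ᵥ u = ∑ a, ∑ b, u a * (M a b * u b) := by
    simp [dotProduct, Matrix.mulVec, Finset.mul_sum]
  rw [this, Finset.mul_sum]
  refine (Finset.abs_sum_le_sum_abs _ _).trans (Finset.sum_le_sum fun a _ => ?_)
  rw [Finset.mul_sum]
  refine (Finset.abs_sum_le_sum_abs _ _).trans (Finset.sum_le_sum fun b _ => ?_)
  rw [abs_mul, abs_mul]
  calc |u a| * (|M a b| * |u b|) ≤ ‖u‖ * (|M a b| * ‖u‖) := by
        gcongr
        · exact norm_le_pi_norm u a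
        · exact norm_le_pi_norm u b
    _ = _ := by ring

lemma scoreStat_eq {n : ℕ} (z : Fin n → DataPt dη dΘ dY) :
    scoreStat E θ₀ z = (√(n : ℝ))⁻¹ • ∑ i, score E θ₀ (z i) := rfl

/-- Error bound of the quadratic approximation of the log-likelihood ratio of one generation. -/
noncomputable def expansionError (E : ExpFamily dη dY) (θ₀ : Vec dΘ)
    (V : Matrix (Fin dΘ) (Fin dΘ) ℝ) (B : Feature dη dΘ → ℝ) (K : ℝ) {n : ℕ}
    (z : Fin n → DataPt dη dΘ dY) : ℝ :=
  K ^ 2 * ∑ a, ∑ b, |(n : ℝ)⁻¹ * ∑ i, fisherPoint E θ₀ (z i).1 a b - V a b| +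
    (dη : ℝ) ^ 3 * dΘ ^ 3 * K ^ 3 *
      ((√(n : ℝ))⁻¹ * ((n : ℝ)⁻¹ * ∑ i, ‖(z i).1‖ ^ 3 * B (z i).1))

/-- With h = u/√n, the linear terms sum to the score statistic against u, the quadratic ones average
the Fisher contributions, and the cubic ones are of size n·n^(−3/2). The bound is deterministic and
uniform over ‖u‖ ≤ K, so u may depend on the data. -/
lemma abs_sum_pointLogRatio_sub_le {V : Matrix (Fin dΘ) (Fin dΘ) ℝ} {r : ℝ}
    {B : Feature dη dΘ → ℝ} (hB : ∀ x, 0 ≤ B x) {n : ℕ} (hn : 0 < n) {θ u : Vec dΘ}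
    (hu : u = √(n : ℝ) • (θ - θ₀)) (hθ : ‖θ - θ₀‖ ≤ r) {K : ℝ} (hK : ‖u‖ ≤ K)
    {z : Fin n → DataPt dη dΘ dY} (hz : ∀ i, IsRegularFeature E θ₀ r B (z i).1) :
    |∑ i, pointLogRatio E θ₀ θ (z i) - logLRStep V u (scoreStat E θ₀ z)| ≤
      expansionError E θ₀ V B K z := by
  have hn' : (0 : ℝ) < n := by exact_mod_cast hn
  have hs : 0 < √(n : ℝ) := Real.sqrt_pos.2 hn'
  have hss : √(n : ℝ) * √(n : ℝ) = n := Real.mul_self_sqrt hn'.le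
  set h := θ - θ₀ with hh
  have hθh : θ = θ₀ + h := by rw [hh]; abel
  have hh_eq : h = (√(n : ℝ))⁻¹ • u := by rw [hu, smul_smul, inv_mul_cancel₀ hs.ne', one_smul]
  have hnorm : ‖h‖ = (√(n : ℝ))⁻¹ * ‖u‖ := by
    rw [hh_eq, norm_smul, Real.norm_of_nonneg (inv_nonneg.2 hs.le)]
  set M : Matrix (Fin dΘ) (Fin dΘ) ℝ := (n : ℝ)⁻¹ • ∑ i, fisherPoint E θ₀ (z i).1 with hM
  have hscore : ∑ i, h ⬝ᵥ score E θ₀ (z i) = u ⬝ᵥ scoreStat E θ₀ z := by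
    rw [scoreStat_eq, dotProduct_smul, ← smul_dotProduct, ← hh_eq, dotProduct_sum]
  have hquad : ∑ i, (h ⬝ᵥ fisherPoint E θ₀ (z i).1 *ᵥ h) / 2 = (u ⬝ᵥ M *ᵥ u) / 2 := by
    rw [← Finset.sum_div, ← dotProduct_sum, ← Matrix.sum_mulVec, hM, hh_eq, Matrix.mulVec_smul,
      smul_dotProduct, dotProduct_smul, Matrix.smul_mulVec, dotProduct_smul]
    simp only [smul_eq_mul]
    rw [← mul_assoc, ← mul_inv, hss]
  have hsplit : ∑ i, pointLogRatio E θ₀ θ (z i) - logLRStep V u (scoreStat E θ₀ z) =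
      ∑ i, (pointLogRatio E θ₀ (θ₀ + h) (z i) -
        (h ⬝ᵥ score E θ₀ (z i) - (h ⬝ᵥ fisherPoint E θ₀ (z i).1 *ᵥ h) / 2)) -
      (u ⬝ᵥ (M - V) *ᵥ u) / 2 := by
    rw [Finset.sum_sub_distrib, Finset.sum_sub_distrib, hscore, hquad, ← hθh, logLRStep,
      Matrix.sub_mulVec, dotProduct_sub]
    ring
  have hMV : |(u ⬝ᵥ (M - V) *ᵥ u) / 2| ≤
      K ^ 2 * ∑ a, ∑ b, |(n : ℝ)⁻¹ * ∑ i, fisherPoint E θ₀ (z i).1 a b - V a b| := by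
    have h1 := abs_dotProduct_mulVec_le u (M - V)
    have h2 : ∀ a b, (M - V) a b = (n : ℝ)⁻¹ * ∑ i, fisherPoint E θ₀ (z i).1 a b - V a b :=
      fun a b => by
        simp [hM, Matrix.sum_apply]
    simp only [h2] at h1
    rw [abs_div, abs_two]
    have h3 : ‖u‖ ^ 2 * ∑ a, ∑ b, |(n : ℝ)⁻¹ * ∑ i, fisherPoint E θ₀ (z i).1 a b - V a b| ≤
        K ^ 2 * ∑ a, ∑ b, |(n : ℝ)⁻¹ * ∑ i, fisherPoint E θ₀ (z i).1 a b - V a b| := by gcongr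
    linarith [abs_nonneg (u ⬝ᵥ (M - V) *ᵥ u)]
  have hrem : |∑ i, (pointLogRatio E θ₀ (θ₀ + h) (z i) -
        (h ⬝ᵥ score E θ₀ (z i) - (h ⬝ᵥ fisherPoint E θ₀ (z i).1 *ᵥ h) / 2))| ≤
      (dη : ℝ) ^ 3 * dΘ ^ 3 * K ^ 3 *
        ((√(n : ℝ))⁻¹ * ((n : ℝ)⁻¹ * ∑ i, ‖(z i).1‖ ^ 3 * B (z i).1)) := by
    refine (Finset.abs_sum_le_sum_abs _ _).trans
      ((Finset.sum_le_sum fun i _ => abs_pointLogRatio_sub_le hB hθ (hz i)).trans ?_)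
    rw [← Finset.mul_sum, hnorm]
    have hS : 0 ≤ ∑ i, ‖(z i).1‖ ^ 3 * B (z i).1 :=
      Finset.sum_nonneg fun i _ => mul_nonneg (by positivity) (hB _)
    calc (dη : ℝ) ^ 3 * dΘ ^ 3 * ((√(n : ℝ))⁻¹ * ‖u‖) ^ 3 * ∑ i, ‖(z i).1‖ ^ 3 * B (z i).1
        ≤ (dη : ℝ) ^ 3 * dΘ ^ 3 * ((√(n : ℝ))⁻¹ * K) ^ 3 * ∑ i, ‖(z i).1‖ ^ 3 * B (z i).1 := by
          gcongr
      _ = _ := by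
          have : (n : ℝ)⁻¹ = (√(n : ℝ))⁻¹ * (√(n : ℝ))⁻¹ := by rw [← mul_inv, hss]
          rw [this]
          ring
  rw [hsplit]
  refine (abs_sub _ _).trans ?_
  rw [expansionError]
  linarith

end LocalExpansion

/-! ### Averages over one generation, and events depending on the past. -/

section Averages

variable {U 𝒵 : Type*} [MeasurableSpace U] [MeasurableSpace 𝒵] {ν : Measure U}
  [IsProbabilityMeasure ν] {P : Measure 𝒵} [IsProbabilityMeasure P] {G : ℕ}

/-- Law of large numbers for the average over one generation. -/
lemma tendstoInProb_generation_average {ξ : 𝒵 → ℝ} (hξ : Integrable ξ P) (g₀ : Fin G) :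
    TendstoInProb (fun n => arrayLaw ν P G n)
      (fun n p => (n : ℝ)⁻¹ * ∑ i : Fin n, ξ (p.2 g₀ i)) (∫ z, ξ z ∂P) := by
  have hinv : Tendsto (fun n : ℕ => (n : ℝ)⁻¹) atTop (𝓝 0) :=
    tendsto_inv_atTop_nhds_zero_nat
  have hsum : ∀ n : ℕ, n ≠ 0 →
      ∑ g : Fin G, ∑ _i : Fin n, (if g = g₀ then (n : ℝ)⁻¹ else 0) = 1 := fun n hn => by
    simp [hn]
  have h := tendstoInProb_arraySum (ν := ν) hξ
    (w := fun n g _ _ => if g = g₀ then (n : ℝ)⁻¹ else 0) (fun _ _ _ => measurable_const)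
    (fun δ hδ => WHP.of_eventually ?_) ⟨1, WHP.of_eventually ?_⟩ (ρ := 1)
    (tendstoInProb_of_tendsto (tendsto_const_nhds.congr' ?_))
  · rw [one_mul] at h
    refine h.congr fun n => Eventually.of_forall fun p => ?_
    simp [ite_mul, Finset.mul_sum]
  · filter_upwards [hinv.eventually_lt_const hδ] with n hn
    refine Eventually.of_forall fun u g i => ?_
    split_ifs
    · rwa [abs_of_nonneg (by positivity)]
    · simpa using hδ
  · filter_upwards [eventually_ne_atTop 0] with n hn
    refine Eventually.of_forall fun u => ?_
    refine le_of_eq ((Finset.sum_congr rfl fun g _ => Finset.sum_congr rfl fun i _ => ?_).trans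
      (hsum n hn))
    exact abs_of_nonneg (by positivity)
  · filter_upwards [eventually_ne_atTop 0] with n hn using (hsum n hn).symm

/-- Forgetting the last generation maps array laws to array laws. Only an inequality between
measures of preimage and image is used, so measurability of the events is not needed. -/
lemma WHP.of_arrayLaw_past {p : ∀ n, U × (Fin G → Fin n → 𝒵) → Prop}
    (h : WHP (fun n => arrayLaw ν P G n) p) :
    WHP (fun n => arrayLaw ν P (G + 1) n) fun n x => p n (x.1, fun j => x.2 j.castSucc) := by
  have key : ∀ n, (arrayLaw ν P (G + 1) n) {x | ¬ p n (x.1, fun j => x.2 j.castSucc)} ≤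
      (arrayLaw ν P G n) {x | ¬ p n x} := fun n => by
    have hm : Measurable fun x : U × (Fin (G + 1) → Fin n → 𝒵) =>
        (x.1, fun j : Fin G => x.2 j.castSucc) := by fun_prop
    have h1 : (arrayLaw ν P (G + 1) n).map (fun x => (x.1, fun j : Fin G => x.2 j.castSucc)) =
        arrayLaw ν P G n := by
      rw [arrayLaw_succ, Measure.map_map hm measurable_snoc_prod]
      have : ((fun x : U × (Fin (G + 1) → Fin n → 𝒵) => (x.1, fun j : Fin G => x.2 j.castSucc)) ∘
          fun p : (U × (Fin G → Fin n → 𝒵)) × (Fin n → 𝒵) =>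
            ((p.1.1, Fin.snoc p.1.2 p.2) : U × (Fin (G + 1) → Fin n → 𝒵))) = Prod.fst := by
        funext p
        simp
      rw [this, Measure.map_fst_prod, measure_univ, one_smul]
    rw [← h1]
    exact Measure.le_map_apply hm.aemeasurable _
  exact tendsto_of_tendsto_of_tendsto_of_le_of_le tendsto_const_nhds h (fun _ => zero_le) key

end Averages

/-! ### Asymptotic lower bound for the likelihood ratio. -/

section LikelihoodExpansion

lemma integrable_norm_pow_mul {dη dΘ : ℕ} {H : Measure (Feature dη dΘ)}
    {B : Feature dη dΘ → ℝ}
    (hx : ∀ k : ℕ, Integrable (fun x => ‖x‖ ^ k) H)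
    (hB : ∀ k : ℕ, Integrable (fun x => B x ^ k) H) (k : ℕ) :
    Integrable (fun x => ‖x‖ ^ k * B x) H := by
  have hBm : AEStronglyMeasurable B H := by simpa using (hB 1).1
  refine ((hx (2 * k)).add (hB 2)).mono' ((hx k).1.mul hBm) (Eventually.of_forall fun x => ?_)
  rw [Real.norm_eq_abs, abs_mul, abs_of_nonneg (by positivity : 0 ≤ ‖x‖ ^ k), Pi.add_apply,
    show ‖x‖ ^ (2 * k) = (‖x‖ ^ k) ^ 2 by rw [← pow_mul, mul_comm], ← sq_abs (B x)]
  nlinarith [sq_nonneg (‖x‖ ^ k - |B x|), sq_nonneg (‖x‖ ^ k), sq_nonneg |B x|]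

variable {dη dΘ dY : ℕ} {E : ExpFamily dη dY} {q : Kernel (Vec dη) (Vec dY)} [IsMarkovKernel q]
  {H : Measure (Feature dη dΘ)} [IsProbabilityMeasure H] {θ₀ : Vec dΘ}

lemma map_fst_pointKernel (θ : Vec dΘ) : (pointKernel E q H θ).map Prod.fst = H := by
  rw [pointKernel_eq]
  exact Measure.fst_compProd H _

lemma integrable_comp_feature {f : Feature dη dΘ → ℝ} (hf : Integrable f H) (θ : Vec dΘ) :
    Integrable (fun z : DataPt dη dΘ dY => f z.1) (pointKernel E q H θ) := by
  rw [← map_fst_pointKernel (E := E) (q := q) (H := H) θ] at hf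
  exact hf.comp_measurable measurable_fst

lemma integral_comp_feature {f : Feature dη dΘ → ℝ} (hf : Integrable f H) (θ : Vec dΘ) :
    ∫ z : DataPt dη dΘ dY, f z.1 ∂(pointKernel E q H θ) = ∫ x, f x ∂H := by
  have hf' := hf
  rw [← map_fst_pointKernel (E := E) (q := q) (H := H) θ] at hf'
  conv_rhs => rw [← map_fst_pointKernel (E := E) (q := q) (H := H) θ]
  exact (integral_map measurable_fst.aemeasurable hf'.1).symm

lemma ae_comp_feature {p : Feature dη dΘ → Prop} (hp : ∀ᵐ x ∂H, p x) (θ : Vec dΘ) :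
    ∀ᵐ z : DataPt dη dΘ dY ∂(pointKernel E q H θ), p z.1 := by
  rw [← map_fst_pointKernel (E := E) (q := q) (H := H) θ] at hp
  exact ae_of_ae_map measurable_fst.aemeasurable hp

variable {U : Type*} [MeasurableSpace U] {ν : Measure U} [IsProbabilityMeasure ν]
  {e : Estimators dη dΘ dY U}

/-- The first average converges to the Fisher matrix. The second is bounded in probability and
carries an extra factor 1/√n. -/
lemma tendstoInProb_expansionError (hm : RegularModel E H θ₀) {B : Feature dη dΘ → ℝ}
    (hB : ∀ k : ℕ, Integrable (fun x => B x ^ k) H) (K : ℝ) {G : ℕ} (g₀ : Fin G) :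
    TendstoInProb (fun n => refLaw E q H θ₀ ν n G) (fun _ p =>
      expansionError E θ₀ (fisherMatrix E H θ₀) B K (p.2 g₀)) 0 := by
  have h1 : ∀ a b, TendstoInProb (fun n => refLaw E q H θ₀ ν n G) (fun n p =>
      |(n : ℝ)⁻¹ * ∑ i : Fin n, fisherPoint E θ₀ (p.2 g₀ i).1 a b - fisherMatrix E H θ₀ a b|) 0 :=
    fun a b => by
      have hi := hm.fisher_integrable a b
      have h := tendstoInProb_generation_average (ν := ν)
        (integrable_comp_feature (E := E) (q := q) hi θ₀) g₀
      rw [integral_comp_feature hi] at h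
      have h' := h.comp (f := fun x => |x - fisherMatrix E H θ₀ a b|) (by fun_prop)
      have e0 : |∫ x, ((Matrix.of x)ᵀ * hess E.A (natParam x θ₀) * Matrix.of x) a b ∂H -
        fisherMatrix E H θ₀ a b| = 0 := by simp [fisherMatrix]
      rw [e0] at h'
      exact h'
  have h2 := (TendstoInProb.sum fun a => TendstoInProb.sum fun b => h1 a b).const_mul (K ^ 2)
  have h3 := tendstoInProb_generation_average (ν := ν) (integrable_comp_feature (E := E) (q := q)
    (integrable_norm_pow_mul hm.moments hB 3) θ₀) g₀
  have hsqrt : Tendsto (fun n : ℕ => (√(n : ℝ))⁻¹) atTop (𝓝 0) :=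
    (Real.tendsto_sqrt_atTop.comp tendsto_natCast_atTop_atTop).inv_tendsto_atTop
  have h4 := ((tendstoInProb_of_tendsto (μ := fun n => refLaw E q H θ₀ ν n G) hsqrt).mul
    h3).const_mul ((dη : ℝ) ^ 3 * dΘ ^ 3 * K ^ 3)
  have h5 := h2.add h4
  simp only [Finset.sum_const_zero, mul_zero, zero_mul, add_zero] at h5
  exact h5

lemma prod_pointRatio {n : ℕ} (θ : Vec dΘ) (z : Fin n → DataPt dη dΘ dY) :
    ∏ i, pointRatio E θ₀ θ (z i) =
      ENNReal.ofReal (Real.exp (∑ i, pointLogRatio E θ₀ θ (z i))) := by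
  rw [Real.exp_sum, ENNReal.ofReal_prod_of_nonneg fun i _ => (Real.exp_pos _).le]
  rfl

/-- Quadratic lower bound of the likelihood ratio of one generation. -/
lemma whp_le_generationRatio (hm : RegularModel E H θ₀) {r : ℝ} (hr : 0 < r)
    {B : Feature dη dΘ → ℝ} (hB0 : ∀ x, 0 ≤ B x) (hB : ∀ k : ℕ, Integrable (fun x => B x ^ k) H)
    (hreg : ∀ᵐ x ∂H, IsRegularFeature E θ₀ r B x) (G : ℕ) (K : ℝ) {ε : ℝ} (hε : 0 < ε) :
    WHP (fun n => refLaw E q H θ₀ ν n (G + 1)) fun n p =>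
      ‖√(n : ℝ) • (e.current θ₀ n G (pastData p) - θ₀)‖ ≤ K →
      ENNReal.ofReal (Real.exp (logLRStep (fisherMatrix E H θ₀)
        (√(n : ℝ) • (e.current θ₀ n G (pastData p) - θ₀)) (scoreStat E θ₀ (p.2 (Fin.last G))) - ε)) ≤
      generationRatio E θ₀ r (e.current θ₀ n G (pastData p)) (p.2 (Fin.last G)) := by
  have h1 := tendstoInProb_expansionError (q := q) (ν := ν) hm hB K (Fin.last G) ε hε
  have hsqrt : Tendsto (fun n : ℕ => √(n : ℝ)) atTop atTop :=
    Real.tendsto_sqrt_atTop.comp tendsto_natCast_atTop_atTop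
  refine h1.mono_ae ?_
  -- Once √n ≥ K / r, the bound K on the rescaled error places the parameter in the ball of radius
  -- r, where the truncation is inactive and the expansion applies.
  filter_upwards [eventually_gt_atTop 0, hsqrt.eventually_ge_atTop (K / r)] with n hn hnK
  have hae : ∀ᵐ p ∂(refLaw E q H θ₀ ν n (G + 1)), ∀ g i, IsRegularFeature E θ₀ r B (p.2 g i).1 :=
    ae_arrayLaw (ae_comp_feature hreg θ₀)
  filter_upwards [hae] with p hp herr hK
  have hs : 0 < √(n : ℝ) := Real.sqrt_pos.2 (by exact_mod_cast hn)
  set θ := e.current θ₀ n G (pastData p) with hθdef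
  have hθ : ‖θ - θ₀‖ ≤ r := by
    have h2 := hK
    rw [norm_smul, Real.norm_of_nonneg hs.le] at h2
    rw [div_le_iff₀ hr] at hnK
    exact le_of_mul_le_mul_left (h2.trans hnK) hs
  have key := abs_sum_pointLogRatio_sub_le (V := fisherMatrix E H θ₀) hB0 hn rfl hθ hK
    (hp (Fin.last G))
  rw [sub_zero] at herr
  have h3 := (abs_lt.1 ((le_abs_self _).trans_lt herr |> key.trans_lt)).1
  rw [generationRatio, if_pos (by rwa [Metric.mem_closedBall, dist_eq_norm]), prod_pointRatio]
  refine ENNReal.ofReal_le_ofReal (Real.exp_le_exp.2 ?_)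
  linarith

/-- For `G = 0` the current parameter is θ₀, which corresponds to the convention W_Θ(0) = 0. -/
lemma lastTheta_jointStat (n G : ℕ) (p : U × History dη dΘ dY n G) :
    lastTheta (jointStat E e θ₀ n G p) = √(n : ℝ) • (e.current θ₀ n G p - θ₀) := by
  cases G with
  | zero => simp [lastTheta, Estimators.current]
  | succ G => rfl

lemma pastPath_jointStat (n G : ℕ) (p : U × History dη dΘ dY n (G + 1)) :
    pastPath (jointStat E e θ₀ n (G + 1) p) = jointStat E e θ₀ n G (pastData p) := rfl

lemma norm_lastTheta_le {d G : ℕ} (w : Fin G → Vec d × Vec d) : ‖lastTheta w‖ ≤ ‖w‖ := by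
  cases G with
  | zero => simp [lastTheta]
  | succ G => exact (norm_snd_le _).trans (norm_le_pi_norm w (Fin.last G))

lemma norm_pastPath_le {d G : ℕ} (w : Fin (G + 1) → Vec d × Vec d) : ‖pastPath w‖ ≤ ‖w‖ :=
  (pi_norm_le_iff_of_nonneg (norm_nonneg w)).2 fun j => norm_le_pi_norm w j.castSucc

/-- On bounded paths the likelihood ratio is, up to a factor close to one, at least its Gaussian
limit. -/
theorem whp_le_likelihoodRatio (hm : RegularModel E H θ₀) {r : ℝ} (hr : 0 < r)
    {B : Feature dη dΘ → ℝ} (hB0 : ∀ x, 0 ≤ B x) (hB : ∀ k : ℕ, Integrable (fun x => B x ^ k) H)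
    (hreg : ∀ᵐ x ∂H, IsRegularFeature E θ₀ r B x) (G : ℕ) (K : ℝ) {ε : ℝ} (hε : 0 < ε) :
    WHP (fun n => refLaw E q H θ₀ ν n G) fun n p => ‖jointStat E e θ₀ n G p‖ ≤ K →
      ENNReal.ofReal (Real.exp (logLR (fisherMatrix E H θ₀) G (jointStat E e θ₀ n G p) - ε)) ≤
        likelihoodRatio E θ₀ e r n G p := by
  induction G generalizing ε with
  | zero =>
    refine WHP.of_eventually (Eventually.of_forall fun n => Eventually.of_forall fun p _ => ?_)
    rw [likelihoodRatio, ← ENNReal.ofReal_one]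
    refine ENNReal.ofReal_le_ofReal (Real.exp_le_one_iff.2 ?_)
    simp [logLR, hε.le]
  | succ G ih =>
    -- Half of the slack is spent on the past and half on the new generation.
    have h1 := (ih (half_pos hε)).of_arrayLaw_past
    have h2 := whp_le_generationRatio (q := q) (ν := ν) (e := e) hm hr hB0 hB hreg G K (half_pos hε)
    refine (WHP.and h1 h2).mono fun n p hp hK => ?_
    have hpast : ‖jointStat E e θ₀ n G (pastData p)‖ ≤ K :=
      (norm_pastPath_le (jointStat E e θ₀ n (G + 1) p)).trans hK
    have h3 := hp.1 hpast
    have h4 := hp.2 (by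
      rw [← lastTheta_jointStat (E := E)]
      exact (norm_lastTheta_le _).trans hpast)
    rw [likelihoodRatio]
    refine le_trans (le_of_eq ?_) (mul_le_mul' h3 h4)
    rw [← ENNReal.ofReal_mul (Real.exp_pos _).le, ← Real.exp_add, logLR, pastPath_jointStat,
      lastTheta_jointStat]
    congr 2
    change _ + logLRStep _ _ (scoreStat E θ₀ (p.2 (Fin.last G))) - ε = _
    ring

end LikelihoodExpansion

/-! ### Limit theorems under a change of measure. -/

section ChangeOfMeasure

variable {W : Type*} [NormedAddCommGroup W] [ProperSpace W] [MeasurableSpace W] [BorelSpace W]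

/-- A continuous function times a cutoff, as a bounded continuous function. -/
noncomputable def cutoffMul (K : ℝ) {φ : W → ℝ} (hφ : Continuous φ) :
    BoundedContinuousFunction W ℝ :=
  BoundedContinuousFunction.ofNormedAddCommGroup (fun x => cutoff W K x * φ x)
    ((cutoff W K).continuous.mul hφ)
    (max 0 ((isCompact_closedBall (0 : W) (K + 1)).exists_bound_of_continuousOn
      hφ.continuousOn).choose) fun x => by
    rcases le_or_gt (K + 1) ‖x‖ with h | h
    · simp [cutoff_eq_zero h]
    · have hb := ((isCompact_closedBall (0 : W) (K + 1)).exists_bound_of_continuousOn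
        hφ.continuousOn).choose_spec x (by simpa using h.le)
      rw [norm_mul, Real.norm_of_nonneg (cutoff_nonneg _ _)]
      exact (mul_le_of_le_one_left (norm_nonneg _) (cutoff_le_one _ _)).trans
        (hb.trans (le_max_right _ _))

variable {Ω : ℕ → Type*} [∀ n, MeasurableSpace (Ω n)] {μ μ' : ∀ n, Measure (Ω n)}
  [∀ n, IsProbabilityMeasure (μ n)] [∀ n, IsProbabilityMeasure (μ' n)]

/-- A limit theorem under a change of measure: if the likelihood ratio is asymptotically at least
`exp (ℓ (X n))` and this is a probability density in the limit, then the law of `X n` under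
the new measures converges to the tilted limit law. -/
theorem tendstoInDistribution_of_le_likelihoodRatio {X : ∀ n, Ω n → W} {γ : Measure W}
    [IsProbabilityMeasure γ] {ℓ : W → ℝ} (hℓ : Continuous ℓ) {R : ∀ n, Ω n → ℝ≥0∞}
    (hR : ∀ n, Measurable (R n)) (hX : ∀ n, Measurable (X n))
    (hlim : TendstoInDistribution X atTop id μ γ)
    (hRle : ∀ n (f : Ω n → ℝ≥0∞), Measurable f → ∫⁻ ω, R n ω * f ω ∂(μ n) ≤ ∫⁻ ω, f ω ∂(μ' n))
    (hRge : ∀ K ε : ℝ, 0 < ε → WHP μ fun n ω => ‖X n ω‖ ≤ K →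
      ENNReal.ofReal (Real.exp (ℓ (X n ω) - ε)) ≤ R n ω)
    [IsProbabilityMeasure (γ.withDensity fun x => ENNReal.ofReal (Real.exp (ℓ x)))] :
    TendstoInDistribution X atTop id μ'
      (γ.withDensity fun x => ENNReal.ofReal (Real.exp (ℓ x))) := by
  set γ' := γ.withDensity fun x => ENNReal.ofReal (Real.exp (ℓ x)) with hγ'
  have hexp : Continuous fun x => Real.exp (ℓ x) := Real.continuous_exp.comp hℓ
  have hfin : ∀ᵐ x ∂γ, ENNReal.ofReal (Real.exp (ℓ x)) < ∞ :=
    Eventually.of_forall fun _ => ENNReal.ofReal_lt_top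
  have hprob : ∀ n, IsProbabilityMeasure ((μ' n).map (X n)) := fun n =>
    Measure.isProbabilityMeasure_map (hX n).aemeasurable
  have hlim' := (tendstoInDistribution_iff_integral (fun n => (hX n).aemeasurable)
    aemeasurable_id).1 hlim
  refine (tendstoInDistribution_iff_integral (fun n => (hX n).aemeasurable) aemeasurable_id).2
    fun f₀ => ?_
  -- All measures involved have mass one, so a lower bound on the liminf for nonnegative test
  -- functions already implies weak convergence. This is why one-sided control of the likelihood
  -- ratio is enough.
  have key := BoundedContinuousFunction.tendsto_integral_of_forall_integral_le_liminf_integral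
    (L := atTop) (μ := γ') (μs := fun n => (μ' n).map (X n)) (fun f hf => ?_) f₀
  · simp only [id]
    refine key.congr fun n => ?_
    exact integral_map (hX n).aemeasurable f₀.continuous.aestronglyMeasurable
  have hf0 : ∀ x, 0 ≤ f x := hf
  have hfe : Continuous fun x => f x * Real.exp (ℓ x) := f.continuous.mul hexp
  have hfint : ∫ x, f x ∂γ' = ∫ x, f x * Real.exp (ℓ x) ∂γ := by
    rw [hγ', integral_withDensity_eq_integral_toReal_smul hexp.measurable.ennreal_ofReal hfin]
    refine integral_congr_ae (Eventually.of_forall fun x => ?_)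
    simp only [ENNReal.toReal_ofReal (Real.exp_pos _).le, smul_eq_mul, mul_comm]
  have hfi : Integrable (fun x => f x * Real.exp (ℓ x)) γ := by
    have h1 : Integrable f γ' := f.integrable γ'
    rw [hγ', integrable_withDensity_iff_integrable_smul' hexp.measurable.ennreal_ofReal hfin] at h1
    refine h1.congr (Eventually.of_forall fun x => ?_)
    simp only [ENNReal.toReal_ofReal (Real.exp_pos _).le, smul_eq_mul, mul_comm]
  have hbdd : ∀ n, |∫ x, f x ∂((μ' n).map (X n))| ≤ ‖f‖ := fun n =>
    f.norm_integral_le_norm _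
  refine le_of_forall_lt fun c hc => ?_
  -- choose the cutoff and the slack
  have hK : Tendsto (fun K : ℕ => ∫ x, cutoff W K x * (f x * Real.exp (ℓ x)) ∂γ) atTop
      (𝓝 (∫ x, 1 * (f x * Real.exp (ℓ x)) ∂γ)) := by
    refine tendsto_integral_of_dominated_convergence (fun x => f x * Real.exp (ℓ x))
      (fun K => ((cutoff W K).continuous.mul hfe).aestronglyMeasurable) hfi
      (fun K => Eventually.of_forall fun x => ?_)
      (Eventually.of_forall fun x => (tendsto_cutoff x).mul_const _)
    have hp : 0 ≤ f x * Real.exp (ℓ x) := mul_nonneg (hf0 x) (Real.exp_pos _).le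
    rw [norm_mul, Real.norm_of_nonneg hp, Real.norm_of_nonneg (cutoff_nonneg _ _)]
    exact mul_le_of_le_one_left hp (cutoff_le_one _ _)
  simp only [one_mul] at hK
  obtain ⟨c', hcc', hc'⟩ := exists_between hc
  rw [hfint] at hc'
  obtain ⟨K, hKc⟩ := (hK.eventually_const_lt hc').exists
  set F := cutoffMul (K : ℝ) hfe with hF
  have hFx : ∀ x, F x = cutoff W K x * (f x * Real.exp (ℓ x)) := fun x => rfl
  have hF0 : ∀ x, 0 ≤ F x := fun x =>
    mul_nonneg (cutoff_nonneg _ _) (mul_nonneg (hf0 x) (Real.exp_pos _).le)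
  have hε : Tendsto (fun ε : ℝ => Real.exp (-ε) * ∫ x, F x ∂γ) (𝓝[>] 0)
      (𝓝 (Real.exp (-0) * ∫ x, F x ∂γ)) :=
    (Continuous.tendsto (by fun_prop) (0 : ℝ)).mono_left nhdsWithin_le_nhds
  rw [neg_zero, Real.exp_zero, one_mul] at hε
  obtain ⟨ε, hεc, hε0⟩ := ((hε.eventually_const_lt hKc).and self_mem_nhdsWithin).exists
  have hε0' : (0 : ℝ) < ε := hε0
  -- the bound for fixed `n`
  set bad : ∀ n, Set (Ω n) := fun n => {ω | ¬ (‖X n ω‖ ≤ (K : ℝ) + 1 →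
    ENNReal.ofReal (Real.exp (ℓ (X n ω) - ε)) ≤ R n ω)} with hbad
  have hbound : ∀ n, Real.exp (-ε) * ∫ ω, F (X n ω) ∂(μ n) - ‖F‖ * (μ n).real (bad n) ≤
      ∫ x, f x ∂((μ' n).map (X n)) := fun n => by
    have hfX : Measurable fun ω => ENNReal.ofReal (f (X n ω)) :=
      (f.continuous.measurable.comp (hX n)).ennreal_ofReal
    have hFX : Integrable (fun ω => F (X n ω)) (μ n) :=
      (F.integrable ((μ n).map (X n))).comp_measurable (hX n)
    have hfX' : Integrable (fun ω => f (X n ω)) (μ' n) :=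
      (f.integrable ((μ' n).map (X n))).comp_measurable (hX n)
    -- On the bad event `F` is bounded by its norm. On the good event either the cutoff vanishes or
    -- the path is bounded and the lower bound for `R` applies.
    have hpt : ∀ ω, ENNReal.ofReal (Real.exp (-ε) * F (X n ω)) ≤
        R n ω * ENNReal.ofReal (f (X n ω)) +
          (bad n).indicator (fun _ => ENNReal.ofReal ‖F‖) ω := fun ω => by
      by_cases hω : ω ∈ bad n
      · rw [Set.indicator_of_mem hω]
        refine le_add_left (ENNReal.ofReal_le_ofReal ?_)
        exact (mul_le_of_le_one_left (hF0 _) (Real.exp_le_one_iff.2 (by linarith))).trans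
          ((le_abs_self _).trans (F.norm_coe_le_norm _))
      · rw [Set.indicator_of_notMem hω, add_zero]
        rcases le_or_gt ((K : ℝ) + 1) ‖X n ω‖ with h | h
        · simp [hFx, cutoff_eq_zero h]
        · have hgood : ‖X n ω‖ ≤ (K : ℝ) + 1 →
            ENNReal.ofReal (Real.exp (ℓ (X n ω) - ε)) ≤ R n ω := not_not.1 hω
          refine le_trans ?_ (mul_le_mul_left (hgood h.le) _)
          rw [← ENNReal.ofReal_mul (Real.exp_pos _).le]
          refine ENNReal.ofReal_le_ofReal ?_
          rw [hFx, sub_eq_add_neg, Real.exp_add]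
          have hp : 0 ≤ Real.exp (-ε) * (f (X n ω) * Real.exp (ℓ (X n ω))) :=
            mul_nonneg (Real.exp_pos _).le (mul_nonneg (hf0 _) (Real.exp_pos _).le)
          calc _ = cutoff W K (X n ω) * (Real.exp (-ε) * (f (X n ω) * Real.exp (ℓ (X n ω)))) := by
                ring
            _ ≤ Real.exp (-ε) * (f (X n ω) * Real.exp (ℓ (X n ω))) :=
                mul_le_of_le_one_left hp (cutoff_le_one _ _)
            _ = _ := by ring
    have h1 : ENNReal.ofReal (Real.exp (-ε) * ∫ ω, F (X n ω) ∂(μ n)) ≤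
        ENNReal.ofReal (∫ ω, f (X n ω) ∂(μ' n) + ‖F‖ * (μ n).real (bad n)) := by
      rw [← integral_const_mul, ofReal_integral_eq_lintegral_ofReal (hFX.const_mul _)
        (Eventually.of_forall fun ω => mul_nonneg (Real.exp_pos _).le (hF0 _)),
        ENNReal.ofReal_add (integral_nonneg fun ω => hf0 _) (by positivity),
        ofReal_integral_eq_lintegral_ofReal hfX' (Eventually.of_forall fun ω => hf0 _),
        ENNReal.ofReal_mul (norm_nonneg _), ofReal_measureReal]
      refine (lintegral_mono hpt).trans ?_
      have hRf : Measurable fun ω => R n ω * ENNReal.ofReal (f (X n ω)) := (hR n).mul hfX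
      rw [lintegral_add_left hRf]
      exact add_le_add (hRle n _ hfX) (lintegral_indicator_const_le _ _)
    have h2 := (ENNReal.ofReal_le_ofReal_iff (add_nonneg (integral_nonneg fun ω => hf0 _)
      (by positivity))).1 h1
    rw [integral_map (hX n).aemeasurable f.continuous.aestronglyMeasurable]
    linarith
  have hbadlim : Tendsto (fun n => (μ n).real (bad n)) atTop (𝓝 0) := by
    have := (ENNReal.tendsto_toReal ENNReal.zero_ne_top).comp (hRge (K + 1) ε hε0')
    rw [ENNReal.toReal_zero] at this
    exact this
  have hlow : Tendsto (fun n => Real.exp (-ε) * ∫ ω, F (X n ω) ∂(μ n) - ‖F‖ * (μ n).real (bad n))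
      atTop (𝓝 (Real.exp (-ε) * ∫ x, F x ∂γ - ‖F‖ * 0)) :=
    ((hlim' F).const_mul _).sub (hbadlim.const_mul _)
  rw [mul_zero, sub_zero] at hlow
  refine hcc'.trans_le (le_liminf_of_le ?_ ?_)
  -- For real sequences a lower bound on the liminf is only meaningful when the sequence does not
  -- escape to infinity.
  · exact (isBoundedUnder_of ⟨‖f‖, fun n => (abs_le.1 (hbdd n)).2⟩).isCoboundedUnder_ge
  · filter_upwards [hlow.eventually_const_lt hεc] with n hn using hn.le.trans (hbound n)

end ChangeOfMeasure

/-! ### Consequences of the weight conditions; limit of the averaged Hessian. -/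

section Weights

variable {U : Type*} [MeasurableSpace U] {ν : Measure U} {ω : ℕ → ℕ → ℕ → ℕ → U → ℝ}

lemma RegularWeights.whp_abs_lt (hω : RegularWeights ω ν) {G g : ℕ} (hg : g < G) {δ : ℝ}
    (hδ : 0 < δ) :
    WHP (fun _ => ν) fun n u => ∀ i : Fin n, (√(n : ℝ))⁻¹ * |ω n G g i u| < δ := by
  refine (tendstoInProb_of_tendstoInMeasure (hω.negligible G g hg) δ hδ).mono fun n u h i => ?_
  rw [sub_zero] at h
  refine lt_of_le_of_lt ?_ ((le_abs_self _).trans_lt h)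
  gcongr
  exact le_ciSup (f := fun i : Fin n => |ω n G g i u|) (Set.finite_range _).bddAbove i

/-- From |ω| ≤ 1 + ω² and convergence of the mean square; convergence of the signed mean alone would
not control absolute values. -/
lemma RegularWeights.whp_average_abs_le (hω : RegularWeights ω ν) {G g : ℕ} (hg : g < G) :
    ∃ C, WHP (fun _ => ν) fun n u => (n : ℝ)⁻¹ * ∑ i : Fin n, |ω n G g i u| ≤ C := by
  obtain ⟨c, hc⟩ := hω.cross G G g hg hg
  refine ⟨1 + (c + 1), (tendstoInProb_of_tendstoInMeasure hc 1 one_pos).mono fun n u h => ?_⟩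
  have h1 := (abs_lt.1 h).2
  have h2 : (n : ℝ)⁻¹ * ∑ i : Fin n, |ω n G g i u| ≤
      (n : ℝ)⁻¹ * ∑ i : Fin n, (1 + ω n G g i u * ω n G g i u) := by
    gcongr with i
    nlinarith [abs_mul_abs_self (ω n G g i u), sq_nonneg (|ω n G g i u| - 1)]
  rw [Finset.sum_add_distrib, mul_add] at h2
  have h3 : (n : ℝ)⁻¹ * ∑ _i : Fin n, (1 : ℝ) ≤ 1 := by
    simpa using inv_mul_le_one (a := (n : ℝ))
  linarith

variable {dη dΘ dY : ℕ} [IsProbabilityMeasure ν] {P : Measure (DataPt dη dΘ dY)}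
  [IsProbabilityMeasure P]

/-- The law of large numbers applies with weights ω/(nG): they are uniformly negligible because even
ω/√n is, and their total tends to G⁻¹∑ρ. -/
lemma tendstoInProb_weightedHess (hω : RegularWeights ω ν)
    {L : DataPt dη dΘ dY → Vec dΘ → ℝ} {θ₀ : Vec dΘ}
    (hL : ∀ a b, Integrable (fun z => hess (L z) θ₀ a b) P) {G : ℕ} (hG : 1 ≤ G) {ρ : ℕ → ℝ}
    (hρ : ∀ g < G, TendstoInMeasure ν
      (fun (n : ℕ) u => (n : ℝ)⁻¹ * ∑ i : Fin n, ω n G g i u) atTop fun _ => ρ g) :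
    TendstoInProb (fun n => arrayLaw ν P G n)
      (fun n p a b => weightedHess L ω θ₀ n G p a b)
      (fun a b => ((G : ℝ)⁻¹ * ∑ g ∈ Finset.range G, ρ g) * ∫ z, hess (L z) θ₀ a b ∂P) := by
  refine TendstoInProb.pi fun a => TendstoInProb.pi fun b => ?_
  have hG1 : (1 : ℝ) ≤ G := by exact_mod_cast hG
  have hG' : (G : ℝ)⁻¹ ≤ 1 := inv_le_one_of_one_le₀ hG1
  choose C hC using fun g : Fin G => hω.whp_average_abs_le g.isLt
  have h := tendstoInProb_arraySum (ν := ν) (hL a b)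
    (w := fun n (g : Fin G) i u => ((n : ℝ) * G)⁻¹ * ω n G g i u)
    (fun n g i => (hω.measurable n G g i).const_mul _) ?_
    ⟨∑ g, C g, (WHP.all hC).mono fun n u hu => ?_⟩ (ρ := (G : ℝ)⁻¹ * ∑ g ∈ Finset.range G, ρ g) ?_
  · refine h.congr fun n => Eventually.of_forall fun p => ?_
    simp [weightedHess, Matrix.sum_apply, Finset.mul_sum, mul_assoc]
  · intro δ hδ
    refine (WHP.all fun g : Fin G => hω.whp_abs_lt g.isLt hδ).mono fun n u hu g i => ?_
    refine lt_of_le_of_lt ?_ (hu g i)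
    rw [abs_mul, abs_of_nonneg (by positivity)]
    have hn : (1 : ℝ) ≤ n := by exact_mod_cast (Nat.one_le_iff_ne_zero.2 i.pos.ne')
    gcongr
    rw [Real.sqrt_le_left (by positivity)]
    nlinarith [mul_le_mul hn hG1 zero_le_one (by positivity)]
  · refine Finset.sum_le_sum fun g _ => le_trans ?_ (hu g)
    rw [Finset.mul_sum]
    refine Finset.sum_le_sum fun i _ => ?_
    rw [abs_mul, abs_of_nonneg (by positivity), mul_inv]
    gcongr
    exact mul_le_of_le_one_right (by positivity) hG'
  · have h1 := (TendstoInProb.sum fun g : Fin G =>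
      tendstoInProb_of_tendstoInMeasure (hρ g g.isLt)).const_mul (G : ℝ)⁻¹
    rw [← Fin.sum_univ_eq_sum_range]
    refine h1.congr fun n => Eventually.of_forall fun u => ?_
    simp only [Finset.mul_sum, mul_inv]
    refine Finset.sum_congr rfl fun g _ => Finset.sum_congr rfl fun i _ => by ring

lemma continuousAt_matrix_inv {d : ℕ} {M : Fin d → Fin d → ℝ} (hM : (Matrix.of M).det ≠ 0) :
    ContinuousAt (fun (N : Fin d → Fin d → ℝ) a b => (Matrix.of N)⁻¹ a b) M := by
  refine continuousAt_pi.2 fun a => continuousAt_pi.2 fun b => ?_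
  simp only [Matrix.inv_def, Ring.inverse_eq_inv', Matrix.smul_apply, smul_eq_mul]
  have h1 : Continuous fun N : Fin d → Fin d → ℝ => (Matrix.of N).det :=
    Continuous.matrix_det continuous_id
  have h2 : Continuous fun N : Fin d → Fin d → ℝ => (Matrix.of N).adjugate :=
    Continuous.matrix_adjugate continuous_id
  exact (h1.continuousAt.inv₀ hM).mul (h2.matrix_elem a b).continuousAt

lemma WHP.of_truncate {k G : ℕ} (hk : k ≤ G) {p : ∀ n, U × History dη dΘ dY n k → Prop}
    (h : WHP (fun n => arrayLaw ν P k n) p) :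
    WHP (fun n => arrayLaw ν P G n) fun n x => p n (x.1, truncate hk x.2) := by
  induction G, hk using Nat.le_induction with
  | base => exact h
  | succ G hk ih => exact ih.of_arrayLaw_past

end Weights

lemma sum_castLE {M : Type*} [AddCommMonoid M] {k G : ℕ} (hk : k ≤ G) (f : Fin G → M) :
    ∑ j, f (Fin.castLE hk j) = ∑ j : Fin G, if (j : ℕ) < k then f j else 0 := by
  induction G, hk using Nat.le_induction with
  | base => exact Finset.sum_congr rfl fun j _ => by simp
  | succ G hk ih =>
    rw [Fin.sum_univ_castSucc, if_neg (by simpa using hk), add_zero]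
    exact ih fun j => f j.castSucc

/-! ### Reduction of the estimation error to the weighted gradient sum. -/

section LinearStatistic

variable {dη dΘ dY : ℕ} {U : Type*}

/-- The rescaled estimation error, up to the error of the linear approximation and the error of
the averaged Hessian. -/
lemma sqrt_smul_sub_eq {L : DataPt dη dΘ dY → Vec dΘ → ℝ} {ω : ℕ → ℕ → ℕ → ℕ → U → ℝ}
    {θ₀ : Vec dΘ} {n G : ℕ} (hG : 0 < G) (p : U × History dη dΘ dY n G) (s : ℝ)
    (v N : Vec dΘ) (M : Matrix (Fin dΘ) (Fin dΘ) ℝ)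
    (hN : N = (√(n : ℝ))⁻¹ • ∑ g : Fin G, ∑ i : Fin n, ω n G g i p.1 • grad (L (p.2 g i)) θ₀) :
    √(n : ℝ) • v - (s / G) • (M *ᵥ N) =
      (√(G : ℝ))⁻¹ • (√((n : ℝ) * G) • v - s • linearTerm L ω θ₀ n G p) +
        (s / G) • (((weightedHess L ω θ₀ n G p)⁻¹ - M) *ᵥ N) := by
  have hG' : (0 : ℝ) < G := by exact_mod_cast hG
  have hsG : 0 < √(G : ℝ) := Real.sqrt_pos.2 hG'
  have hss : (√(G : ℝ))⁻¹ * (√(G : ℝ))⁻¹ = (G : ℝ)⁻¹ := by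
    rw [← mul_inv, Real.mul_self_sqrt hG'.le]
  have hlin : linearTerm L ω θ₀ n G p =
      (√(G : ℝ))⁻¹ • ((weightedHess L ω θ₀ n G p)⁻¹ *ᵥ N) := by
    rw [hN, Matrix.mulVec_smul, Matrix.mulVec_sum, smul_smul, linearTerm,
      Real.sqrt_mul (by positivity), mul_inv, mul_comm]
    congr 1
    refine Finset.sum_congr rfl fun g _ => ?_
    rw [Matrix.mulVec_sum]
    exact Finset.sum_congr rfl fun i _ => (Matrix.mulVec_smul _ _ _).symm
  rw [hlin, Real.sqrt_mul (by positivity), smul_sub, smul_smul, smul_smul, smul_smul,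
    Matrix.sub_mulVec, smul_sub]
  have e1 : (√(G : ℝ))⁻¹ * (√(n : ℝ) * √(G : ℝ)) = √(n : ℝ) := by field_simp
  have e2 : (√(G : ℝ))⁻¹ * s * (√(G : ℝ))⁻¹ = s / G := by
    rw [mul_right_comm, hss, div_eq_mul_inv, mul_comm]
  rw [e1, e2]
  abel

end LinearStatistic

/-! ### All scores and weighted gradients as one array sum. -/

section StackedStatistic

variable {dη dΘ dY : ℕ} {U : Type*}

/-- Score and loss gradient, repeated for each generation. -/
noncomputable def stackedScore (E : ExpFamily dη dY) (θ₀ : Vec dΘ)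
    (ψ : DataPt dη dΘ dY → Vec dΘ) (G : ℕ) (z : DataPt dη dΘ dY) :
    Fin G × (Fin dΘ ⊕ Fin dΘ) → ℝ :=
  fun j => Sum.elim (score E θ₀ z) (ψ z) j.2

/-- The weights of the points of generation `g` in the score statistic and in the weighted loss
gradient, up to normalization. -/
noncomputable def stackedWeight (ω : ℕ → ℕ → ℕ → ℕ → U → ℝ) (dΘ : ℕ) {G : ℕ} (n : ℕ) (g : Fin G)
    (i : ℕ) (j : Fin G × (Fin dΘ ⊕ Fin dΘ)) (u : U) : ℝ :=
  Sum.elim (fun _ => if g = j.1 then 1 else 0)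
    -- Index `j.1` stands for generation `j.1 + 1`, whose estimator uses the generations with index
    -- at most `j.1`.
    (fun _ => if (g : ℕ) < j.1 + 1 then ω n (j.1 + 1) g i u else 0) j.2

variable {ω : ℕ → ℕ → ℕ → ℕ → U → ℝ}

/-- The three cases reduce every statement about stacked weights to a trivial one or to one of the
weight conditions. -/
lemma stackedWeight_cases {G : ℕ} (g : Fin G) (j : Fin G × (Fin dΘ ⊕ Fin dΘ)) :
    (∀ n i u, stackedWeight ω dΘ n g i j u = 0) ∨ (∀ n i u, stackedWeight ω dΘ n g i j u = 1) ∨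
      ∃ G', (g : ℕ) < G' ∧ ∀ n i u, stackedWeight ω dΘ n g i j u = ω n G' g i u := by
  obtain ⟨k, b | b⟩ := j
  · by_cases h : g = k
    · exact Or.inr (Or.inl fun n i u => if_pos h)
    · exact Or.inl fun n i u => if_neg h
  · by_cases h : (g : ℕ) < k + 1
    · exact Or.inr (Or.inr ⟨k + 1, h, fun n i u => if_pos h⟩)
    · exact Or.inl fun n i u => if_neg h

variable [MeasurableSpace U] {ν : Measure U}

lemma measurable_stackedWeight (hω : RegularWeights ω ν) {G : ℕ} (n : ℕ) (g : Fin G) (i : ℕ)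
    (j : Fin G × (Fin dΘ ⊕ Fin dΘ)) : Measurable (stackedWeight ω dΘ n g i j) := by
  rcases stackedWeight_cases (ω := ω) g j with h | h | ⟨G', -, h⟩
  · rw [show stackedWeight ω dΘ n g i j = fun _ => 0 from funext (h n i)]
    exact measurable_const
  · rw [show stackedWeight ω dΘ n g i j = fun _ => 1 from funext (h n i)]
    exact measurable_const
  · rw [show stackedWeight ω dΘ n g i j = ω n G' g i from funext (h n i)]
    exact hω.measurable _ _ _ _

lemma tendsto_inv_sqrt_natCast : Tendsto (fun n : ℕ => (√(n : ℝ))⁻¹) atTop (𝓝 0) :=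
  (Real.tendsto_sqrt_atTop.comp tendsto_natCast_atTop_atTop).inv_tendsto_atTop

lemma whp_stackedWeight_lt (hω : RegularWeights ω ν) {G : ℕ} {δ : ℝ} (hδ : 0 < δ) :
    WHP (fun _ => ν) fun n u => ∀ (g : Fin G) (i : Fin n) (j : Fin G × (Fin dΘ ⊕ Fin dΘ)),
      |(√(n : ℝ))⁻¹ * stackedWeight ω dΘ n g i j u| < δ := by
  have key : ∀ (g : Fin G) (j : Fin G × (Fin dΘ ⊕ Fin dΘ)), WHP (fun _ => ν) fun n u =>
      ∀ i : Fin n, |(√(n : ℝ))⁻¹ * stackedWeight ω dΘ n g i j u| < δ := fun g j => by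
    rcases stackedWeight_cases (ω := ω) g j with h | h | ⟨G', hg, h⟩
    · refine WHP.of_eventually (Eventually.of_forall fun n => Eventually.of_forall fun u i => ?_)
      simpa [h] using hδ
    · refine WHP.of_eventually ?_
      filter_upwards [tendsto_inv_sqrt_natCast.eventually_lt_const hδ] with n hn
      refine Eventually.of_forall fun u i => ?_
      rwa [h, mul_one, abs_of_nonneg (by positivity)]
    · refine (hω.whp_abs_lt hg hδ).mono fun n u hu i => ?_
      rw [h, abs_mul, abs_of_nonneg (by positivity)]
      exact hu i
  exact (WHP.all fun g => WHP.all fun j => key g j).mono fun n u h g i j => h g j i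

/-- Products of two gradient weights use the cross condition; a score weight times a gradient weight
leaves a mean of ω; two score weights leave a constant or zero. -/
lemma exists_tendstoInProb_stackedWeight_mul (hω : RegularWeights ω ν) {G : ℕ}
    (j k : Fin G × (Fin dΘ ⊕ Fin dΘ)) :
    ∃ c, TendstoInProb (fun _ => ν) (fun n u => ∑ g : Fin G, ∑ i : Fin n,
      ((√(n : ℝ))⁻¹ * stackedWeight ω dΘ n g i j u) *
        ((√(n : ℝ))⁻¹ * stackedWeight ω dΘ n g i k u)) c := by
  have hmean : ∀ (G' : ℕ) (g : Fin G), (g : ℕ) < G' → ∃ c, TendstoInProb (fun _ => ν)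
      (fun n u => (n : ℝ)⁻¹ * ∑ i : Fin n, ω n G' g i u) c := fun G' g hg => by
    obtain ⟨ρ, -, hρ⟩ := hω.mean G' (by lia)
    exact ⟨ρ g, tendstoInProb_of_tendstoInMeasure (hρ g hg)⟩
  have hone : ∃ c, TendstoInProb (fun _ => ν)
      (fun (n : ℕ) (_ : U) => (n : ℝ)⁻¹ * ∑ _i : Fin n, (1 : ℝ)) c := by
    refine ⟨1, tendstoInProb_of_tendsto (tendsto_const_nhds.congr' ?_)⟩
    filter_upwards [eventually_ne_atTop 0] with n hn
    simp [hn]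
  have key : ∀ g : Fin G, ∃ c, TendstoInProb (fun _ => ν) (fun n u => (n : ℝ)⁻¹ * ∑ i : Fin n,
      stackedWeight ω dΘ n g i j u * stackedWeight ω dΘ n g i k u) c := fun g => by
    have hzero : ∃ c, TendstoInProb (fun _ => ν) (fun (_ : ℕ) (_ : U) => (0 : ℝ)) c :=
      ⟨0, tendstoInProb_of_tendsto tendsto_const_nhds⟩
    rcases stackedWeight_cases (ω := ω) g j with h | h | ⟨G', hg, h⟩
    · simpa [h] using hzero
    · rcases stackedWeight_cases (ω := ω) g k with h' | h' | ⟨G'', hg', h'⟩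
      · simpa [h'] using hzero
      · simpa only [h, h', mul_one] using hone
      · simpa only [h, h', one_mul] using hmean G'' g hg'
    · rcases stackedWeight_cases (ω := ω) g k with h' | h' | ⟨G'', hg', h'⟩
      · simpa [h'] using hzero
      · simpa only [h, h', mul_one] using hmean G' g hg
      · obtain ⟨c, hc⟩ := hω.cross G' G'' g hg hg'
        simp only [h, h']
        exact ⟨c, tendstoInProb_of_tendstoInMeasure hc⟩
  choose c hc using key
  refine ⟨∑ g, c g, (TendstoInProb.sum hc).congr fun n => Eventually.of_forall fun u => ?_⟩
  have hn : (n : ℝ)⁻¹ = (√(n : ℝ))⁻¹ * (√(n : ℝ))⁻¹ := by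
    rw [← mul_inv, Real.mul_self_sqrt (by positivity)]
  simp only [Finset.mul_sum, hn]
  refine Finset.sum_congr rfl fun g _ => Finset.sum_congr rfl fun i _ => by ring

end StackedStatistic

section StackedSum

variable {dη dΘ dY : ℕ} {U : Type*} {E : ExpFamily dη dY} {θ₀ : Vec dΘ}
  {L : DataPt dη dΘ dY → Vec dΘ → ℝ} {ω : ℕ → ℕ → ℕ → ℕ → U → ℝ}

/-- The vector of all weighted sums of scores and loss gradients. -/
noncomputable def stackedSum (ω : ℕ → ℕ → ℕ → ℕ → U → ℝ) (E : ExpFamily dη dY) (θ₀ : Vec dΘ)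
    (ψ : DataPt dη dΘ dY → Vec dΘ) (n G : ℕ) (p : U × History dη dΘ dY n G) :
    EuclideanSpace ℝ (Fin G × (Fin dΘ ⊕ Fin dΘ)) :=
  WithLp.toLp 2 fun j => ∑ g, ∑ i : Fin n, ((√(n : ℝ))⁻¹ * stackedWeight ω dΘ n g i j p.1) *
    stackedScore E θ₀ ψ G (p.2 g i) j

lemma stackedSum_inl (ψ : DataPt dη dΘ dY → Vec dΘ) (n G : ℕ) (p : U × History dη dΘ dY n G)
    (g : Fin G) : (fun a => stackedSum ω E θ₀ ψ n G p (g, Sum.inl a)) = scoreStat E θ₀ (p.2 g) := by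
  funext a
  simp [scoreStat_eq, stackedSum, stackedWeight, stackedScore, Finset.mul_sum, ite_mul]

lemma stackedSum_inr {ψ : DataPt dη dΘ dY → Vec dΘ} {n G : ℕ} {p : U × History dη dΘ dY n G}
    (hψ : ∀ g i, grad (L (p.2 g i)) θ₀ = ψ (p.2 g i)) (g : Fin G) :
    (fun b => stackedSum ω E θ₀ ψ n G p (g, Sum.inr b)) =
      (√(n : ℝ))⁻¹ • ∑ j : Fin (g + 1), ∑ i : Fin n, ω n (g + 1) j i p.1 •
        grad (L (truncate (Nat.succ_le_of_lt g.isLt) p.2 j i)) θ₀ := by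
  have h := sum_castLE (Nat.succ_le_of_lt g.isLt) fun j : Fin G =>
    ∑ i : Fin n, ω n (g + 1) j i p.1 • grad (L (p.2 j i)) θ₀
  simp only [Fin.val_castLE] at h
  simp only [truncate]
  rw [h]
  funext b
  simp only [stackedSum, stackedWeight, stackedScore, Sum.elim_inr, Pi.smul_apply,
    Finset.sum_apply, smul_eq_mul, Finset.mul_sum]
  refine Finset.sum_congr rfl fun j _ => ?_
  split_ifs with hj
  · simp [hψ, Finset.mul_sum, mul_assoc]
  · simp

end StackedSum

/-! ### Joint Gaussian limit under the reference law. -/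

section ReferenceLimit

/-- The image of a centred Gaussian measure under a linear map is centred. -/
lemma integral_map_linearMap_eq_zero {E F : Type*} [NormedAddCommGroup E] [NormedSpace ℝ E]
    [FiniteDimensional ℝ E] [MeasurableSpace E] [BorelSpace E] [NormedAddCommGroup F]
    [NormedSpace ℝ F] [FiniteDimensional ℝ F] [MeasurableSpace F] [BorelSpace F] {P : Measure E}
    [IsGaussian P] (hP : ∫ x, x ∂P = 0) (ℓ : E →ₗ[ℝ] F) : ∫ x, x ∂(P.map ℓ) = 0 := by
  have hc : Continuous ℓ := ℓ.continuous_of_finiteDimensional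
  have h1 : ∫ x, x ∂(P.map ℓ) = ∫ w, ℓ w ∂P :=
    integral_map hc.measurable.aemeasurable aestronglyMeasurable_id
  rw [h1]
  have h2 := ContinuousLinearMap.integral_comp_id_comm (μ := P) IsGaussian.integrable_id
    (LinearMap.toContinuousLinearMap ℓ)
  refine h2.trans ?_
  rw [hP, map_zero]

variable {dη dΘ dY : ℕ} {U : Type*} [MeasurableSpace U] {E : ExpFamily dη dY}
  {e : Estimators dη dΘ dY U} {θ₀ : Vec dΘ}

lemma measurable_scoreStat {n : ℕ} :
    Measurable (scoreStat E θ₀ : (Fin n → DataPt dη dΘ dY) → Vec dΘ) := by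
  have h : Measurable fun z : Fin n → DataPt dη dΘ dY =>
      (√(n : ℝ))⁻¹ • ∑ i, score E θ₀ (z i) := by
    have := measurable_score (E := E) (θ₀ := θ₀)
    fun_prop
  exact h

lemma measurable_jointStat (n G : ℕ) : Measurable (jointStat E e θ₀ n G) := by
  refine measurable_pi_lambda _ fun g => Measurable.prodMk ?_ ?_
  · exact measurable_scoreStat.comp ((measurable_pi_apply g).comp measurable_snd)
  · have h1 : Measurable fun p : U × History dη dΘ dY n G =>
        (p.1, truncate (Nat.succ_le_of_lt g.isLt) p.2) :=
      measurable_fst.prodMk (measurable_pi_lambda _ fun j =>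
        (measurable_pi_apply (Fin.castLE _ j)).comp measurable_snd)
    have h2 : Measurable fun p : U × History dη dΘ dY n G =>
        e.est n (g + 1) (p.1, truncate (Nat.succ_le_of_lt g.isLt) p.2) :=
      (e.measurable_est n _).comp h1
    exact (h2.sub_const θ₀).const_smul √(n : ℝ)

/-- The linear map that takes the limits of the stacked weighted sums to the limits of the score
statistics and the rescaled estimation errors. -/
noncomputable def limitMap (G d : ℕ) (M : Fin G → Matrix (Fin d) (Fin d) ℝ) :
    EuclideanSpace ℝ (Fin G × (Fin d ⊕ Fin d)) →ₗ[ℝ] (Fin G → Vec d × Vec d) :=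
  LinearMap.pi fun g =>
    (LinearMap.pi fun a => (EuclideanSpace.proj (𝕜 := ℝ) (g, Sum.inl a)).toLinearMap).prod
      ((M g).mulVecLin ∘ₗ
        LinearMap.pi fun b => (EuclideanSpace.proj (𝕜 := ℝ) (g, Sum.inr b)).toLinearMap)

variable {q : Kernel (Vec dη) (Vec dY)} [IsMarkovKernel q] {H : Measure (Feature dη dΘ)}
  [IsProbabilityMeasure H] {ν : Measure U} [IsProbabilityMeasure ν]
  {L : DataPt dη dΘ dY → Vec dΘ → ℝ} {ω : ℕ → ℕ → ℕ → ℕ → U → ℝ} {s : ℝ}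

lemma exists_tendstoInDistribution_stackedSum (hmodel : RegularModel E H θ₀)
    (hω : RegularWeights ω ν) {ψ : DataPt dη dΘ dY → Vec dΘ} (hψ : Measurable ψ)
    (hψ2 : ∀ b, MemLp (fun z => ψ z b) 2 (pointKernel E q H θ₀))
    (hψ0 : ∀ b, ∫ z, ψ z b ∂(pointKernel E q H θ₀) = 0) (G : ℕ) :
    ∃ C : Matrix (Fin G × (Fin dΘ ⊕ Fin dΘ)) (Fin G × (Fin dΘ ⊕ Fin dΘ)) ℝ,
      TendstoInDistribution (fun n => stackedSum ω E θ₀ ψ n G) atTop id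
        (fun n => refLaw E q H θ₀ ν n G) (multivariateGaussian 0 C) := by
  have hξm : Measurable (stackedScore E θ₀ ψ G) := by
    refine measurable_pi_lambda _ fun j => ?_
    rcases j with ⟨g, a | b⟩
    · exact (measurable_pi_apply a).comp measurable_score
    · exact (measurable_pi_apply b).comp hψ
  choose c hc using fun j k => exists_tendstoInProb_stackedWeight_mul (dΘ := dΘ) (G := G) hω j k
  refine ⟨_, tendstoInDistribution_arraySum (ν := ν) (P := pointKernel E q H θ₀) (G := G) hξm
    (w := fun n g i j u => (√(n : ℝ))⁻¹ * stackedWeight ω dΘ n g i j u) ?_ ?_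
    (fun n g i j => (measurable_stackedWeight hω n g i j).const_mul _)
    (fun δ hδ => whp_stackedWeight_lt hω hδ) hc⟩
  · rintro ⟨g, a | b⟩
    · exact memLp_score hmodel a
    · exact hψ2 b
  · rintro ⟨g, a | b⟩
    · exact integral_score hmodel a
    · exact hψ0 b

/-- The limit of the averaged weighted Hessian inverts in probability. -/
lemma exists_tendstoInProb_inv_weightedHess
    (hloss : RegularLoss L (pointKernel E q H θ₀) θ₀) (hω : RegularWeights ω ν) {G : ℕ}
    (hG : 1 ≤ G) :
    ∃ M : Fin dΘ → Fin dΘ → ℝ, TendstoInProb (fun n => refLaw E q H θ₀ ν n G)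
      (fun n p a b => (weightedHess L ω θ₀ n G p)⁻¹ a b) M := by
  obtain ⟨ρ, hρ0, hρ⟩ := hω.mean G hG
  set A : Fin dΘ → Fin dΘ → ℝ := fun a b =>
    ((G : ℝ)⁻¹ * ∑ j ∈ Finset.range G, ρ j) * ∫ z, hess (L z) θ₀ a b ∂(pointKernel E q H θ₀)
  have hdet : (Matrix.of A).det ≠ 0 := by
    have : Matrix.of A = ((G : ℝ)⁻¹ * ∑ j ∈ Finset.range G, ρ j) •
        Matrix.of fun a b => ∫ z, hess (L z) θ₀ a b ∂(pointKernel E q H θ₀) := by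
      ext a b
      rfl
    rw [this, Matrix.det_smul]
    exact mul_ne_zero (pow_ne_zero _ (mul_ne_zero (by positivity) hρ0))
      hloss.hess_invertible.ne_zero
  exact ⟨_, (tendstoInProb_weightedHess hω hloss.hess_integrable hG hρ).comp
    (continuousAt_matrix_inv hdet)⟩

lemma whp_of_isAAL (hAAL : IsAAL e L ω s E q H θ₀ ν) {k G : ℕ} (hk : 1 ≤ k) (hkG : k ≤ G) {ε : ℝ}
    (hε : 0 < ε) : WHP (fun n => refLaw E q H θ₀ ν n G) fun n p =>
      ‖√((n : ℝ) * k) • (e.est n k (p.1, truncate hkG p.2) - θ₀) -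
        s • linearTerm L ω θ₀ n k (p.1, truncate hkG p.2)‖ < ε := by
  refine WHP.of_truncate hkG (p := fun n p => ‖√((n : ℝ) * k) • (e.est n k p - θ₀) -
    s • linearTerm L ω θ₀ n k p‖ < ε) ?_
  have := hAAL k hk ε hε
  simp only [WHP, not_lt]
  exact this

/-- Joint asymptotic normality of the score statistics and the estimators under the reference
law. -/
theorem exists_gaussian_tendstoInDistribution_jointStat (hmodel : RegularModel E H θ₀)
    (hloss : RegularLoss L (pointKernel E q H θ₀) θ₀) (hω : RegularWeights ω ν)
    (hs : s = 1 ∨ s = -1) (hAAL : IsAAL e L ω s E q H θ₀ ν) (G : ℕ) :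
    ∃ γ : ProbabilityMeasure (Fin G → Vec dΘ × Vec dΘ),
      IsGaussian (γ : Measure (Fin G → Vec dΘ × Vec dΘ)) ∧
      ∫ w, w ∂(γ : Measure (Fin G → Vec dΘ × Vec dΘ)) = 0 ∧
      TendstoInDistribution (fun n => jointStat E e θ₀ n G) atTop id
        (fun n => refLaw E q H θ₀ ν n G) γ := by
  have hae : ∀ b, AEMeasurable (fun z => grad (L z) θ₀ b) (pointKernel E q H θ₀) := fun b =>
    (hloss.grad_sq b).1.aemeasurable
  -- The loss gradient is only almost everywhere measurable, so the central limit theorem is applied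
  -- to a measurable version.
  set ψ : DataPt dη dΘ dY → Vec dΘ := fun z b => (hae b).mk _ z with hψ
  have hψm : Measurable ψ := measurable_pi_lambda _ fun b => (hae b).measurable_mk
  have hψb : ∀ b, (fun z => grad (L z) θ₀ b) =ᵐ[pointKernel E q H θ₀] fun z => ψ z b :=
    fun b => (hae b).ae_eq_mk
  have hψae : ∀ᵐ z ∂(pointKernel E q H θ₀), grad (L z) θ₀ = ψ z := by
    filter_upwards [ae_all_iff.2 hψb] with z hz using funext hz
  clear_value ψ
  obtain ⟨C, hC⟩ := exists_tendstoInDistribution_stackedSum (q := q) (ν := ν) hmodel hω hψm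
    (fun b => (memLp_congr_ae (hψb b)).1 (hloss.grad_sq b))
    (fun b => (integral_congr_ae (hψb b)).symm.trans (hloss.grad_mean b)) G
  choose M hM using fun g : Fin G =>
    exists_tendstoInProb_inv_weightedHess (q := q) hloss hω (Nat.le_add_left 1 (g : ℕ))
  -- Index `g` carries the estimator of generation k = g + 1. Passing from √(nk) to √n on the left
  -- and separating 1/√n from 1/√(nk) on the right gives 1/√k twice, hence the factor s/k.
  set ℓ := limitMap G dΘ fun g => (s / (g + 1 : ℕ)) • Matrix.of (M g) with hℓ
  have hℓc : Continuous ℓ := ℓ.continuous_of_finiteDimensional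
  have hGauss : IsGaussian ((multivariateGaussian 0 C).map ℓ) := isGaussian_map_linearMap ℓ
  refine ⟨⟨(multivariateGaussian 0 C).map ℓ, inferInstance⟩, hGauss,
    integral_map_linearMap_eq_zero integral_id_multivariateGaussian ℓ, ?_⟩
  have hlin : TendstoInDistribution (fun n p => ℓ (stackedSum ω E θ₀ ψ n G p)) atTop id
      (fun n => refLaw E q H θ₀ ν n G) ((multivariateGaussian 0 C).map ℓ) := by
    have h := hC.continuous_comp hℓc
    refine ⟨h.forall_aemeasurable, aemeasurable_id, ?_⟩
    have h2 := h.tendsto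
    simp only [Function.comp_id] at h2
    simp only [Measure.map_id]
    exact h2
  refine hlin.of_sub_tendstoInProb (fun n => (measurable_jointStat n G).aemeasurable) ?_
  refine TendstoInProb.pi fun g => TendstoInProb.prodMk (c := 0) (d := 0) ?_ ?_
  · refine (tendstoInProb_of_tendsto tendsto_const_nhds).congr fun n =>
      Eventually.of_forall fun p => ?_
    symm
    change scoreStat E θ₀ (p.2 g) - (fun a => stackedSum ω E θ₀ ψ n G p (g, Sum.inl a)) = 0
    rw [stackedSum_inl, sub_self]
  · intro ε hε
    have hg : (g : ℕ) + 1 ≤ G := Nat.succ_le_of_lt g.isLt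
    -- Tightness of the stacked sum allows bounding it by K. Then δ is chosen so that a
    -- Hessian-inverse error of size δ acting on such a vector contributes at most ε / 2; the other
    -- half goes to the linearisation error.
    refine hC.whp_of_bounded fun K => ?_
    set δ := ε / (2 * (dΘ * |K| + 1)) with hδ
    have hδ0 : 0 < δ := by positivity
    have h1 := whp_of_isAAL hAAL (Nat.le_add_left 1 (g : ℕ)) hg (half_pos hε)
    have h2 := WHP.of_truncate hg (hM g δ hδ0)
    refine (h1.and h2).mono_ae (Eventually.of_forall fun n => ?_)
    filter_upwards [ae_arrayLaw (ν := ν) (G := G) (n := n) hψae] with p hp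
    rintro ⟨h1, h2⟩ hK
    rw [sub_zero]
    have hN := stackedSum_inr (ω := ω) (E := E) hp g
    set N : Vec dΘ := fun b => stackedSum ω E θ₀ ψ n G p (g, Sum.inr b) with hNdef
    have hNK : ‖N‖ ≤ |K| := by
      refine (pi_norm_le_iff_of_nonneg (abs_nonneg _)).2 fun b => ?_
      exact (PiLp.norm_apply_le _ _).trans (hK.trans (le_abs_self K))
    change ‖√(n : ℝ) • (e.est n (g + 1) (p.1, truncate hg p.2) - θ₀) -
      ((s / (g + 1 : ℕ)) • Matrix.of (M g)) *ᵥ N‖ < ε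
    rw [Matrix.smul_mulVec, sqrt_smul_sub_eq (Nat.succ_pos g) (p.1, truncate hg p.2) s _ N
      (Matrix.of (M g)) hN]
    have hg1 : (1 : ℝ) ≤ (g + 1 : ℕ) := by exact_mod_cast Nat.le_add_left 1 (g : ℕ)
    have hs1 : |s| = 1 := by rcases hs with h | h <;> simp [h]
    refine (norm_add_le _ _).trans_lt ?_
    rw [norm_smul, norm_smul]
    have e1 : ‖(√((g + 1 : ℕ) : ℝ))⁻¹‖ ≤ 1 := by
      rw [Real.norm_of_nonneg (by positivity)]
      exact inv_le_one_of_one_le₀ (Real.one_le_sqrt.2 hg1)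
    have e2 : ‖s / (g + 1 : ℕ)‖ ≤ 1 := by
      rw [norm_div, Real.norm_eq_abs, hs1, Real.norm_of_nonneg (by positivity)]
      exact div_le_one_of_le₀ hg1 (by positivity)
    -- The difference of the inverse matrices is treated as a feature, which gives a bound on its
    -- action by the entrywise sup norm.
    have e3 := norm_natParam_le
      (fun a b => (weightedHess L ω θ₀ n (g + 1) (p.1, truncate hg p.2))⁻¹ a b - M g a b) N
    have e4 : dΘ * δ * |K| ≤ ε / 2 := by
      rw [hδ]
      rw [show (dΘ : ℝ) * (ε / (2 * (dΘ * |K| + 1))) * |K| =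
        (ε / 2) * ((dΘ * |K|) / (dΘ * |K| + 1)) by field_simp]
      exact mul_le_of_le_one_right (by positivity)
        (div_le_one_of_le₀ (by linarith) (by positivity))
    have e5 : ‖((weightedHess L ω θ₀ n (g + 1) (p.1, truncate hg p.2))⁻¹ - Matrix.of (M g)) *ᵥ N‖
        ≤ ε / 2 := by
      refine e3.trans (le_trans ?_ e4)
      gcongr
      exact h2.le
    have f1 := mul_le_of_le_one_left (norm_nonneg _) e1 |>.trans_lt h1
    have f2 := (mul_le_of_le_one_left (norm_nonneg _) e2).trans e5
    linarith [f1, f2]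

end ReferenceLimit

instance {ι : Type*} [Fintype ι] [DecidableEq ι] (m : EuclideanSpace ℝ ι) (S : Matrix ι ι ℝ) :
    IsGaussian ((multivariateGaussian m S).map WithLp.ofLp) :=
  isGaussian_map_linearMap (P := multivariateGaussian m S)
    (WithLp.linearEquiv 2 ℝ (ι → ℝ)).toLinearMap

/-! ### Independence of a new score from the past in the limit. -/

section ProductLimit

variable {dη dΘ dY : ℕ} {U : Type*} [MeasurableSpace U] {E : ExpFamily dη dY} {θ₀ : Vec dΘ}
  {q : Kernel (Vec dη) (Vec dY)} [IsMarkovKernel q] {H : Measure (Feature dη dΘ)}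
  [IsProbabilityMeasure H]

lemma tendstoInProb_sum_inv_sqrt_mul {ν : Measure U} :
    TendstoInProb (fun _ => ν) (fun (n : ℕ) (_ : U) =>
      ∑ _g : Fin 1, ∑ _i : Fin n, (√(n : ℝ))⁻¹ * (√(n : ℝ))⁻¹) 1 := by
  refine tendstoInProb_of_tendsto (tendsto_const_nhds.congr' ?_)
  filter_upwards [eventually_ne_atTop 0] with n hn
  rw [← mul_inv, Real.mul_self_sqrt (by positivity)]
  simp [hn]

lemma limitCov_score (hm : RegularModel E H θ₀) :
    limitCov (pointKernel E q H θ₀) (score E θ₀) (fun _ _ => 1) = fisherMatrix E H θ₀ := by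
  ext a b
  rw [limitCov, Matrix.of_apply, one_mul, integral_score_mul hm]

/-- The Fisher matrix is the limit covariance of the score array with all weights equal to 1/√n, so
positivity follows from `limitCov_posSemidef`. -/
lemma posSemidef_fisherMatrix (q : Kernel (Vec dη) (Vec dY)) [IsMarkovKernel q]
    (hm : RegularModel E H θ₀) : (fisherMatrix E H θ₀).PosSemidef := by
  rw [← limitCov_score (q := q) hm]
  exact limitCov_posSemidef (ν := Measure.dirac ()) (memLp_score hm)
    (w := fun n (_ : Fin 1) _ _ _ => (√(n : ℝ))⁻¹) fun _ _ => tendstoInProb_sum_inv_sqrt_mul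

/-- Asymptotic normality of the score statistic of one generation of real data. -/
lemma tendstoInDistribution_scoreStat (hm : RegularModel E H θ₀) :
    TendstoInDistribution (fun n (z : Fin n → DataPt dη dΘ dY) => scoreStat E θ₀ z) atTop id
      (fun n => Measure.pi fun _ : Fin n => pointKernel E q H θ₀)
      ((multivariateGaussian 0 (fisherMatrix E H θ₀)).map WithLp.ofLp) := by
  have hCLT := tendstoInDistribution_arraySum (ν := Measure.dirac ())
    (P := pointKernel E q H θ₀) (G := 1) measurable_score (memLp_score hm) (integral_score hm)
    (w := fun n (_ : Fin 1) _ _ _ => (√(n : ℝ))⁻¹) (fun _ _ _ _ => measurable_const)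
    (fun δ hδ => WHP.of_eventually ?_) (c := fun _ _ => 1)
    fun _ _ => tendstoInProb_sum_inv_sqrt_mul
  · rw [limitCov_score hm] at hCLT
    have h := (hCLT.continuous_comp (PiLp.continuous_ofLp 2 _)).tendsto
    refine ⟨fun n => measurable_scoreStat.aemeasurable, aemeasurable_id, ?_⟩
    simp only [Function.comp_id] at h
    simp only [Measure.map_id]
    refine h.congr fun n => Subtype.ext ?_
    have hev : Measurable fun p : Unit × (Fin 1 → Fin n → DataPt dη dΘ dY) => p.2 0 := by fun_prop
    have hlaw : (arrayLaw (Measure.dirac ()) (pointKernel E q H θ₀) 1 n).map (fun p => p.2 0) =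
        Measure.pi fun _ : Fin n => pointKernel E q H θ₀ :=
      ((measurePreserving_eval (fun _ : Fin 1 => Measure.pi fun _ : Fin n => pointKernel E q H θ₀)
        0).comp measurePreserving_snd).map_eq
    change Measure.map _ _ = Measure.map _ _
    rw [← hlaw, Measure.map_map measurable_scoreStat hev]
    congr 1
    funext p a
    simp [scoreStat_eq, Finset.mul_sum]
  · filter_upwards [tendsto_inv_sqrt_natCast.eventually_lt_const hδ] with n hn
    refine Eventually.of_forall fun u g i j => ?_
    rwa [abs_of_nonneg (by positivity)]

variable {e : Estimators dη dΘ dY U} {ν : Measure U} [IsProbabilityMeasure ν]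

/-- In the limit, the score statistic of a generation is independent of the past. -/
lemma map_pastPath_score_eq_prod {G : ℕ} {N : Measure (Vec dΘ)} [IsProbabilityMeasure N]
    {γ : ProbabilityMeasure (Fin G → Vec dΘ × Vec dΘ)}
    {γ' : ProbabilityMeasure (Fin (G + 1) → Vec dΘ × Vec dΘ)}
    (hN : TendstoInDistribution (fun n (z : Fin n → DataPt dη dΘ dY) => scoreStat E θ₀ z) atTop id
      (fun n => Measure.pi fun _ : Fin n => pointKernel E q H θ₀) N)
    (hγ : TendstoInDistribution (fun n => jointStat E e θ₀ n G) atTop id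
      (fun n => refLaw E q H θ₀ ν n G) γ)
    (hγ' : TendstoInDistribution (fun n => jointStat E e θ₀ n (G + 1)) atTop id
      (fun n => refLaw E q H θ₀ ν n (G + 1)) γ') :
    (γ' : Measure (Fin (G + 1) → Vec dΘ × Vec dΘ)).map
      (fun w => (pastPath w, (w (Fin.last G)).1)) = (γ : Measure _).prod N := by
  have hc : Continuous fun w : Fin (G + 1) → Vec dΘ × Vec dΘ =>
      (pastPath w, (w (Fin.last G)).1) :=
    continuous_pastPath.prodMk (continuous_fst.comp (continuous_apply (Fin.last G)))
  have h1 := (hγ'.continuous_comp hc).tendsto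
  -- At finite `n` the joint law of past and new score is exactly a product. Products are weakly
  -- continuous, and uniqueness of limits identifies the marginal of `γ'`.
  have h2 := (ProbabilityMeasure.continuous_prod.tendsto _).comp
    (hγ.tendsto.prodMk_nhds hN.tendsto)
  have h3 := tendsto_nhds_unique h1 (h2.congr fun n => Subtype.ext ?_)
  · have h4 := congrArg Subtype.val h3
    simp only [Function.comp_id, Measure.map_id] at h4
    exact h4
  · have hm : Measurable fun p : U × History dη dΘ dY n (G + 1) =>
        (pastPath (jointStat E e θ₀ n (G + 1) p),
          (jointStat E e θ₀ n (G + 1) p (Fin.last G)).1) :=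
      hc.measurable.comp (measurable_jointStat n (G + 1))
    change ((refLaw E q H θ₀ ν n G).map (jointStat E e θ₀ n G)).prod
      ((Measure.pi fun _ : Fin n => pointKernel E q H θ₀).map (scoreStat E θ₀)) =
      (arrayLaw ν (pointKernel E q H θ₀) (G + 1) n).map fun p =>
        (pastPath (jointStat E e θ₀ n (G + 1) p),
          (jointStat E e θ₀ n (G + 1) p (Fin.last G)).1)
    rw [arrayLaw_succ, Measure.map_map hm measurable_snoc_prod,
      Measure.map_prod_map _ _ (measurable_jointStat n G) measurable_scoreStat]
    congr 1
    funext p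
    change _ = (pastPath (jointStat E e θ₀ n (G + 1) (p.1.1, Fin.snoc p.1.2 p.2)),
      (jointStat E e θ₀ n (G + 1) (p.1.1, Fin.snoc p.1.2 p.2) (Fin.last G)).1)
    rw [pastPath_jointStat, pastData_snoc]
    simp only [jointStat, Fin.snoc_last]
    rfl

end ProductLimit

/-! ### Limit under the workflow law. -/

section WorkflowLimit

variable {dη dΘ dY : ℕ} {U : Type*} [MeasurableSpace U] {E : ExpFamily dη dY} {θ₀ : Vec dΘ}
  {q : Kernel (Vec dη) (Vec dY)} [IsMarkovKernel q] {H : Measure (Feature dη dΘ)}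
  [IsProbabilityMeasure H] {e : Estimators dη dΘ dY U} {ν : Measure U} [IsProbabilityMeasure ν]

/-- Limit under the workflow law: Gaussian limits under the reference law imply convergence to the
sequentially generated process. -/
theorem isGaussian_sequentialLaw_and_tendstoInDistribution (hmodel : RegularModel E H θ₀)
    {Γ : (G : ℕ) → ProbabilityMeasure (Fin G → Vec dΘ × Vec dΘ)}
    (hΓ : ∀ G, IsGaussian (Γ G : Measure (Fin G → Vec dΘ × Vec dΘ)))
    (hΓ0 : ∀ G, ∫ w, w ∂(Γ G : Measure (Fin G → Vec dΘ × Vec dΘ)) = 0)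
    (hlim : ∀ G, TendstoInDistribution (fun n => jointStat E e θ₀ n G) atTop id
      (fun n => refLaw E q H θ₀ ν n G) (Γ G)) (G : ℕ) :
    IsGaussian (sequentialLaw (fisherMatrix E H θ₀) Γ G) ∧
      TendstoInDistribution (fun n => jointStat E e θ₀ n G) atTop id
        (fun n => workflowLaw E q H θ₀ ν e n G) (sequentialLaw (fisherMatrix E H θ₀) Γ G) := by
  have hV := posSemidef_fisherMatrix q hmodel
  have hVt : (fisherMatrix E H θ₀)ᵀ = fisherMatrix E H θ₀ := by
    rw [← Matrix.conjTranspose_eq_transpose_of_trivial]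
    exact hV.isHermitian
  obtain ⟨hdens, hgauss⟩ := sequentialLaw_eq_withDensity hVt
    (integral_exp_dotProduct_multivariateGaussian hV) hΓ hΓ0
    (fun G => map_pastPath_score_eq_prod (tendstoInDistribution_scoreStat hmodel) (hlim G)
      (hlim (G + 1))) G
  refine ⟨hgauss, ?_⟩
  obtain ⟨r, hr, B, hB0, hB, hreg⟩ := hmodel.third_bound
  have hΩ : ∀ θ ∈ Metric.closedBall θ₀ r, ∀ᵐ x ∂H, natParam x θ ∈ E.Ω := fun θ hθ => by
    filter_upwards [hreg] with x hx using interior_subset (hx θ hθ).1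
  -- Stating this for an arbitrary `m` lets the equality of measures be substituted together with
  -- the probability instance.
  have key : ∀ (m : Measure (Fin G → Vec dΘ × Vec dΘ)) [IsProbabilityMeasure m],
      m = (Γ G : Measure _).withDensity (expLR (fisherMatrix E H θ₀) G) →
      TendstoInDistribution (fun n => jointStat E e θ₀ n G) atTop id
        (fun n => workflowLaw E q H θ₀ ν e n G) m := by
    rintro m hm rfl
    exact tendstoInDistribution_of_le_likelihoodRatio (continuous_logLR _ G)
      (R := fun n => likelihoodRatio E θ₀ e r n G) (fun n => measurable_likelihoodRatio r n G)
      (fun n => measurable_jointStat n G) (hlim G)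
      (fun n f hf => lintegral_likelihoodRatio_le hΩ hr.le n G hf)
      fun K ε hε => whp_le_likelihoodRatio hmodel hr hB0 hB hreg G K hε
  exact key _ hdens

end WorkflowLimit

end SyntheticData

theorem theorem1 {dη dΘ dY : ℕ} {U : Type*} [MeasurableSpace U]
    (E : SyntheticData.ExpFamily dη dY)
    (q : Kernel (SyntheticData.Vec dη) (SyntheticData.Vec dY)) [IsMarkovKernel q]
    (H : Measure (SyntheticData.Feature dη dΘ)) [IsProbabilityMeasure H]
    (θ₀ : SyntheticData.Vec dΘ) (hmodel : SyntheticData.RegularModel E H θ₀)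
    (ν : Measure U) [IsProbabilityMeasure ν]
    (L : SyntheticData.DataPt dη dΘ dY → SyntheticData.Vec dΘ → ℝ)
    (hloss : SyntheticData.RegularLoss L (SyntheticData.pointKernel E q H θ₀) θ₀)
    (ω : ℕ → ℕ → ℕ → ℕ → U → ℝ) (hω : SyntheticData.RegularWeights ω ν)
    (e : SyntheticData.Estimators dη dΘ dY U) (s : ℝ) (hs : s = 1 ∨ s = -1)
    (hAAL : SyntheticData.IsAAL e L ω s E q H θ₀ ν) :
    ∃ Γ : (G : ℕ) → ProbabilityMeasure
        (Fin G → SyntheticData.Vec dΘ × SyntheticData.Vec dΘ),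
      (∀ G : ℕ,
        IsGaussian (Γ G : Measure (Fin G → SyntheticData.Vec dΘ × SyntheticData.Vec dΘ)) ∧
        ∫ w, w ∂(Γ G : Measure (Fin G → SyntheticData.Vec dΘ × SyntheticData.Vec dΘ)) = 0 ∧
        TendstoInDistribution (fun n => SyntheticData.jointStat E e θ₀ n G) atTop id
          (fun n => SyntheticData.refLaw E q H θ₀ ν n G) (Γ G)) ∧
      (∀ G : ℕ,
        IsGaussian
          (SyntheticData.sequentialLaw (SyntheticData.fisherMatrix E H θ₀) Γ G) ∧
        TendstoInDistribution (fun n => SyntheticData.jointStat E e θ₀ n G) atTop id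
          (fun n => SyntheticData.workflowLaw E q H θ₀ ν e n G)
          (SyntheticData.sequentialLaw (SyntheticData.fisherMatrix E H θ₀) Γ G)) := by
  -- The laws are chosen separately for each `G`. The compatibility of `Γ G` with `Γ (G + 1)` needed
  -- for the sequential law is a consequence of uniqueness of limits, through
  -- `map_pastPath_score_eq_prod`.
  choose Γ hΓ using
    SyntheticData.exists_gaussian_tendstoInDistribution_jointStat hmodel hloss hω hs hAAL
  exact ⟨Γ, hΓ, SyntheticData.isGaussian_sequentialLaw_and_tendstoInDistribution hmodel
    (fun G => (hΓ G).1) (fun G => (hΓ G).2.1) fun G => (hΓ G).2.2⟩
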